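/- Let $AG(4,3)$ be the affine space $GF(3)^4$; a line is a set of three distinct points with vector sum $\vec 0$, a cap is a set of points containing no line, and a maximal cap is a cap of largest possible size. A point $a$ is an anchor point of a set $S$ if $S$ splits into pairs each of which forms a line with $a$. A demicap is a cap consisting of five pairs of points such that each pair forms a line with a common point (its anchor point) and no four of these five lines lie in a common hyperplane. Two disjoint maximal caps form a $1$-completable pair if they belong together to exactly one partition of $AG(4,3)$ into four disjoint maximal caps and one point that is a common anchor point of these caps. Let $C$ be a maximal cap in $AG(4,3)$, and let $G$ be the group of all affine transformations of $AG(4,3)$ that fix $C$ as a set. Then $|G|=2880$, and $C$ has a unique anchor point $a$. Write $-I$ for the point reflection $x\mapsto 2a-x$ (which is $x\mapsto -x$ if $a=\vec0$). There are a maximal cap $C'$ forming a $1$-completable pair with $C$ and disjoint demicaps $C_1,R_1$ with $C_1\cup R_1=C'$ such that $C$ is the set of all points that complete exactly one line with a pair of points of $C_1$ and exactly one line with a pair of points of $R_1$. For every such choice of $C',C_1,R_1$, let $\mathcal R$ be the set of complements of $C_1$ in the maximal caps containing $C_1$, and let $\mathcal C$ be the set of complements of $R_1$ in the maximal caps containing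 $R_1$. Then the following hold. 1. $\mathcal R=\{R_1,\dots,R_6\}$ and $\mathcal C=\{C_1,\dots,C_6\}$ are disjoint families of six demicaps with anchor point $a$, and the maximal caps forming a $1$-completable pair with $C$ are exactly the unions $R_i\cup C_j$; there are 36 of them. 2. $\{I,-I\}$ is a normal subgroup of order 2 in $G$, the quotient $G/\{I,-I\}$ has order 1440, and $\{I,-I\}$ is exactly the set of elements of $G$ fixing all 12 demicaps $R_i,C_j$. Each $g\in G$ either maps each of $\mathcal R,\mathcal C$ onto itself or interchanges $\mathcal R$ and $\mathcal C$, and not both. Modulo $\{I,-I\}$ there are 720 elements of each kind. 3. For every numbering of $\mathcal R$ and of $\mathcal C$ there is an automorphism $\omega$ of $S_6$ that is not inner such that each $g\in G$ preserving $\mathcal R$ and $\mathcal C$ acts by $R_i\mapsto R_{\sigma(i)}$, $C_j\mapsto C_{\omega(\sigma)(j)}$ for some $\sigma\in S_6$, and every $\sigma\in S_6$ occurs in this way. Here $\omega$ sends transpositions to products of three disjoint transpositions and conversely, and it sends 6-cycles to products of a disjoint 2-cycle and 3-cycle. Moreover every bijection $\mathcal R\to\mathcal C$ is induced by some element of $G$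 interchanging $\mathcal R$ and $\mathcal C$. 4. For a suitable numbering of $\mathcal R$ and $\mathcal C$ there is a non-inner automorphism $\omega$ of $S_6$ with $\omega^2=1$ and $\omega((1\,2))=(1\,2)(3\,4)(5\,6)$ such that the elements of $G$ act on the 12 demicaps in exactly the following ways, where $\sigma$ runs through all of $S_6$: either (i) $R_i\mapsto R_{\sigma(i)}$, $C_j\mapsto C_{\omega(\sigma)(j)}$, or (ii) $R_i\mapsto C_{\sigma(i)}$, $C_j\mapsto R_{\omega(\sigma)(j)}$. There is a surjective homomorphism $\Phi:G\to\operatorname{Aut}(S_6)$ with kernel $\{I,-I\}$ that sends an element of the form (i) to conjugation by $\sigma$ and an element of the form (ii) to $\omega$ composed with conjugation by $\sigma$ (conjugation first). The action of $G$ on the 36 caps $R_i\cup C_j$ factors through $\Phi$ as a faithful action of $\operatorname{Aut}(S_6)$; in this sense $G$ acts on the 36 caps as the full automorphism group of $S_6$. -/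

import Mathlib

namespace AG43

/-- The points of `AG(4,3)`: vectors of length four over the field with three elements. -/
abbrev Pt : Type := Fin 4 → ZMod 3

/-- The affine group `Aff(4,3)`. -/
abbrev Aff : Type := Pt ≃ᵃ[ZMod 3] Pt

/-- A line of `AG(4,3)`: three distinct points whose vectors sum to zero. -/
def IsLine (L : Finset Pt) : Prop := L.card = 3 ∧ ∑ x ∈ L, x = 0

instance : DecidablePred IsLine := fun L =>
  inferInstanceAs (Decidable (L.card = 3 ∧ ∑ x ∈ L, x = 0))

/-- A cap is a set of points that contains no line. -/
def IsCap (S : Finset Pt) : Prop := ∀ L : Finset Pt, L ⊆ S → ¬ IsLine L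

/-- A maximal cap is a cap of largest possible size. -/
def IsMaximalCap (C : Finset Pt) : Prop :=
  IsCap C ∧ ∀ S : Finset Pt, IsCap S → S.card ≤ C.card

/-- `a` is an anchor point of `S`: the points of `S` fall into pairs, each of which completes a
line with `a` (the partner of `x` is unique, since a line is determined by two of its points). -/
def IsAnchor (a : Pt) (S : Finset Pt) : Prop := ∀ x ∈ S, ∃ y ∈ S, IsLine {a, x, y}

/-- A demicap with anchor point `a`: a cap consisting of five pairs of points, each completing a
line with `a`, such that no four of these five lines lie in a common hyperplane. -/
def IsDemicapAt (a : Pt) (D : Finset Pt) : Prop :=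
  IsCap D ∧ D.card = 10 ∧
    ∃ d d' : Fin 5 → Pt,
      (∀ i, IsLine {a, d i, d' i}) ∧
      D = Finset.univ.image d ∪ Finset.univ.image d' ∧
      ∀ s : Finset (Fin 5), s.card = 4 →
        ¬ ∃ H : AffineSubspace (ZMod 3) Pt, Module.finrank (ZMod 3) H.direction = 3 ∧
          ∀ i ∈ s, a ∈ H ∧ d i ∈ H ∧ d' i ∈ H

/-- A demicap (with some anchor point). -/
def IsDemicap (D : Finset Pt) : Prop := ∃ a, IsDemicapAt a D

/-- `P` is the set of the four maximal caps of a partition of `AG(4,3)` into four pairwise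
disjoint maximal caps and their common anchor point. -/
def IsCapPartition (P : Finset (Finset Pt)) : Prop :=
  P.card = 4 ∧ (∀ M ∈ P, IsMaximalCap M) ∧
    (∀ M ∈ P, ∀ N ∈ P, M ≠ N → Disjoint M N) ∧
    ∃ a : Pt, (∀ M ∈ P, IsAnchor a M) ∧ P.biUnion id = Finset.univ.erase a

/-- Disjoint maximal caps `C`, `C'` form a `k`-completable pair if exactly `k` such partitions
contain both of them. -/
def IsCompletablePair (k : ℕ) (C C' : Finset Pt) : Prop :=
  IsMaximalCap C ∧ IsMaximalCap C' ∧ Disjoint C C' ∧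
    {P : Finset (Finset Pt) | IsCapPartition P ∧ C ∈ P ∧ C' ∈ P}.ncard = k

/-- The number of pairs of points of `S` with which `p` completes a line. -/
def linesCompleted (p : Pt) (S : Finset Pt) : ℕ :=
  ((S.powersetCard 2).filter fun s => IsLine (insert p s)).card

/-- The points that complete exactly one line with a pair of points of `D` and exactly one line
with a pair of points of `D'`. -/
def correspondingCap (D D' : Finset Pt) : Finset Pt :=
  Finset.univ.filter fun p => linesCompleted p D = 1 ∧ linesCompleted p D' = 1

/-- `{C, C'}` is a 1-completable pair, and `C₁`, `R₁` are disjoint demicaps with union `C'` forming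
the demicap decomposition of `C'` that corresponds to `C`. -/
structure IsCorrespondingDecomposition (C C' C₁ R₁ : Finset Pt) : Prop where
  pair : IsCompletablePair 1 C C'
  left : IsDemicap C₁
  right : IsDemicap R₁
  disj : Disjoint C₁ R₁
  union : C₁ ∪ R₁ = C'
  corr : correspondingCap C₁ R₁ = C

/-- The complements of `D` in the maximal caps that contain `D`. -/
def complements (D : Finset Pt) : Set (Finset Pt) :=
  {E | ∃ M, IsMaximalCap M ∧ D ⊆ M ∧ E = M \ D}

/-- The image of a set of points under an affine transformation. -/
def act (g : Aff) (S : Finset Pt) : Finset Pt := S.image g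

/-- The subgroup of the affine group that fixes `C` as a set. -/
def capStabilizer (C : Finset Pt) : Subgroup Aff where
  carrier := {g | act g C = C}
  one_mem' := by simp [act]
  mul_mem' := by
    intro g h hg hh
    simp only [Set.mem_ofPred_eq, act] at *
    rw [AffineEquiv.coe_mul, ← Finset.image_image, hh, hg]
  inv_mem' := by
    intro g hg
    simp only [Set.mem_ofPred_eq, act] at *
    conv_lhs => rw [← hg]
    rw [Finset.image_image]
    have h : (⇑g⁻¹ ∘ ⇑g) = id := by
      rw [← AffineEquiv.coe_mul, inv_mul_cancel, AffineEquiv.coe_one]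
    rw [h, Finset.image_id]

/-- The subgroup `{I, -I}` of the stabilizer of `C`, where `-I` is the point reflection
`x ↦ 2a - x` in the anchor point `a` of `C` (it is `x ↦ -x` if `a = 0`). -/
def signSubgroup (C : Finset Pt) (a : Pt) : Subgroup (capStabilizer C) :=
  (Subgroup.zpowers (AffineEquiv.pointReflection (ZMod 3) a)).subgroupOf (capStabilizer C)

/-- `g` maps each of the families `𝓡`, `𝓒` onto itself. -/
def Preserves (g : Aff) (𝓡 𝓒 : Set (Finset Pt)) : Prop := act g '' 𝓡 = 𝓡 ∧ act g '' 𝓒 = 𝓒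

/-- `g` interchanges the families `𝓡` and `𝓒`. -/
def Interchanges (g : Aff) (𝓡 𝓒 : Set (Finset Pt)) : Prop := act g '' 𝓡 = 𝓒 ∧ act g '' 𝓒 = 𝓡

/-- `r 0, …, r 5` lists the elements of `𝓢` without repetition. -/
def IsNumbering (r : Fin 6 → Finset Pt) (𝓢 : Set (Finset Pt)) : Prop :=
  Function.Injective r ∧ Set.range r = 𝓢

/-- `g` permutes the `R_i` by `σ` and the `C_j` by `τ`. -/
def PermutesBy (g : Aff) (r c : Fin 6 → Finset Pt) (σ τ : Equiv.Perm (Fin 6)) : Prop :=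
  (∀ i, act g (r i) = r (σ i)) ∧ ∀ j, act g (c j) = c (τ j)

/-- `g` maps `R_i` to `C_{σ i}` and `C_j` to `R_{τ j}`. -/
def SwapsBy (g : Aff) (r c : Fin 6 → Finset Pt) (σ τ : Equiv.Perm (Fin 6)) : Prop :=
  (∀ i, act g (r i) = c (σ i)) ∧ ∀ j, act g (c j) = r (τ j)

/-- An automorphism of `S₆` that is not inner. -/
def IsOuter (ω : MulAut (Equiv.Perm (Fin 6))) : Prop :=
  ∀ π : Equiv.Perm (Fin 6), ω ≠ MulAut.conj π

end AG43

/-! All maximal caps are affinely equivalent, and the standard one has a model that explains the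
theorem. Let S₆ permute the coordinates of GF(3)^6. As 3 divides 6, the vectors of coordinate sum 0
modulo the all-ones vector form a 4-dimensional space; write ε_i for the coordinate vectors and take
e_k = ε_k - ε_{k+1} (k = 0, …, 3) as standard basis. The characteristic vectors of the twenty
3-subsets of the six symbols form `stdCap`. Complementary subsets are antipodal, so the anchor is 0.
Of the other 30 antipodal pairs, 15 are the duads ±(ε_i - ε_j), and 15 are the classes of vectors
such as (1,1,-1,-1,0,0), one for each syntheme (a partition of the symbols into three pairs). The
demicap `stdRow i` consists of the five duads through the symbol i, and `stdCol j` of the five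
synthemes of one of the six totals (sets of five synthemes containing every duad once).

Coordinate permutations act on the rows as on symbols and on the columns as on totals. These two
actions differ by the outer automorphism of S₆. A further linear map (`exists_duality`) exchanges
duads with synthemes and supplies the other coset of S₆ in Aut(S₆). Only ±I fixes all rows
(`eq_one_or_eq_pointReflection`), which gives the order 2·1440.

Uniqueness of the maximal cap (`exists_eq_act_stdCap`) comes from counting points on hyperplanes:
some parallel class meets a 20-cap in 9, 9 and 2 points, and with an affine frame placed in such
slices the rest is a finite search. Further searches, cut down by the symmetries already exhibited,
show that the 1-completable partners are the 36 sets row ∪ column (`isCompletablePair_std`), that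
each has only one decomposition up to order (`decomposition_std_cases`), and that the maximal caps
through a row are its unions with the columns (`complements_stdRow`). Hence every element of the
stabilizer preserves or interchanges the two families (`stabilizer_cases`).

The rest is group theory. The row action determines the column action, which defines the linking
automorphism (`IsConfiguration.exists_link`); every automorphism of S₆ is inner or that automorphism
times an inner one (`exists_eq_conj_or`), which makes Φ surjective. `IsConfiguration` collects the
affinely invariant facts, so that they pass from the standard cap to all maximal caps. -/

namespace AG43

/-! ### Exhaustive search for sets avoiding forbidden triples -/

section Search

/-- The mask with the single bit `x`. -/
def bit (x : ℕ) : ℕ := Nat.shiftLeft 1 x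

/-- The union of the masks `kill x y` for `y` in a list. -/
def killAll (kill : ℕ → ℕ → ℕ) (x : ℕ) : List ℕ → ℕ
  | [] => 0
  | y :: l => Nat.lor (kill x y) (killAll kill x l)

/-- The union of the masks `kill x y` for all pairs in a list. -/
def killPairs (kill : ℕ → ℕ → ℕ) : List ℕ → ℕ
  | [] => 0
  | x :: l => Nat.lor (killAll kill x l) (killPairs kill l)

/-- The mask of a list. -/
def maskOf : List ℕ → ℕ
  | [] => 0
  | x :: l => Nat.lor (bit x) (maskOf l)

/-- Test of a bit of a mask, in a form that the kernel evaluates quickly. -/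
def hasBit (m z : ℕ) : Bool := Bool.not (Nat.beq (Nat.land (Nat.shiftRight m z) 1) 0)

/-- The elements of a list that are not in the mask. -/
def filt (m : ℕ) : List ℕ → List ℕ
  | [] => []
  | z :: l => bif hasBit m z then filt m l else z :: filt m l

/-- The list has at least `n` entries. -/
def atLeast : ℕ → List ℕ → Bool
  | 0, _ => true
  | _ + 1, [] => false
  | n + 1, _ :: l => atLeast n l

/-- All extensions of `cur` by `n` elements of the list of candidates in which no two elements
forbid a third one. -/
def search (kill : ℕ → ℕ → ℕ) :
    ℕ → List ℕ → List ℕ → ℕ → List (List ℕ) → List (List ℕ)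
  | _, _, cur, 0, acc => cur :: acc
  | 0, _, _, _ + 1, acc => acc
  | _ + 1, [], _, _ + 1, acc => acc
  | f + 1, x :: xs, cur, n + 1, acc =>
    -- Branches with too few candidates are cut: besides `x`, another `n` are needed. The results of
    -- the branch without `x` serve as accumulator for the branch with `x`.
    bif atLeast n xs then
      search kill f (filt (killAll kill x cur) xs) (x :: cur) n (search kill f xs cur (n + 1) acc)
    else acc

/-- The search started from `cur`. -/
def extensions (kill : ℕ → ℕ → ℕ) (cur av : List ℕ) (n : ℕ) : List (List ℕ) :=
  search kill av.length (filt (killPairs kill cur) av) cur n []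

/-- No two elements of the set forbid a third one. -/
def Free (kill : ℕ → ℕ → ℕ) (P : Finset ℕ) : Prop :=
  ∀ x ∈ P, ∀ y ∈ P, ∀ z ∈ P, x ≠ y → z ≠ x → z ≠ y → hasBit (kill x y) z = false

theorem hasBit_eq (m z : ℕ) : hasBit m z = m.testBit z := by
  unfold hasBit Nat.testBit
  change (!(Nat.beq ((m >>> z) &&& 1) 0)) = _
  rw [Nat.land_comm, Bool.eq_iff_iff, Bool.not_eq_true', ← Bool.not_eq_true, Nat.beq_eq,
    bne_iff_ne]

theorem hasBit_lor (m m' z : ℕ) : hasBit (Nat.lor m m') z = (hasBit m z || hasBit m' z) := by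
  simp only [hasBit_eq]
  exact Nat.testBit_or ..

theorem hasBit_bit (x z : ℕ) : hasBit (bit x) z = true ↔ z = x := by
  rw [hasBit_eq]
  change ((1 <<< x).testBit z) = true ↔ _
  rw [Nat.one_shiftLeft, Nat.testBit_two_pow]
  simp [eq_comm]

theorem hasBit_zero (z : ℕ) : hasBit 0 z = false := by
  rw [hasBit_eq, Nat.zero_testBit]

theorem hasBit_killAll {kill : ℕ → ℕ → ℕ} {x z : ℕ} {l : List ℕ} :
    hasBit (killAll kill x l) z = true ↔ ∃ y ∈ l, hasBit (kill x y) z = true := by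
  induction l with
  | nil => simp [killAll, hasBit_zero]
  | cons y l ih => rw [killAll, hasBit_lor]; simp [ih]

theorem hasBit_maskOf {z : ℕ} {l : List ℕ} : hasBit (maskOf l) z = true ↔ z ∈ l := by
  induction l with
  | nil => simp [maskOf, hasBit_zero]
  | cons y l ih => rw [maskOf, hasBit_lor]; simp [ih, hasBit_bit]

theorem mem_filt {m z : ℕ} {l : List ℕ} : z ∈ filt m l ↔ z ∈ l ∧ hasBit m z = false := by
  induction l with
  | nil => simp [filt]
  | cons y l ih =>
    rw [filt]
    cases h : hasBit m y
    · simp only [cond_false, List.mem_cons, ih]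
      constructor
      · rintro (rfl | h')
        · exact ⟨.inl rfl, h⟩
        · exact ⟨.inr h'.1, h'.2⟩
      · rintro ⟨rfl | h', h2⟩
        · exact .inl rfl
        · exact .inr ⟨h', h2⟩
    · simp only [cond_true, List.mem_cons, ih]
      constructor
      · exact fun h' => ⟨.inr h'.1, h'.2⟩
      · rintro ⟨rfl | h', h2⟩
        · rw [h] at h2; cases h2
        · exact ⟨h', h2⟩

theorem filt_sublist (m : ℕ) (l : List ℕ) : (filt m l).Sublist l := by
  induction l with
  | nil => exact .slnil
  | cons y l ih =>
    rw [filt]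
    cases hasBit m y
    · exact ih.cons_cons y
    · exact ih.cons y

theorem atLeast_iff {n : ℕ} {l : List ℕ} : atLeast n l = true ↔ n ≤ l.length := by
  induction n generalizing l with
  | zero => simp [atLeast]
  | succ n ih => cases l <;> simp [atLeast, ih]

theorem acc_subset_search (kill : ℕ → ℕ → ℕ) (f : ℕ) (av cur : List ℕ) (n : ℕ)
    (acc : List (List ℕ)) : acc ⊆ search kill f av cur n acc := by
  induction f generalizing av cur n acc with
  | zero => cases n <;> simp [search]
  | succ f ih =>
    cases n with
    | zero => simp [search]
    | succ n =>
      cases av with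
      | nil => simp [search]
      | cons x xs =>
        rw [search]
        cases atLeast n xs
        · simp
        · exact List.Subset.trans (ih _ _ _ _) (ih _ _ _ _)

/-- Completeness of the search: a candidate dropped by `filt` is forbidden by two elements already
chosen, so it cannot lie in the free set `P`. The number `f` is fuel and only has to bound the
number of candidates. -/
theorem mem_search {kill : ℕ → ℕ → ℕ} {P : Finset ℕ} (hP : Free kill P) (f : ℕ)
    (av cur : List ℕ) (n : ℕ) (acc : List (List ℕ)) (hf : av.length ≤ f)
    (hnd : (cur ++ av).Nodup) (hcur : ∀ y ∈ cur, y ∈ P) (hsub : ∀ y ∈ P, y ∈ cur ∨ y ∈ av)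
    (hcard : P.card = cur.length + n) :
    ∃ l ∈ search kill f av cur n acc, l.toFinset = P := by
  have hndc : cur.Nodup := (List.nodup_append.1 hnd).1
  induction f generalizing av cur n acc with
  | zero =>
    have hav : av = [] := List.length_eq_zero_iff.1 (by omega)
    subst hav
    have hPc : cur.toFinset = P := by
      ext y
      rw [List.mem_toFinset]
      exact ⟨hcur y, fun h => by simpa using hsub y h⟩
    have hn : n = 0 := by
      rw [← hPc, List.toFinset_card_of_nodup hndc] at hcard
      omega
    subst hn
    exact ⟨cur, by simp [search], hPc⟩
  | succ f ih =>
    cases n with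
    | zero =>
      refine ⟨cur, by simp [search], ?_⟩
      apply Finset.eq_of_subset_of_card_le
      · intro y hy
        exact hcur y (List.mem_toFinset.1 hy)
      · rw [List.toFinset_card_of_nodup hndc]
        omega
    | succ n =>
      have hle : P.card ≤ cur.length + av.length := by
        rw [← List.length_append, ← List.toFinset_card_of_nodup hnd]
        apply Finset.card_le_card
        intro y hy
        simpa using hsub y hy
      cases av with
      | nil => simp at hle; omega
      | cons x xs =>
        rw [search]
        have hlen : atLeast n xs = true := by
          rw [atLeast_iff]
          simp at hle
          omega
        rw [hlen, cond_true]
        simp only [List.length_cons] at hf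
        by_cases hx : x ∈ P
        · refine ih _ _ _ _ ((filt_sublist _ _).length_le.trans (by omega)) ?_ ?_ ?_ ?_ ?_
          · have h1 : (x :: cur ++ xs).Nodup :=
              (List.perm_middle (a := x) (l₁ := cur) (l₂ := xs)).nodup_iff.1 hnd
            exact h1.sublist ((filt_sublist _ _).append_left (x :: cur))
          · simpa using ⟨hx, hcur⟩
          · intro y hy
            by_cases hyx : y ∈ x :: cur
            · exact .inl hyx
            refine .inr (mem_filt.2 ⟨?_, ?_⟩)
            · rcases hsub y hy with h | h
              · exact absurd (List.mem_cons_of_mem x h) hyx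
              · rcases List.mem_cons.1 h with rfl | h
                · exact absurd List.mem_cons_self hyx
                · exact h
            · rw [Bool.eq_false_iff, ne_eq, hasBit_killAll]
              rintro ⟨w, hw, hk⟩
              have hxw : x ≠ w := by
                rintro rfl
                exact (List.nodup_append.1 hnd).2.2 _ hw _ List.mem_cons_self rfl
              rw [hP x hx w (hcur w hw) y hy hxw (by rintro rfl; simp at hyx)
                (by rintro rfl; exact hyx (List.mem_cons_of_mem x hw))] at hk
              cases hk
          · simp; omega
          · exact ((List.perm_middle (a := x) (l₁ := cur) (l₂ := xs)).nodup_iff.1 hnd).sublist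
              (List.sublist_append_left (x :: cur) xs)
        · obtain ⟨l, hl, hlP⟩ := ih xs cur (n + 1) acc (by omega)
            (hnd.sublist ((List.sublist_cons_self x xs).append_left cur)) hcur (by
              intro y hy
              rcases hsub y hy with h | h
              · exact .inl h
              · rcases List.mem_cons.1 h with rfl | h
                · exact absurd hy hx
                · exact .inr h) hcard hndc
          exact ⟨l, acc_subset_search _ _ _ _ _ _ hl, hlP⟩

theorem hasBit_killPairs {kill : ℕ → ℕ → ℕ} {P : Finset ℕ} (hP : Free kill P) {l : List ℕ}
    (hl : l.Nodup) (hlP : ∀ y ∈ l, y ∈ P) {z : ℕ} (hz : z ∈ P) (hzl : z ∉ l) :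
    hasBit (killPairs kill l) z = false := by
  induction l with
  | nil => exact hasBit_zero z
  | cons x l ih =>
    simp only [List.nodup_cons, List.mem_cons, forall_eq_or_imp, not_or] at hl hlP hzl
    rw [killPairs, hasBit_lor, ih hl.2 hlP.2 hzl.2, Bool.or_false, Bool.eq_false_iff, ne_eq,
      hasBit_killAll]
    rintro ⟨y, hy, hk⟩
    rw [hP x hlP.1 y (hlP.2 y hy) z hz (by rintro rfl; exact hl.1 hy) hzl.1
      (by rintro rfl; exact hzl.2 hy)] at hk
    cases hk

theorem mem_extensions {kill : ℕ → ℕ → ℕ} {P : Finset ℕ} (hP : Free kill P)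
    (cur av : List ℕ) (n : ℕ) (hnd : (cur ++ av).Nodup) (hcur : ∀ y ∈ cur, y ∈ P)
    (hsub : ∀ y ∈ P, y ∈ cur ∨ y ∈ av) (hcard : P.card = cur.length + n) :
    ∃ l ∈ extensions kill cur av n, l.toFinset = P := by
  refine mem_search hP _ _ _ _ _ (filt_sublist _ _).length_le
    (hnd.sublist ((filt_sublist _ _).append_left cur)) hcur ?_ hcard
  intro y hy
  by_cases hyc : y ∈ cur
  · exact .inl hyc
  · exact .inr (mem_filt.2 ⟨(hsub y hy).resolve_left hyc,
      hasBit_killPairs hP (List.nodup_append.1 hnd).1 hcur hy hyc⟩)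

theorem Free.mono {kill : ℕ → ℕ → ℕ} {P P' : Finset ℕ} (hP : Free kill P) (h : P' ⊆ P) :
    Free kill P' :=
  fun x hx y hy z hz => hP x (h hx) y (h hy) z (h hz)

end Search

end AG43

namespace AG43

/-! ### Points of `AG(4,3)` coded by natural numbers -/

section Codes

/-- The point with code `c`; the digits `0, 1, 2` of `c` in base three stand for `-1, 0, 1`. -/
def dec (c : ℕ) : Pt :=
  ![((c % 3 : ℕ) : ZMod 3) - 1, ((c / 3 % 3 : ℕ) : ZMod 3) - 1,
    ((c / 9 % 3 : ℕ) : ZMod 3) - 1, ((c / 27 % 3 : ℕ) : ZMod 3) - 1]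

/-- The code of a point. -/
def enc (p : Pt) : ℕ :=
  (p 0 + 1).val + 3 * (p 1 + 1).val + 9 * (p 2 + 1).val + 27 * (p 3 + 1).val

/-- The code of the third point on the line through two points. -/
def third (x y : ℕ) : ℕ :=
  -- The constant is a table with four bits per entry: entry 9a + b is the third-point map on two
  -- base-nine digits, each of which encodes two coordinates.
  let t := fun a b => Nat.land (Nat.shiftRight
    0x867201534678012345786120453201534867012345678120453786534867201345678012453786120
    (Nat.mul 4 (Nat.add (Nat.mul 9 a) b))) 15
  Nat.add (Nat.mul 9 (t (Nat.div x 9) (Nat.div y 9))) (t (Nat.mod x 9) (Nat.mod y 9))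

/-- The code of the negative of a point. -/
def negc (x : ℕ) : ℕ := Nat.sub 80 x

/-- The code of the sum of two points. -/
def addc (x y : ℕ) : ℕ := negc (third x y)

theorem enc_lt (p : Pt) : enc p < 81 := by
  have h (i : Fin 4) : (p i + 1).val < 3 := ZMod.val_lt _
  have h0 := h 0; have h1 := h 1; have h2 := h 2; have h3 := h 3
  unfold enc
  omega

theorem dec_enc (p : Pt) : dec (enc p) = p := by
  have h (i : Fin 4) : (p i + 1).val < 3 := ZMod.val_lt _
  have h0 := h 0; have h1 := h 1; have h2 := h 2; have h3 := h 3
  have e0 : enc p % 3 = (p 0 + 1).val := by unfold enc; omega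
  have e1 : enc p / 3 % 3 = (p 1 + 1).val := by unfold enc; omega
  have e2 : enc p / 9 % 3 = (p 2 + 1).val := by unfold enc; omega
  have e3 : enc p / 27 % 3 = (p 3 + 1).val := by unfold enc; omega
  unfold dec
  rw [e0, e1, e2, e3]
  funext i
  fin_cases i <;> simp

theorem val_digit (a : ℕ) : (((a % 3 : ℕ) : ZMod 3) - 1 + 1).val = a % 3 := by
  rw [sub_add_cancel, ZMod.val_natCast, Nat.mod_mod]

theorem enc_dec {c : ℕ} (hc : c < 81) : enc (dec c) = c := by
  unfold enc dec
  simp only [Matrix.cons_val_zero, Matrix.cons_val_one, Matrix.cons_val, val_digit]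
  omega

theorem dec_injective {c d : ℕ} (hc : c < 81) (hd : d < 81) (h : dec c = dec d) : c = d := by
  rw [← enc_dec hc, h, enc_dec hd]

/-- The digit 1 stands for the coordinate 0, so the origin is 40 = 1 + 3 + 9 + 27 and the standard
basis vectors 40 + 3^k have codes 41, 43, 49, 67. -/
theorem dec_forty : dec 40 = 0 := by
  funext i
  fin_cases i <;> rfl

theorem forall_pt {p : Pt → Prop} : (∀ x, p x) ↔ ∀ c < 81, p (dec c) :=
  ⟨fun h c _ => h _, fun h x => by rw [← dec_enc x]; exact h _ (enc_lt x)⟩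

/-- Correctness of the table, digit by digit. The shift of each digit by -1 does not matter, since
three shifts add up to 0 modulo 3. -/
theorem digits_third : ∀ x < 81, ∀ y < 81, third x y < 81 ∧
    (third x y % 3 + x % 3 + y % 3) % 3 = 0 ∧
    (third x y / 3 % 3 + x / 3 % 3 + y / 3 % 3) % 3 = 0 ∧
    (third x y / 9 % 3 + x / 9 % 3 + y / 9 % 3) % 3 = 0 ∧
    (third x y / 27 % 3 + x / 27 % 3 + y / 27 % 3) % 3 = 0 := by
  decide +kernel

theorem third_lt {x y : ℕ} (hx : x < 81) (hy : y < 81) : third x y < 81 :=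
  (digits_third x hx y hy).1

theorem dec_third {x y : ℕ} (hx : x < 81) (hy : y < 81) :
    dec (third x y) = -(dec x + dec y) := by
  have key {a b c : ℕ} (h : (a + b + c) % 3 = 0) :
      ((a : ℕ) : ZMod 3) - 1 = -((((b : ℕ) : ZMod 3) - 1) + (((c : ℕ) : ZMod 3) - 1)) := by
    have h1 : ((a + b + c : ℕ) : ZMod 3) = 0 := (ZMod.natCast_eq_zero_iff _ _).2
      (Nat.dvd_of_mod_eq_zero h)
    push_cast at h1
    have h3 : (3 : ZMod 3) = 0 := rfl
    linear_combination h1 - h3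
  obtain ⟨-, h0, h1, h2, h3⟩ := digits_third x hx y hy
  funext i
  fin_cases i
  · exact key h0
  · exact key h1
  · exact key h2
  · exact key h3

theorem negc_lt {x : ℕ} : negc x < 81 := by
  change 80 - x < 81
  omega

theorem dec_negc {x : ℕ} (hx : x < 81) : dec (negc x) = -dec x := by
  have : ∀ x < 81, negc x = third x 40 := by decide +kernel
  rw [this x hx, dec_third hx (by norm_num), dec_forty, add_zero]

theorem addc_lt {x y : ℕ} : addc x y < 81 := negc_lt

theorem dec_addc {x y : ℕ} (hx : x < 81) (hy : y < 81) : dec (addc x y) = dec x + dec y := by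
  rw [addc, dec_negc (third_lt hx hy), dec_third hx hy, neg_neg]

/-- The codes of the points of a set. -/
def codes (S : Finset Pt) : Finset ℕ := S.image enc

theorem enc_injective : Function.Injective enc := fun p q h => by
  rw [← dec_enc p, h, dec_enc]

theorem mem_codes {S : Finset Pt} {c : ℕ} : c ∈ codes S ↔ c < 81 ∧ dec c ∈ S := by
  rw [codes, Finset.mem_image]
  constructor
  · rintro ⟨p, hp, rfl⟩
    exact ⟨enc_lt p, by rwa [dec_enc]⟩
  · exact fun h => ⟨dec c, h.2, enc_dec h.1⟩

theorem card_codes (S : Finset Pt) : (codes S).card = S.card :=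
  Finset.card_image_of_injective _ enc_injective

/-- The set of points with codes in a list. -/
def pts (l : List ℕ) : Finset Pt := (l.map dec).toFinset

theorem mem_pts {l : List ℕ} {p : Pt} : p ∈ pts l ↔ ∃ c ∈ l, dec c = p := by
  simp [pts]

/-- All entries are codes of points. -/
def IsCodeList (l : List ℕ) : Prop := ∀ c ∈ l, c < 81

instance : DecidablePred IsCodeList := fun l => inferInstanceAs (Decidable (∀ c ∈ l, c < 81))

theorem dec_mem_pts {l : List ℕ} (hl : IsCodeList l) {c : ℕ} (hc : c < 81) :
    dec c ∈ pts l ↔ c ∈ l := by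
  rw [mem_pts]
  constructor
  · rintro ⟨d, hd, h⟩
    rwa [← dec_injective (hl d hd) hc h]
  · exact fun h => ⟨c, h, rfl⟩

theorem pts_codes {S : Finset Pt} {l : List ℕ} (h : l.toFinset = codes S) : pts l = S := by
  ext p
  rw [mem_pts]
  constructor
  · rintro ⟨c, hc, rfl⟩
    exact (mem_codes.1 (h ▸ List.mem_toFinset.2 hc)).2
  · intro hp
    refine ⟨enc p, ?_, dec_enc p⟩
    rw [← List.mem_toFinset, h, mem_codes]
    exact ⟨enc_lt p, by rwa [dec_enc]⟩

theorem codes_pts {l : List ℕ} (hl : IsCodeList l) : codes (pts l) = l.toFinset := by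
  ext c
  rw [mem_codes, List.mem_toFinset]
  constructor
  · exact fun h => (dec_mem_pts hl h.1).1 h.2
  · exact fun h => ⟨hl c h, (dec_mem_pts hl (hl c h)).2 h⟩

theorem card_pts {l : List ℕ} (hl : IsCodeList l) (hnd : l.Nodup) : (pts l).card = l.length := by
  rw [← card_codes, codes_pts hl, List.toFinset_card_of_nodup hnd]

/-- Turns equality of point sets, whatever the order of the lists, into one comparison of natural
numbers. -/
theorem pts_congr {l l' : List ℕ} (h : maskOf l = maskOf l') : pts l = pts l' := by
  have (c : ℕ) : c ∈ l ↔ c ∈ l' := by rw [← hasBit_maskOf, h, hasBit_maskOf]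
  ext p
  simp [mem_pts, this]

theorem pts_append (l l' : List ℕ) : pts (l ++ l') = pts l ∪ pts l' := by
  simp [pts]

end Codes

/-! ### Lines, caps and anchors in terms of sums -/

section Lines

/-- In characteristic 3, x ≠ y already makes -(x + y) different from both x and y, so one inequality
suffices. -/
theorem isLine_triple {x y z : Pt} : IsLine {x, y, z} ↔ x ≠ y ∧ z = -(x + y) := by
  have h3 : ∀ v : Pt, v + v + v = 0 := fun v => by
    funext i
    have : ∀ t : ZMod 3, t + t + t = 0 := by decide
    exact this (v i)
  constructor
  · rintro ⟨hc, hs⟩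
    have hxy : x ≠ y := by
      rintro rfl
      have := Finset.card_le_two (a := x) (b := z)
      rw [Finset.insert_eq_of_mem (Finset.mem_insert_self x {z})] at hc
      omega
    have hxz : x ≠ z := by
      rintro rfl
      have := Finset.card_le_two (a := y) (b := x)
      rw [Finset.insert_eq_of_mem (by simp)] at hc
      omega
    have hyz : y ≠ z := by
      rintro rfl
      have := Finset.card_le_two (a := x) (b := y)
      rw [Finset.pair_eq_singleton] at hc
      omega
    rw [Finset.sum_insert (by simp [hxy, hxz]), Finset.sum_pair hyz] at hs
    refine ⟨hxy, ?_⟩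
    rw [eq_neg_iff_add_eq_zero, ← hs]
    abel
  · rintro ⟨hxy, rfl⟩
    have hxz : x ≠ -(x + y) := by
      intro h
      apply hxy
      have h1 : x + x + y = 0 := by
        nth_rewrite 1 [h]
        abel
      have h2 := h3 x
      rw [← h1] at h2
      exact (add_left_cancel h2)
    have hyz : y ≠ -(x + y) := by
      intro h
      apply hxy
      have h1 : y + y + x = 0 := by
        nth_rewrite 1 [h]
        abel
      have h2 := h3 y
      rw [← h1] at h2
      exact (add_left_cancel h2).symm
    constructor
    · rw [Finset.card_eq_three]
      exact ⟨_, _, _, hxy, hxz, hyz, rfl⟩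
    · rw [Finset.sum_insert (by simpa only [Finset.mem_insert, Finset.mem_singleton, not_or] using
        ⟨hxy, hxz⟩), Finset.sum_pair hyz]
      abel

theorem isCap_iff {S : Finset Pt} :
    IsCap S ↔ ∀ x ∈ S, ∀ y ∈ S, x ≠ y → -(x + y) ∉ S := by
  constructor
  · intro h x hx y hy hxy hz
    refine h {x, y, -(x + y)} ?_ (isLine_triple.2 ⟨hxy, rfl⟩)
    simp only [Finset.insert_subset_iff, Finset.singleton_subset_iff]
    exact ⟨hx, hy, hz⟩
  · intro h L hL hline
    obtain ⟨x, y, z, -, -, -, rfl⟩ := Finset.card_eq_three.1 hline.1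
    obtain ⟨hxy, rfl⟩ := isLine_triple.1 hline
    exact h x (hL (by simp)) y (hL (by simp)) hxy (hL (by simp))

theorem isAnchor_iff {a : Pt} {S : Finset Pt} :
    IsAnchor a S ↔ ∀ x ∈ S, a ≠ x ∧ -(a + x) ∈ S := by
  constructor
  · intro h x hx
    obtain ⟨y, hy, hl⟩ := h x hx
    obtain ⟨h1, rfl⟩ := isLine_triple.1 hl
    exact ⟨h1, hy⟩
  · exact fun h x hx => ⟨_, (h x hx).2, isLine_triple.2 ⟨(h x hx).1, rfl⟩⟩

theorem IsCap.mono {S T : Finset Pt} (hS : IsCap S) (h : T ⊆ S) : IsCap T :=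
  fun L hL => hS L (hL.trans h)

end Lines

/-! ### The action of affine transformations -/

section Action

/-- The third point is the affine combination of x and y with weights -1 and -1, whose sum is -2 = 1
in GF(3); hence affine maps respect it. -/
theorem map_third (g : Aff) (x y : Pt) : g (-(x + y)) = -(g x + g y) := by
  have h (v : Pt) : g v = g.linear v + g 0 := by
    have := g.map_vadd 0 v
    simpa using this
  have h3 : g 0 + g 0 + g 0 = 0 := by
    funext i
    have : ∀ t : ZMod 3, t + t + t = 0 := by decide
    exact this (g 0 i)
  have e : -(g x + g y) = -(g.linear x + g.linear y) + (g 0 + g 0 + g 0) - (g 0 + g 0 + g 0)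
      - (g 0 + g 0) := by
    rw [h x, h y]
    abel
  rw [h (-(x + y)), map_neg, map_add, e, h3, ← sub_eq_zero]
  calc _ = g 0 + g 0 + g 0 := by abel
    _ = 0 := h3

theorem mem_act {g : Aff} {S : Finset Pt} {p : Pt} : p ∈ act g S ↔ ∃ x ∈ S, g x = p :=
  Finset.mem_image

theorem apply_mem_act {g : Aff} {S : Finset Pt} {p : Pt} : g p ∈ act g S ↔ p ∈ S :=
  g.injective.mem_finset_image

theorem act_mul (g h : Aff) (S : Finset Pt) : act (g * h) S = act g (act h S) := by
  rw [act, act, act, Finset.image_image, AffineEquiv.coe_mul]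

theorem act_one (S : Finset Pt) : act 1 S = S := by
  rw [act, AffineEquiv.coe_one, Finset.image_id]

theorem act_inv_act (g : Aff) (S : Finset Pt) : act g⁻¹ (act g S) = S := by
  rw [← act_mul, inv_mul_cancel, act_one]

theorem act_act_inv (g : Aff) (S : Finset Pt) : act g (act g⁻¹ S) = S := by
  rw [← act_mul, mul_inv_cancel, act_one]

theorem act_injective (g : Aff) : Function.Injective (act g) :=
  Function.LeftInverse.injective (act_inv_act g)

theorem act_eq_iff {g : Aff} {S T : Finset Pt} : act g S = T ↔ S = act g⁻¹ T :=
  ⟨fun h => by rw [← h, act_inv_act], fun h => by rw [h, act_act_inv]⟩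

theorem card_act (g : Aff) (S : Finset Pt) : (act g S).card = S.card :=
  Finset.card_image_of_injective _ g.injective

theorem act_union (g : Aff) (S T : Finset Pt) : act g (S ∪ T) = act g S ∪ act g T :=
  Finset.image_union ..

theorem act_sdiff (g : Aff) (S T : Finset Pt) : act g (S \ T) = act g S \ act g T :=
  Finset.image_sdiff _ _ g.injective

theorem act_subset_act {g : Aff} {S T : Finset Pt} : act g S ⊆ act g T ↔ S ⊆ T :=
  Finset.image_subset_image_iff g.injective

theorem disjoint_act {g : Aff} {S T : Finset Pt} : Disjoint (act g S) (act g T) ↔ Disjoint S T :=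
  Finset.disjoint_image g.injective

theorem IsCap.act {S : Finset Pt} (hS : IsCap S) (g : Aff) : IsCap (act g S) := by
  rw [isCap_iff] at hS ⊢
  intro x hx y hy hxy
  obtain ⟨x, hx', rfl⟩ := mem_act.1 hx
  obtain ⟨y, hy', rfl⟩ := mem_act.1 hy
  rw [← map_third, apply_mem_act]
  exact hS x hx' y hy' (fun h => hxy (congrArg g h))

theorem IsMaximalCap.act {S : Finset Pt} (hS : IsMaximalCap S) (g : Aff) :
    IsMaximalCap (act g S) :=
  ⟨hS.1.act g, fun T hT => by rw [card_act]; exact hS.2 T hT⟩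

theorem isAnchor_act {a : Pt} {S : Finset Pt} {g : Aff} :
    IsAnchor (g a) (act g S) ↔ IsAnchor a S := by
  rw [isAnchor_iff, isAnchor_iff]
  constructor
  · intro h x hx
    obtain ⟨h1, h2⟩ := h (g x) (apply_mem_act.2 hx)
    rw [← map_third, apply_mem_act] at h2
    exact ⟨fun h => h1 (congrArg g h), h2⟩
  · intro h x hx
    obtain ⟨x, hx', rfl⟩ := mem_act.1 hx
    rw [← map_third, apply_mem_act]
    exact ⟨fun h' => (h x hx').1 (g.injective h'), (h x hx').2⟩

end Action

/-! ### Affine transformations given on codes -/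

section CodeMaps

/-- The multiple of a point by the coefficient coded by `d`. -/
def scalc (d v : ℕ) : ℕ := bif Nat.beq d 0 then negc v else bif Nat.beq d 1 then 40 else v

/-- The linear map sending the standard basis to the points with codes `v₀, …, v₃`, on codes. -/
def linc (v₀ v₁ v₂ v₃ c : ℕ) : ℕ :=
  addc (addc (scalc (c % 3) v₀) (scalc (c / 3 % 3) v₁))
    (addc (scalc (c / 9 % 3) v₂) (scalc (c / 27 % 3) v₃))

/-- The linear map sending the standard basis to the points with codes `v₀, …, v₃`. -/
def linMap (v₀ v₁ v₂ v₃ : ℕ) : Pt →ₗ[ZMod 3] Pt :=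
  Matrix.vecMulLinear (Matrix.of ![dec v₀, dec v₁, dec v₂, dec v₃])

theorem scalc_lt {d v : ℕ} (hv : v < 81) : scalc d v < 81 := by
  unfold scalc
  cases Nat.beq d 0
  · cases Nat.beq d 1
    · exact hv
    · exact (by norm_num : 40 < 81)
  · exact negc_lt

theorem dec_scalc {d v : ℕ} (hd : d < 3) (hv : v < 81) :
    dec (scalc d v) = (((d : ℕ) : ZMod 3) - 1) • dec v := by
  interval_cases d
  · simp [scalc, dec_negc hv]
  · change dec 40 = _
    simp [dec_forty]
  · have : ((2 : ℕ) : ZMod 3) - 1 = 1 := rfl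
    rw [this, one_smul]
    rfl

theorem dec_linc {v₀ v₁ v₂ v₃ : ℕ} (h₀ : v₀ < 81) (h₁ : v₁ < 81) (h₂ : v₂ < 81) (h₃ : v₃ < 81)
    (c : ℕ) : dec (linc v₀ v₁ v₂ v₃ c) = linMap v₀ v₁ v₂ v₃ (dec c) := by
  rw [linc, dec_addc addc_lt addc_lt, dec_addc (scalc_lt h₀) (scalc_lt h₁),
    dec_addc (scalc_lt h₂) (scalc_lt h₃), dec_scalc (Nat.mod_lt _ (by norm_num)) h₀,
    dec_scalc (Nat.mod_lt _ (by norm_num)) h₁, dec_scalc (Nat.mod_lt _ (by norm_num)) h₂,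
    dec_scalc (Nat.mod_lt _ (by norm_num)) h₃]
  rw [linMap, Matrix.vecMulLinear_apply, Matrix.vecMul_eq_sum, Fin.sum_univ_four, ← add_assoc]
  rfl

/-- An affine transformation of codes, given by the images of the standard basis vectors under its
linear part and the image of the origin. -/
def affc (v₀ v₁ v₂ v₃ t c : ℕ) : ℕ := addc (linc v₀ v₁ v₂ v₃ c) t

theorem dec_basis : dec 41 = Pi.single 0 1 ∧ dec 43 = Pi.single 1 1 ∧ dec 49 = Pi.single 2 1 ∧
    dec 67 = Pi.single 3 1 := by
  refine ⟨?_, ?_, ?_, ?_⟩ <;> funext i <;> fin_cases i <;> rfl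

/-- The inverse matrix is supplied as data, so invertibility needs checking on four basis codes
only: a left inverse gives injectivity, which suffices for an endomorphism in finite dimension. -/
theorem exists_aff {v₀ v₁ v₂ v₃ t : ℕ} (hv : IsCodeList [v₀, v₁, v₂, v₃, t])
    {w₀ w₁ w₂ w₃ : ℕ} (hw : IsCodeList [w₀, w₁, w₂, w₃])
    (hinv : [41, 43, 49, 67].map (fun c => linc w₀ w₁ w₂ w₃ (linc v₀ v₁ v₂ v₃ c)) =
      [41, 43, 49, 67]) :
    ∃ g : Aff, ∀ c < 81, g (dec c) = dec (affc v₀ v₁ v₂ v₃ t c) := by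
  simp only [IsCodeList, List.forall_mem_cons, List.not_mem_nil, IsEmpty.forall_iff,
    implies_true, and_true] at hv hw
  obtain ⟨h₀, h₁, h₂, h₃, ht⟩ := hv
  obtain ⟨k₀, k₁, k₂, k₃⟩ := hw
  simp only [List.map_cons, List.map_nil, List.cons.injEq, and_true] at hinv
  obtain ⟨i₀, i₁, i₂, i₃⟩ := hinv
  have hlin (c : ℕ) : linMap w₀ w₁ w₂ w₃ (linMap v₀ v₁ v₂ v₃ (dec c)) =
      dec (linc w₀ w₁ w₂ w₃ (linc v₀ v₁ v₂ v₃ c)) := by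
    rw [← dec_linc h₀ h₁ h₂ h₃, ← dec_linc k₀ k₁ k₂ k₃]
  obtain ⟨b₀, b₁, b₂, b₃⟩ := dec_basis
  have hcomp : (linMap w₀ w₁ w₂ w₃).comp (linMap v₀ v₁ v₂ v₃) = LinearMap.id := by
    refine (Pi.basisFun (ZMod 3) (Fin 4)).ext fun i => ?_
    rw [Pi.basisFun_apply, LinearMap.comp_apply, LinearMap.id_apply]
    fin_cases i
    · exact b₀ ▸ (hlin 41).trans (congrArg dec i₀)
    · exact b₁ ▸ (hlin 43).trans (congrArg dec i₁)
    · exact b₂ ▸ (hlin 49).trans (congrArg dec i₂)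
    · exact b₃ ▸ (hlin 67).trans (congrArg dec i₃)
  have hinj : Function.Injective (linMap v₀ v₁ v₂ v₃) :=
    Function.LeftInverse.injective (g := linMap w₀ w₁ w₂ w₃) fun x => LinearMap.congr_fun hcomp x
  refine ⟨(LinearEquiv.ofInjectiveEndo _ hinj).toAffineEquiv.trans
    (AffineEquiv.constVAdd (ZMod 3) Pt (dec t)), fun c hc => ?_⟩
  have hlt : linc v₀ v₁ v₂ v₃ c < 81 := addc_lt
  rw [affc, dec_addc hlt ht, dec_linc h₀ h₁ h₂ h₃, add_comm]
  rfl

theorem act_pts {g : Aff} {f : ℕ → ℕ} (hg : ∀ c < 81, g (dec c) = dec (f c)) {l : List ℕ}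
    (hl : IsCodeList l) : act g (pts l) = pts (l.map f) := by
  ext p
  rw [mem_act]
  constructor
  · rintro ⟨x, hx, rfl⟩
    obtain ⟨c, hc, rfl⟩ := mem_pts.1 hx
    rw [hg c (hl c hc)]
    exact mem_pts.2 ⟨_, List.mem_map_of_mem hc, rfl⟩
  · intro hp
    obtain ⟨_, hfc, rfl⟩ := mem_pts.1 hp
    obtain ⟨c, hc, rfl⟩ := List.mem_map.1 hfc
    exact ⟨dec c, mem_pts.2 ⟨c, hc, rfl⟩, hg c (hl c hc)⟩

end CodeMaps

end AG43

namespace AG43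

open Finset

/-! ### Counting points of a cap on hyperplanes -/

section Counting

theorem three_smul_pt (v : Pt) : v + v + v = 0 := by
  funext i
  have : ∀ t : ZMod 3, t + t + t = 0 := by decide
  exact this (v i)

theorem card_ker_mul {W : Type*} [AddCommGroup W] [Module (ZMod 3) W] {f : Pt →ₗ[ZMod 3] W}
    (hf : Function.Surjective f) : Nat.card W * Nat.card (LinearMap.ker f) = 81 := by
  have h1 := Submodule.card_eq_card_quotient_mul_card (LinearMap.ker f)
  rw [Nat.card_congr (f.quotKerEquivOfSurjective hf).toEquiv] at h1
  rw [mul_comm, ← h1]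
  simp [Nat.card_eq_fintype_card, ZMod.card]

/-- The linear functional given by the dot product with `u`. -/
def dotL (u : Pt) : Pt →ₗ[ZMod 3] ZMod 3 where
  toFun w := w ⬝ᵥ u
  map_add' w w' := add_dotProduct w w' u
  map_smul' c w := smul_dotProduct c w u

theorem card_orth {u : Pt} (hu : u ≠ 0) : #{w : Pt | w ⬝ᵥ u = 0} = 27 := by
  have hs : Function.Surjective (dotL u) := by
    obtain ⟨i, hi⟩ := Function.ne_iff.1 hu
    intro c
    refine ⟨Pi.single i (c / u i), ?_⟩
    change Pi.single i (c / u i) ⬝ᵥ u = c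
    rw [single_dotProduct]
    exact div_mul_cancel₀ c hi
  have h := card_ker_mul hs
  have h2 : Nat.card (LinearMap.ker (dotL u)) = #{w : Pt | w ⬝ᵥ u = 0} := by
    exact Nat.subtype_card _ (fun w => by rw [mem_filter_univ]; rfl)
  rw [← h2]
  rw [Nat.card_eq_fintype_card, ZMod.card] at h
  omega

/-- Over GF(3) nonzero vectors u, v with u ≠ ±v are linearly independent, so the two equations cut
out a subspace of codimension 2. -/
theorem card_orth_pair {u v : Pt} (hu : u ≠ 0) (hv : v ≠ 0) (huv : u ≠ v) (huv' : u + v ≠ 0) :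
    #{w : Pt | w ⬝ᵥ u = 0 ∧ w ⬝ᵥ v = 0} = 9 := by
  have hs : Function.Surjective ((dotL u).prod (dotL v)) := by
    rw [← LinearMap.range_eq_top]
    by_contra hne
    obtain ⟨f, hf, hle⟩ := Submodule.exists_le_ker_of_lt_top _ (lt_top_iff_ne_top.2 hne)
    have hf' (a b : ZMod 3) : f (a, b) = a * f (1, 0) + b * f (0, 1) := by
      rw [← smul_eq_mul, ← smul_eq_mul, ← map_smul, ← map_smul, ← map_add]
      simp
    have h0 : ∀ w : Pt, w ⬝ᵥ (f (1, 0) • u + f (0, 1) • v) = 0 := by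
      intro w
      have := hle ⟨w, rfl⟩
      rw [LinearMap.mem_ker] at this
      change f (w ⬝ᵥ u, w ⬝ᵥ v) = 0 at this
      rw [hf'] at this
      rw [dotProduct_add, dotProduct_smul, dotProduct_smul, smul_eq_mul, smul_eq_mul,
        mul_comm (f _), mul_comm (f _), this]
    have h1 : f (1, 0) • u + f (0, 1) • v = 0 := by
      funext i
      have := h0 (Pi.single i 1)
      rwa [single_dotProduct, one_mul] at this
    have key : ∀ a b : ZMod 3, a • u + b • v = 0 → a = 0 ∧ b = 0 := by
      have h3 : ∀ a : ZMod 3, a = 0 ∨ a = 1 ∨ a = -1 := by decide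
      intro a b hab
      rcases h3 a with rfl | rfl | rfl <;> rcases h3 b with rfl | rfl | rfl <;>
        simp only [zero_smul, one_smul, neg_smul, add_zero, zero_add, neg_eq_zero, and_self] at hab ⊢
      · exact absurd hab hv
      · exact absurd hab hv
      · exact absurd hab hu
      · exact absurd hab huv'
      · exact absurd (by rwa [← sub_eq_add_neg, sub_eq_zero] at hab) huv
      · exact absurd hab hu
      · exact absurd (by rwa [neg_add_eq_zero] at hab) huv
      · exact absurd (by rwa [← neg_add, neg_eq_zero] at hab) huv'
    obtain ⟨h2, h3⟩ := key _ _ h1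
    apply hf
    ext
    · simpa using h2
    · simpa using h3
  have h := card_ker_mul hs
  have h2 : Nat.card (LinearMap.ker ((dotL u).prod (dotL v))) =
      #{w : Pt | w ⬝ᵥ u = 0 ∧ w ⬝ᵥ v = 0} := by
    refine Nat.subtype_card _ fun w => ?_
    rw [mem_filter_univ, LinearMap.mem_ker, LinearMap.prod_apply]
    exact Prod.mk_eq_zero.symm
  rw [← h2]
  rw [Nat.card_prod, Nat.card_zmod] at h
  omega

/-- The number of points of `S` on the hyperplane `w ⬝ᵥ x = c`. -/
def hcount (S : Finset Pt) (w : Pt) (c : ZMod 3) : ℕ := #{x ∈ S | w ⬝ᵥ x = c}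

theorem sum_hcount (S : Finset Pt) (w : Pt) :
    hcount S w 0 + hcount S w 1 + hcount S w 2 = S.card := by
  rw [card_eq_sum_card_fiberwise (f := fun x => w ⬝ᵥ x) (t := univ) (fun _ _ => mem_univ _)]
  exact (Fin.sum_univ_three (fun c : ZMod 3 => hcount S w c)).symm

theorem sum_pow_hcount (S : Finset Pt) (w : Pt) (k : ℕ) :
    hcount S w 0 ^ (k + 1) + hcount S w 1 ^ (k + 1) + hcount S w 2 ^ (k + 1) =
      ∑ x ∈ S, hcount S w (w ⬝ᵥ x) ^ k := by
  rw [← sum_fiberwise_of_maps_to (s := S) (t := univ) (g := fun x => w ⬝ᵥ x)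
    (fun _ _ => mem_univ _)]
  have (c : ZMod 3) : ∑ x ∈ S with w ⬝ᵥ x = c, hcount S w (w ⬝ᵥ x) ^ k = hcount S w c ^ (k + 1) := by
    rw [sum_congr rfl (g := fun _ => hcount S w c ^ k), sum_const, smul_eq_mul, pow_succ, mul_comm]
    · rfl
    · intro x hx
      rw [(mem_filter.1 hx).2]
  simp only [this]
  exact (Fin.sum_univ_three (fun c : ZMod 3 => hcount S w c ^ (k + 1))).symm

theorem dot_eq_iff {w x y : Pt} : w ⬝ᵥ y = w ⬝ᵥ x ↔ w ⬝ᵥ (y - x) = 0 := by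
  rw [dotProduct_sub, sub_eq_zero]

/-- Double count of the triples (w, x, y) with w ⬝ᵥ (y - x) = 0. Each x contributes 81 + 19·27 =
594, and 20·594 = 11880. The functional w = 0 is included. -/
theorem second_moment {S : Finset Pt} (h20 : S.card = 20) :
    ∑ w : Pt, (hcount S w 0 ^ 2 + hcount S w 1 ^ 2 + hcount S w 2 ^ 2) = 11880 := by
  simp only [sum_pow_hcount S _ 1, pow_one]
  rw [sum_comm]
  have hx : ∀ x ∈ S, ∑ w : Pt, hcount S w (w ⬝ᵥ x) = 594 := by
    intro x hx
    simp only [hcount, card_filter]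
    rw [sum_comm]
    simp only [dot_eq_iff, ← card_filter]
    rw [← add_sum_erase S _ hx, sum_congr rfl (g := fun _ => 27), sum_const, card_erase_of_mem hx,
      h20]
    · simp [ZMod.card]
    · intro y hy
      exact card_orth (sub_ne_zero.2 (ne_of_mem_erase hy))
  rw [sum_congr rfl hx, sum_const, h20]
  rfl

/-- Double count of the quadruples (w, x, y, z) with equal values of w at x, y, z. For distinct
points the differences y - x and z - x are independent because x, y, z do not form a line. Each x
contributes 81 + 19·27 + 19·(27 + 27 + 18·9) = 4698. -/
theorem third_moment {S : Finset Pt} (hS : IsCap S) (h20 : S.card = 20) :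
    ∑ w : Pt, (hcount S w 0 ^ 3 + hcount S w 1 ^ 3 + hcount S w 2 ^ 3) = 93960 := by
  rw [isCap_iff] at hS
  simp only [sum_pow_hcount S _ 2]
  rw [sum_comm]
  have hx : ∀ x ∈ S, ∑ w : Pt, hcount S w (w ⬝ᵥ x) ^ 2 = 4698 := by
    intro x hx
    have hw (w : Pt) : hcount S w (w ⬝ᵥ x) ^ 2 =
        ∑ y ∈ S, ∑ z ∈ S, if w ⬝ᵥ (y - x) = 0 ∧ w ⬝ᵥ (z - x) = 0 then 1 else 0 := by
      simp only [hcount, card_filter, pow_two, sum_mul_sum, dot_eq_iff, ite_and, ite_mul, one_mul,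
        zero_mul]
    simp only [hw]
    rw [sum_comm]
    have hin (y : Pt) : ∑ w : Pt, ∑ z ∈ S,
        (if w ⬝ᵥ (y - x) = 0 ∧ w ⬝ᵥ (z - x) = 0 then 1 else 0) =
        ∑ z ∈ S, #{w : Pt | w ⬝ᵥ (y - x) = 0 ∧ w ⬝ᵥ (z - x) = 0} := by
      rw [sum_comm]
      simp only [card_filter]
    simp only [hin]
    rw [← add_sum_erase S _ hx, sum_congr rfl (s₁ := S.erase x) (g := fun _ => 216), sum_const,
      card_erase_of_mem hx, h20, ← add_sum_erase S _ hx, sum_congr rfl (s₁ := S.erase x)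
      (g := fun _ => 27), sum_const, card_erase_of_mem hx, h20]
    · simp [ZMod.card]
    · intro z hz
      simp only [sub_self, dotProduct_zero, true_and]
      exact card_orth (sub_ne_zero.2 (ne_of_mem_erase hz))
    · intro y hy
      have hyx := ne_of_mem_erase hy
      have hyS := mem_of_mem_erase hy
      have hy0 := sub_ne_zero.2 hyx
      rw [← add_sum_erase S _ hx, ← add_sum_erase (S.erase x) _ hy, sum_congr rfl (g := fun _ => 9),
        sum_const, card_erase_of_mem hy, card_erase_of_mem hx, h20]
      · simp only [sub_self, dotProduct_zero, and_true, and_self, card_orth hy0]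
        rfl
      · intro z hz
        have hzy := ne_of_mem_erase hz
        have hzx := ne_of_mem_erase (mem_of_mem_erase hz)
        have hzS := mem_of_mem_erase (mem_of_mem_erase hz)
        refine card_orth_pair hy0 (sub_ne_zero.2 hzx) (fun h => hzy (sub_left_inj.1 h).symm) ?_
        intro h
        apply hS y hyS z hzS hzy.symm
        have : -(y + z) = x := by
          rw [neg_eq_iff_add_eq_zero]
          calc y + z + x = (y - x + (z - x)) + (x + x + x) := by abel
            _ = 0 := by rw [h, three_smul_pt, add_zero]
        rwa [this]
  rw [sum_congr rfl hx, sum_const, h20]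
  rfl

/-- In the plane with coordinates (∑ n², ∑ n³) the bounding line passes through the points of
(7,7,6) and (9,8,3). The excluded triple (9,9,2) is the only one on the wrong side. -/
theorem moment_bound {a b c : ℕ} (ha : a < 10) (hb : b < 10) (hc : c < 10)
    (h : a + b + c = 20 ∧ a ≠ 2 ∧ b ≠ 2 ∧ c ≠ 2) :
    183 * (a ^ 2 + b ^ 2 + c ^ 2) ≤ 10 * (a ^ 3 + b ^ 3 + c ^ 3) + 15502 := by
  obtain rfl : c = 20 - a - b := by omega
  interval_cases a <;> interval_cases b <;> simp at h hc ⊢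

theorem exists_hcount_eq_two {S : Finset Pt} (hS : IsCap S) (h20 : S.card = 20)
    (hle : ∀ w ≠ 0, ∀ c, hcount S w c ≤ 9) : ∃ w ≠ 0, ∃ c, hcount S w c = 2 := by
  by_contra! hne
  have h2 := second_moment h20
  have h3 := third_moment hS h20
  rw [← add_sum_erase univ _ (mem_univ (0 : Pt))] at h2 h3
  have e0 : hcount S 0 0 = 20 := by simp [hcount, h20]
  have e1 : hcount S 0 1 = 0 := by simp [hcount]
  have e2 : hcount S 0 2 = 0 := by
    have := sum_hcount S 0
    omega
  rw [e0, e1, e2] at h2 h3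
  -- Summed over the 80 nonzero w, the bound reads 183·11480 ≤ 10·85960 + 80·15502, that is 2100840
  -- ≤ 2099760, which is false.
  have hb : ∑ w ∈ univ.erase (0 : Pt),
      183 * (hcount S w 0 ^ 2 + hcount S w 1 ^ 2 + hcount S w 2 ^ 2) ≤
      ∑ w ∈ univ.erase (0 : Pt),
        (10 * (hcount S w 0 ^ 3 + hcount S w 1 ^ 3 + hcount S w 2 ^ 3) + 15502) := by
    refine sum_le_sum fun w hw => ?_
    have hw0 := ne_of_mem_erase hw
    exact moment_bound (Nat.lt_succ_of_le (hle w hw0 0)) (Nat.lt_succ_of_le (hle w hw0 1))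
      (Nat.lt_succ_of_le (hle w hw0 2)) ⟨(sum_hcount S w).trans h20, hne w hw0 0, hne w hw0 1,
        hne w hw0 2⟩
  rw [sum_add_distrib, ← mul_sum, ← mul_sum, sum_const, card_erase_of_mem (mem_univ _),
    smul_eq_mul] at hb
  have h81 : #(univ : Finset Pt) = 81 := by simp [ZMod.card]
  rw [h81] at hb
  omega

end Counting

end AG43

namespace AG43

open Finset

/-! ### Every cap of twenty points is affinely equivalent to the standard one -/

section Frame

/-- A cap has at most four points in a plane, so five points in a hyperplane include four affinely
independent ones, and `q` off the hyperplane completes an affine frame. The last clause says that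
the last coordinate of `h` is the normalised functional w, so parallel hyperplanes become slices. -/
theorem exists_frame {S : Finset Pt} (hS : IsCap S) {w : Pt} {c : ZMod 3}
    (h5 : 5 ≤ hcount S w c) {q : Pt} (hq : w ⬝ᵥ q ≠ c) :
    ∃ h : Aff, h q = dec 67 ∧
      (∀ d ∈ [40, 41, 43, 49], ∃ x ∈ S, w ⬝ᵥ x = c ∧ h x = dec d) ∧
      ∀ x, h x 3 * (w ⬝ᵥ q - c) = w ⬝ᵥ x - c := by
  rw [isCap_iff] at hS
  set T := {x ∈ S | w ⬝ᵥ x = c} with hT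
  have hTS : ∀ x ∈ T, x ∈ S := fun x hx => (mem_filter.1 hx).1
  have hTc : ∀ x ∈ T, w ⬝ᵥ x = c := fun x hx => (mem_filter.1 hx).2
  have h5 : 5 ≤ #T := h5
  have hz3 : ∀ a : ZMod 3, a = 0 ∨ a = 1 ∨ a = -1 := by decide
  obtain ⟨p₀, hp₀⟩ : ∃ p, p ∈ T := card_pos.1 (by omega)
  obtain ⟨p₁, hp₁, h10⟩ : ∃ p ∈ T, p ∉ ({p₀} : Finset Pt) :=
    exists_mem_notMem_of_card_lt_card (by rw [card_singleton]; omega)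
  obtain ⟨p₂, hp₂, h20⟩ : ∃ p ∈ T, p ∉ ({p₀, p₁} : Finset Pt) :=
    exists_mem_notMem_of_card_lt_card (card_le_two.trans_lt (by omega))
  simp only [mem_insert, mem_singleton, not_or] at h10 h20
  have hcap {x y z : Pt} (hx : x ∈ T) (hy : y ∈ T) (hz : z ∈ T) (hxy : x ≠ y)
      (h : x + y + z = 0) : False := by
    apply hS x (hTS x hx) y (hTS y hy) hxy
    rw [neg_eq_of_add_eq_zero_right h]
    exact hTS z hz
  -- a point of the plane through `p₀, p₁, p₂` has one of three positions
  have plane {p : Pt} (hp : p ∈ T) (h0 : p ≠ p₀) (h1 : p ≠ p₁) (h2 : p ≠ p₂) {i j : ZMod 3}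
      (hij : p - p₀ = i • (p₁ - p₀) + j • (p₂ - p₀)) :
      p = p₁ + p₂ - p₀ ∨ p = p₀ + p₁ - p₂ ∨ p = p₀ + p₂ - p₁ := by
    have t0 := three_smul_pt p₀
    have t1 := three_smul_pt p₁
    have t2 := three_smul_pt p₂
    rw [sub_eq_iff_eq_add] at hij
    rcases hz3 i with rfl | rfl | rfl <;> rcases hz3 j with rfl | rfl | rfl <;>
      simp only [zero_smul, one_smul, neg_smul, zero_add, add_zero] at hij
    · exact absurd hij h0
    · exact absurd (hij.trans (by abel)) h2
    · refine (hcap hp₀ hp₂ hp (Ne.symm h20.1) ?_).elim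
      rw [hij]
      calc p₀ + p₂ + (-(p₂ - p₀) + p₀) = p₀ + p₀ + p₀ := by abel
        _ = 0 := t0
    · exact absurd (hij.trans (by abel)) h1
    · left
      rw [hij]
      abel
    · right; left
      rw [hij]
      abel
    · refine (hcap hp₀ hp₁ hp (Ne.symm h10) ?_).elim
      rw [hij]
      calc p₀ + p₁ + (-(p₁ - p₀) + p₀) = p₀ + p₀ + p₀ := by abel
        _ = 0 := t0
    · right; right
      rw [hij]
      abel
    · refine (hcap hp₁ hp₂ hp (Ne.symm h20.2) ?_).elim
      rw [hij]
      calc p₁ + p₂ + (-(p₁ - p₀) + -(p₂ - p₀) + p₀) = p₀ + p₀ + p₀ := by abel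
        _ = 0 := t0
  -- Otherwise all points of `T` lie in the plane of p₀, p₁, p₂. A fourth and a fifth point would
  -- each take one of the three positions in `plane`, and any two of these positions form a line
  -- with one of p₀, p₁, p₂.
  obtain ⟨p₃, hp₃, hpl⟩ : ∃ p ∈ T, ∀ i j : ZMod 3,
      p - p₀ ≠ i • (p₁ - p₀) + j • (p₂ - p₀) := by
    by_contra! hne
    obtain ⟨p, hp, hp3⟩ : ∃ p ∈ T, p ∉ ({p₀, p₁, p₂} : Finset Pt) :=
      exists_mem_notMem_of_card_lt_card (card_le_three.trans_lt (by omega))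
    obtain ⟨r, hr, hr4⟩ : ∃ r ∈ T, r ∉ ({p₀, p₁, p₂, p} : Finset Pt) :=
      exists_mem_notMem_of_card_lt_card (card_le_four.trans_lt (by omega))
    simp only [mem_insert, mem_singleton, not_or] at hp3 hr4
    obtain ⟨i, j, hij⟩ := hne p hp
    obtain ⟨k, l, hkl⟩ := hne r hr
    have e1 := plane hp hp3.1 hp3.2.1 hp3.2.2 hij
    have e2 := plane hr hr4.1 hr4.2.1 hr4.2.2.1 hkl
    have hpr := hr4.2.2.2
    have sum_zero {x y z t : Pt} (h : x + y + z = t + t + t) : x + y + z = 0 :=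
      h.trans (three_smul_pt t)
    rcases e1 with rfl | rfl | rfl <;> rcases e2 with rfl | rfl | rfl
    · exact hpr rfl
    · exact hcap hp hr hp₁ (Ne.symm hpr) (sum_zero (t := p₁) (by abel))
    · exact hcap hp hr hp₂ (Ne.symm hpr) (sum_zero (t := p₂) (by abel))
    · exact hcap hp hr hp₁ (Ne.symm hpr) (sum_zero (t := p₁) (by abel))
    · exact hpr rfl
    · exact hcap hp hr hp₀ (Ne.symm hpr) (sum_zero (t := p₀) (by abel))
    · exact hcap hp hr hp₂ (Ne.symm hpr) (sum_zero (t := p₂) (by abel))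
    · exact hcap hp hr hp₀ (Ne.symm hpr) (sum_zero (t := p₀) (by abel))
    · exact hpr rfl
  have hw {p : Pt} (hp : p ∈ T) : w ⬝ᵥ (p - p₀) = 0 := by
    rw [dotProduct_sub, hTc p hp, hTc p₀ hp₀, sub_self]
  have hwq : w ⬝ᵥ (q - p₀) = w ⬝ᵥ q - c := by rw [dotProduct_sub, hTc p₀ hp₀]
  have hq0 : w ⬝ᵥ q - c ≠ 0 := sub_ne_zero.2 hq
  have hdiv {a : ZMod 3} (ha : a ≠ 0) {x y : Pt} (h : a • x = y) : x = a⁻¹ • y := by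
    rw [← h, inv_smul_smul₀ ha]
  have hli : LinearIndependent (ZMod 3) ![p₁ - p₀, p₂ - p₀, p₃ - p₀, q - p₀] := by
    rw [Fintype.linearIndependent_iff]
    intro g hg
    rw [Fin.sum_univ_four] at hg
    simp only [Matrix.cons_val_zero, Matrix.cons_val_one, Matrix.cons_val] at hg
    have g3 : g 3 = 0 := by
      have := congrArg (w ⬝ᵥ ·) hg
      simp only [dotProduct_add, dotProduct_smul, hw hp₁, hw hp₂, hw hp₃, hwq, dotProduct_zero,
        smul_eq_mul, mul_zero, zero_add] at this
      exact (mul_eq_zero.1 this).resolve_right hq0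
    rw [g3, zero_smul, add_zero] at hg
    have g2 : g 2 = 0 := by
      by_contra h
      refine hpl (-((g 2)⁻¹ * g 0)) (-((g 2)⁻¹ * g 1)) ?_
      rw [hdiv h (neg_eq_of_add_eq_zero_right hg).symm, neg_add, smul_add, smul_neg, smul_neg,
        smul_smul, smul_smul, neg_smul, neg_smul]
    rw [g2, zero_smul, add_zero] at hg
    have g1 : g 1 = 0 := by
      by_contra h
      have e : p₂ - p₀ = (-((g 1)⁻¹ * g 0)) • (p₁ - p₀) := by
        rw [hdiv h (neg_eq_of_add_eq_zero_right hg).symm, smul_neg, smul_smul, neg_smul]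
      rcases hz3 (-((g 1)⁻¹ * g 0)) with h' | h' | h' <;> rw [h'] at e
      · rw [zero_smul, sub_eq_zero] at e
        exact h20.1 e
      · rw [one_smul, sub_left_inj] at e
        exact h20.2 e
      · refine hcap hp₁ hp₂ hp₀ (Ne.symm h20.2) ?_
        rw [neg_smul, one_smul, sub_eq_iff_eq_add] at e
        rw [e]
        calc p₁ + (-(p₁ - p₀) + p₀) + p₀ = p₀ + p₀ + p₀ := by abel
          _ = 0 := three_smul_pt p₀
    rw [g1, zero_smul, add_zero] at hg
    have g0 : g 0 = 0 := (smul_eq_zero.1 hg).resolve_right (sub_ne_zero.2 h10)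
    intro i
    fin_cases i
    · exact g0
    · exact g1
    · exact g2
    · exact g3
  let B := basisOfLinearIndependentOfCardEqFinrank hli (by simp)
  have hB (i : Fin 4) : B.equivFun (![p₁ - p₀, p₂ - p₀, p₃ - p₀, q - p₀] i) = Pi.single i 1 := by
    have : ![p₁ - p₀, p₂ - p₀, p₃ - p₀, q - p₀] i = B i := by
      rw [coe_basisOfLinearIndependentOfCardEqFinrank]
    rw [this]
    funext j
    rw [Module.Basis.equivFun_self, Pi.single_apply]
    simp [eq_comm]
  let h : Aff := (AffineEquiv.constVAdd (ZMod 3) Pt (-p₀)).trans B.equivFun.toAffineEquiv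
  have hh (x : Pt) : h x = B.equivFun (x - p₀) := by
    rw [sub_eq_add_neg, add_comm]
    rfl
  obtain ⟨b₀, b₁, b₂, b₃⟩ := dec_basis
  refine ⟨h, ?_, ?_, ?_⟩
  · rw [hh, b₃]
    exact hB 3
  · simp only [List.forall_mem_cons, List.not_mem_nil, IsEmpty.forall_iff, implies_true, and_true]
    refine ⟨⟨p₀, hTS _ hp₀, hTc _ hp₀, ?_⟩, ⟨p₁, hTS _ hp₁, hTc _ hp₁, ?_⟩,
      ⟨p₂, hTS _ hp₂, hTc _ hp₂, ?_⟩, ⟨p₃, hTS _ hp₃, hTc _ hp₃, ?_⟩⟩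
    · rw [hh, sub_self, map_zero, dec_forty]
    · rw [hh, b₀]
      exact hB 0
    · rw [hh, b₁]
      exact hB 1
    · rw [hh, b₂]
      exact hB 2
  · intro x
    have hx := B.sum_equivFun (x - p₀)
    rw [← hh, Fin.sum_univ_four, coe_basisOfLinearIndependentOfCardEqFinrank] at hx
    simp only [Matrix.cons_val_zero, Matrix.cons_val_one, Matrix.cons_val] at hx
    have := congrArg (w ⬝ᵥ ·) hx
    simp only [dotProduct_add, dotProduct_smul, hw hp₁, hw hp₂, hw hp₃, hwq,
        smul_eq_mul, mul_zero, zero_add] at this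
    rw [this, dotProduct_sub, hTc p₀ hp₀]

end Frame

end AG43

namespace AG43

open Finset

/-! ### The finite search behind the classification of 20-point caps -/

section Classification

/-- The mask that forbids the third point of a line. -/
def killLine (x y : ℕ) : ℕ := bit (third x y)

theorem IsCap.free {S : Finset Pt} (hS : IsCap S) : Free killLine (codes S) := by
  rw [isCap_iff] at hS
  intro x hx y hy z hz hxy _ _
  rw [Bool.eq_false_iff]
  intro h
  rw [killLine, hasBit_bit] at h
  rw [mem_codes] at hx hy hz
  refine hS _ hx.2 _ hy.2 (fun h' => hxy (dec_injective hx.1 hy.1 h')) ?_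
  rw [← dec_third hx.1 hy.1, ← h]
  exact hz.2

/-- The codes of the standard maximal cap. -/
def stdList : List ℕ :=
  [2, 7, 8, 22, 25, 26, 29, 34, 35, 38, 42, 45, 46, 51, 54, 55, 58, 72, 73, 78]

/-- The standard maximal cap, with anchor point `0`. -/
def stdCap : Finset Pt := pts stdList

theorem dec_last {c : ℕ} (hc : c < 81) :
    (dec c 3 = 0 ↔ 27 ≤ c ∧ c < 54) ∧ (dec c 3 = 1 ↔ 54 ≤ c) ∧ (dec c 3 = 2 ↔ c < 27) := by
  have e : dec c 3 = ((c / 27 % 3 : ℕ) : ZMod 3) - 1 := rfl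
  have h : c / 27 < 3 := by omega
  rw [e, Nat.mod_eq_of_lt h]
  rcases (by omega : c / 27 = 0 ∨ c / 27 = 1 ∨ c / 27 = 2) with h | h | h <;> rw [h]
  · have h1 : (((0 : ℕ) : ZMod 3) - 1 = 0 ↔ False) ∧ (((0 : ℕ) : ZMod 3) - 1 = 1 ↔ False) ∧
      (((0 : ℕ) : ZMod 3) - 1 = 2 ↔ True) := by decide
    rw [h1.1, h1.2.1, h1.2.2]
    simp only [false_iff, true_iff]
    omega
  · have h1 : (((1 : ℕ) : ZMod 3) - 1 = 0 ↔ True) ∧ (((1 : ℕ) : ZMod 3) - 1 = 1 ↔ False) ∧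
      (((1 : ℕ) : ZMod 3) - 1 = 2 ↔ False) := by decide
    rw [h1.1, h1.2.1, h1.2.2]
    simp only [false_iff, true_iff]
    omega
  · have h1 : (((2 : ℕ) : ZMod 3) - 1 = 0 ↔ False) ∧ (((2 : ℕ) : ZMod 3) - 1 = 1 ↔ True) ∧
      (((2 : ℕ) : ZMod 3) - 1 = 2 ↔ False) := by decide
    rw [h1.1, h1.2.1, h1.2.2]
    simp only [false_iff, true_iff]
    omega

/-- The codes of the points with last coordinate `0` other than the first four frame points. -/
def sliceZero : List ℕ := filt (maskOf [40, 41, 43, 49]) (List.range' 27 27)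

/-- The codes of the points with last coordinate `1` other than the last frame point. -/
def sliceOne : List ℕ := filt (bit 67) (List.range' 54 27)

/-- The codes of the caps of nine points with last coordinate `0` that contain the frame. -/
def nineCaps : List (List ℕ) := extensions killLine [40, 41, 43, 49] sliceZero 5

/-- The codes of the caps with slices of sizes `9, 2, 9` that contain the frame. -/
def twentyCaps : List (List ℕ) :=
  (nineCaps.flatMap fun l => extensions killLine (67 :: l) sliceOne 1).flatMap fun l =>
    extensions killLine l (List.range 27) 9

/-- A cap in AG(3,3) has at most nine points. Fixing four affinely independent points of it as frame
leaves a small search for six more. -/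
theorem no_tenCap : extensions killLine [40, 41, 43, 49] sliceZero 6 = [] := by
  decide +kernel

/-- Affine transformations carrying the standard cap to the caps in `twentyCaps`: the linear part,
the translation and the inverse of the linear part. -/
def certificates : List (ℕ × ℕ × ℕ × ℕ × ℕ × ℕ × ℕ × ℕ × ℕ) :=
  [(53, 49, 54, 33, 71, 63, 12, 43, 50),
   (70, 41, 37, 1, 63, 43, 31, 12, 50),
   (53, 43, 54, 45, 77, 63, 43, 12, 50),
   (61, 20, 55, 34, 57, 44, 48, 21, 14),
   (80, 34, 49, 13, 79, 74, 52, 49, 13),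
   (35, 13, 27, 51, 55, 76, 12, 50, 37),
   (16, 38, 73, 52, 71, 60, 57, 50, 59),
   (68, 43, 39, 3, 63, 31, 43, 12, 50),
   (59, 34, 49, 13, 79, 77, 52, 49, 13),
   (41, 13, 48, 36, 55, 41, 12, 50, 37),
   (61, 32, 49, 13, 77, 52, 77, 49, 13),
   (68, 49, 39, 9, 57, 31, 12, 43, 50),
   (47, 43, 60, 51, 80, 69, 43, 12, 50),
   (79, 38, 34, 4, 54, 71, 68, 59, 75),
   (56, 34, 15, 60, 71, 62, 33, 30, 5),
   (61, 38, 43, 4, 63, 52, 49, 59, 75),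
   (35, 49, 72, 51, 80, 69, 12, 43, 50),
   (79, 32, 46, 10, 54, 71, 59, 68, 75),
   (71, 34, 0, 72, 77, 56, 33, 30, 5),
   (61, 11, 73, 43, 57, 60, 67, 59, 30),
   (70, 29, 7, 76, 72, 33, 76, 21, 5),
   (74, 34, 24, 69, 62, 79, 33, 30, 5),
   (62, 49, 21, 72, 74, 62, 50, 43, 12),
   (79, 41, 10, 55, 60, 43, 59, 50, 12),
   (25, 29, 64, 34, 80, 60, 77, 50, 59),
   (77, 34, 48, 12, 54, 59, 71, 68, 75),
   (62, 34, 49, 13, 79, 65, 52, 49, 13),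
   (44, 13, 45, 42, 55, 66, 12, 50, 37),
   (61, 47, 25, 76, 72, 79, 30, 21, 5),
   (74, 43, 15, 60, 62, 62, 43, 50, 12),
   (76, 38, 1, 61, 78, 33, 30, 76, 5),
   (77, 43, 12, 57, 56, 59, 43, 50, 12),
   (68, 34, 3, 75, 74, 76, 33, 30, 5),
   (76, 29, 19, 70, 60, 33, 21, 76, 5),
   (70, 32, 1, 73, 78, 33, 76, 30, 5),
   (71, 49, 12, 63, 56, 59, 50, 43, 12)]

/-- The search returns 36 caps, and each is the image of the standard cap under the certificate at
the same place. -/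
theorem twentyCaps_eq : twentyCaps.map maskOf = certificates.map fun (v₀, v₁, v₂, v₃, t, _) =>
    maskOf (stdList.map (affc v₀ v₁ v₂ v₃ t)) := by
  decide +kernel

theorem certificates_valid : ∀ v ∈ certificates,
    match v with
    | (v₀, v₁, v₂, v₃, t, w₀, w₁, w₂, w₃) =>
      IsCodeList [v₀, v₁, v₂, v₃, t] ∧ IsCodeList [w₀, w₁, w₂, w₃] ∧
      [41, 43, 49, 67].map (fun c => linc w₀ w₁ w₂ w₃ (linc v₀ v₁ v₂ v₃ c)) = [41, 43, 49, 67] := by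
  decide +kernel

end Classification

end AG43

namespace AG43

open Finset

/-! ### Maximal caps have 20 points and are all affinely equivalent -/

section MaximalCaps

theorem card_slice {S : Finset Pt} {w q : Pt} {c : ZMod 3} (hq : w ⬝ᵥ q ≠ c) {h : Aff}
    (hh : ∀ x, h x 3 * (w ⬝ᵥ q - c) = w ⬝ᵥ x - c) (t : ZMod 3) :
    #{p ∈ act h S | p 3 = t} = hcount S w (t * (w ⬝ᵥ q - c) + c) := by
  have hq0 : w ⬝ᵥ q - c ≠ 0 := sub_ne_zero.2 hq
  have e : {p ∈ act h S | p 3 = t} = act h {x ∈ S | w ⬝ᵥ x = t * (w ⬝ᵥ q - c) + c} := by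
    have hx (x : Pt) : h x 3 = t ↔ w ⬝ᵥ x = t * (w ⬝ᵥ q - c) + c := by
      rw [← sub_eq_iff_eq_add, ← hh, mul_left_inj' hq0]
    rw [act, act, filter_image]
    simp only [hx]
  rw [e, card_act, hcount]

theorem hcount_le_nine {S : Finset Pt} (hS : IsCap S) {w : Pt} (hw : w ≠ 0) (c : ZMod 3) :
    hcount S w c ≤ 9 := by
  by_contra! hlt
  obtain ⟨q, hq⟩ : ∃ q, w ⬝ᵥ q ≠ c := by
    obtain ⟨i, hi⟩ := Function.ne_iff.1 hw
    by_contra! hne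
    have h0 := hne 0
    have h1 := hne (Pi.single i 1)
    rw [dotProduct_zero] at h0
    rw [dotProduct_single_one, ← h0] at h1
    exact hi h1
  obtain ⟨h, -, hfr, hlev⟩ := exists_frame hS (by omega) hq
  have hcard := card_slice hq hlev (S := S) 0
  rw [zero_mul, zero_add] at hcard
  have hcap : IsCap {p ∈ act h S | p 3 = 0} := (hS.act h).mono (filter_subset _ _)
  have hframe : ([40, 41, 43, 49] : List ℕ).toFinset ⊆ codes {p ∈ act h S | p 3 = 0} := by
    intro d hd
    rw [List.mem_toFinset] at hd
    obtain ⟨x, hx, hxc, hxd⟩ := hfr d hd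
    have hd81 : d < 81 := (by decide : ∀ d ∈ [40, 41, 43, 49], d < 81) d hd
    rw [mem_codes, ← hxd, mem_filter]
    refine ⟨hd81, apply_mem_act.2 hx, ?_⟩
    have := hlev x
    rw [hxc, sub_self, mul_eq_zero] at this
    exact this.resolve_right (sub_ne_zero.2 hq)
  obtain ⟨P, hP1, hP2, hP3⟩ := exists_subsuperset_card_eq (n := 10) hframe (by decide)
    (by rw [card_codes, hcard]; omega)
  obtain ⟨l, hl, -⟩ := mem_extensions (hcap.free.mono hP2) [40, 41, 43, 49] sliceZero 6
    (by decide +kernel) (fun y hy => hP1 (List.mem_toFinset.2 hy)) (by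
      intro y hy
      obtain ⟨hy1, hy2⟩ := mem_codes.1 (hP2 hy)
      have := ((dec_last hy1).1.1 (mem_filter.1 hy2).2)
      by_cases hyf : y ∈ [40, 41, 43, 49]
      · exact .inl hyf
      · refine .inr (mem_filt.2 ⟨?_, ?_⟩)
        · rw [List.mem_range'_1]
          omega
        · rwa [Bool.eq_false_iff, ne_eq, hasBit_maskOf]) hP3
  rw [no_tenCap] at hl
  cases hl

theorem exists_mem_twentyCaps {S : Finset Pt} (hS : IsCap S) (h20 : S.card = 20) :
    ∃ h : Aff, ∃ l ∈ twentyCaps, l.toFinset = codes (act h S) := by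
  obtain ⟨w, hw, c', hc'⟩ := exists_hcount_eq_two hS h20 fun w hw c => hcount_le_nine hS hw c
  have hle := hcount_le_nine hS hw
  have hsum := (sum_hcount S w).trans h20
  have hnine : ∀ c, c ≠ c' → hcount S w c = 9 := by
    have h3 : ∀ a : ZMod 3, a = 0 ∨ a = 1 ∨ a = 2 := by decide
    have h0 := hle 0
    have h1 := hle 1
    have h2 := hle 2
    intro c hc
    rcases h3 c with rfl | rfl | rfl <;> rcases h3 c' with rfl | rfl | rfl <;>
      first | exact absurd rfl hc | omega
  obtain ⟨q, hqS⟩ : ∃ q, q ∈ {x ∈ S | w ⬝ᵥ x = c'} := card_pos.1 (by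
    change 0 < hcount S w c'
    omega)
  obtain ⟨hqS, hqc⟩ := mem_filter.1 hqS
  -- The frame is put into the nine-point slice c' + 1, and its fifth point `q` is taken from the
  -- two-point slice c'. The slices with last coordinate 0, 1, -1 then have sizes 9, 2, 9, as the
  -- search expects.
  have hcc : c' + 1 ≠ c' := (by decide : ∀ c : ZMod 3, c + 1 ≠ c) c'
  have hq : w ⬝ᵥ q ≠ c' + 1 := by
    rw [hqc]
    exact hcc.symm
  obtain ⟨h, hhq, hfr, hlev⟩ := exists_frame hS (by rw [hnine _ hcc]; omega) hq
  have hcard := card_slice hq hlev (S := S)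
  have hneg : w ⬝ᵥ q - (c' + 1) = -1 := by
    rw [hqc]
    ring
  have hcard0 : #{p ∈ act h S | p 3 = 0} = 9 := by
    rw [hcard, zero_mul, zero_add, hnine _ hcc]
  have hcard1 : #{p ∈ act h S | p 3 = 1} = 2 := by
    rw [hcard, hneg, ← hc']
    congr 1
    ring
  have hfree := (hS.act h).free
  set T := act h S with hT
  set P0 := codes {p ∈ T | p 3 = 0} with hP0
  set P1 := codes {p ∈ T | p 3 = 1} with hP1
  have hm0 : ∀ y, y ∈ P0 ↔ y ∈ codes T ∧ (27 ≤ y ∧ y < 54) := by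
    intro y
    rw [hP0, mem_codes, mem_codes, mem_filter, and_assoc]
    exact ⟨fun k => ⟨k.1, k.2.1, (dec_last k.1).1.1 k.2.2⟩,
      fun k => ⟨k.1, k.2.1, (dec_last k.1).1.2 k.2.2⟩⟩
  have hm1 : ∀ y, y ∈ P1 ↔ y ∈ codes T ∧ 54 ≤ y := by
    intro y
    rw [hP1, mem_codes, mem_codes, mem_filter, and_assoc]
    exact ⟨fun k => ⟨k.1, k.2.1, (dec_last k.1).2.1.1 k.2.2⟩,
      fun k => ⟨k.1, k.2.1, (dec_last k.1).2.1.2 k.2.2⟩⟩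
  have hs0 : P0 ⊆ codes T := fun y hy => ((hm0 y).1 hy).1
  have hs1 : P1 ⊆ codes T := fun y hy => ((hm1 y).1 hy).1
  have hc0 : #P0 = 9 := by rw [hP0, card_codes, hcard0]
  have hc1 : #P1 = 2 := by rw [hP1, card_codes, hcard1]
  have hd01 : Disjoint P0 P1 := by
    rw [disjoint_left]
    intro y hy hy'
    have := ((hm0 y).1 hy).2
    have := ((hm1 y).1 hy').2
    omega
  have hframe : ∀ d ∈ [40, 41, 43, 49], d ∈ P0 := by
    intro d hd
    obtain ⟨x, hx, hxc, hxd⟩ := hfr d hd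
    have hd81 : d < 81 := (by decide : ∀ d ∈ [40, 41, 43, 49], d < 81) d hd
    rw [hP0, mem_codes, ← hxd, mem_filter]
    refine ⟨hd81, apply_mem_act.2 hx, ?_⟩
    have := hlev x
    rw [hxc, sub_self, mul_eq_zero] at this
    exact this.resolve_right (sub_ne_zero.2 hq)
  have h67 : 67 ∈ P1 := by
    rw [hm1, mem_codes, ← hhq]
    exact ⟨⟨by norm_num, apply_mem_act.2 hqS⟩, by norm_num⟩
  obtain ⟨l₁, hl₁, e₁⟩ := mem_extensions (hfree.mono hs0) [40, 41, 43, 49] sliceZero 5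
    (by decide +kernel) hframe (by
      intro y hy
      have hy1 := ((hm0 y).1 hy).2
      by_cases hyf : y ∈ [40, 41, 43, 49]
      · exact .inl hyf
      · refine .inr (mem_filt.2 ⟨?_, ?_⟩)
        · rw [List.mem_range'_1]
          omega
        · rwa [Bool.eq_false_iff, ne_eq, hasBit_maskOf]) hc0
  have hlen (l : List ℕ) (hl : l ∈ nineCaps) : l.Nodup ∧ l.length = 9 := by
    revert l
    decide +kernel
  have hml₁ (y : ℕ) : y ∈ l₁ ↔ y ∈ P0 := by rw [← e₁, List.mem_toFinset]
  obtain ⟨l₂, hl₂, e₂⟩ := mem_extensions (P := P0 ∪ P1) (hfree.mono (union_subset hs0 hs1))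
    (67 :: l₁) sliceOne 1 (by
      rw [List.nodup_append, List.nodup_cons]
      refine ⟨⟨fun h => ?_, (hlen l₁ hl₁).1⟩, by decide +kernel, fun a ha b hb => ?_⟩
      · have := ((hm0 67).1 ((hml₁ 67).1 h)).2
        omega
      · obtain ⟨hb1, hb2⟩ := mem_filt.1 hb
        rw [List.mem_range'_1] at hb1
        rw [Bool.eq_false_iff, ne_eq, hasBit_bit] at hb2
        rcases List.mem_cons.1 ha with rfl | ha
        · exact Ne.symm hb2
        · have := ((hm0 a).1 ((hml₁ a).1 ha)).2
          omega)
    (by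
      intro y hy
      rcases List.mem_cons.1 hy with rfl | hy
      · exact mem_union_right _ h67
      · exact mem_union_left _ ((hml₁ y).1 hy))
    (by
      intro y hy
      rcases mem_union.1 hy with hy | hy
      · exact .inl (List.mem_cons_of_mem _ ((hml₁ y).2 hy))
      · by_cases hy67 : y = 67
        · exact .inl (hy67 ▸ List.mem_cons_self)
        · refine .inr (mem_filt.2 ⟨?_, ?_⟩)
          · have h1 := ((hm1 y).1 hy).2
            have h2 := (mem_codes.1 (hs1 hy)).1
            rw [List.mem_range'_1]
            omega
          · rwa [Bool.eq_false_iff, ne_eq, hasBit_bit])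
    (by rw [card_union_of_disjoint hd01, hc0, hc1, List.length_cons, (hlen l₁ hl₁).2])
  have hlen₂ (l : List ℕ) (hl : l ∈ nineCaps.flatMap fun l =>
      extensions killLine (67 :: l) sliceOne 1) : l.Nodup ∧ l.length = 11 := by
    revert l
    decide +kernel
  have hl₂' : l₂ ∈ nineCaps.flatMap fun l => extensions killLine (67 :: l) sliceOne 1 :=
    List.mem_flatMap.2 ⟨l₁, hl₁, hl₂⟩
  have hml₂ (y : ℕ) : y ∈ l₂ ↔ y ∈ P0 ∪ P1 := by rw [← e₂, List.mem_toFinset]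
  obtain ⟨l₃, hl₃, e₃⟩ := mem_extensions hfree l₂ (List.range 27) 9 (by
      rw [List.nodup_append]
      refine ⟨(hlen₂ l₂ hl₂').1, List.nodup_range, fun a ha b hb => ?_⟩
      rw [List.mem_range] at hb
      rcases mem_union.1 ((hml₂ a).1 ha) with ha | ha
      · have := ((hm0 a).1 ha).2
        omega
      · have := ((hm1 a).1 ha).2
        omega)
    (fun y hy => union_subset hs0 hs1 ((hml₂ y).1 hy))
    (by
      intro y hy
      rw [hml₂, mem_union, hm0, hm1, List.mem_range]
      by_cases h1 : 27 ≤ y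
      · left
        by_cases h2 : y < 54
        · exact .inl ⟨hy, h1, h2⟩
        · exact .inr ⟨hy, by omega⟩
      · exact .inr (by omega))
    (by rw [card_codes, hT, card_act, h20, (hlen₂ l₂ hl₂').2])
  exact ⟨h, l₃, List.mem_flatMap.2 ⟨l₂, hl₂', hl₃⟩, e₃⟩

theorem isCodeList_stdList : IsCodeList stdList := by decide +kernel

theorem exists_eq_act_stdCap {S : Finset Pt} (hS : IsCap S) (h20 : S.card = 20) :
    ∃ g : Aff, S = act g stdCap := by
  obtain ⟨h, l, hl, e⟩ := exists_mem_twentyCaps hS h20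
  have hm := List.mem_map_of_mem (f := maskOf) hl
  rw [twentyCaps_eq] at hm
  obtain ⟨⟨v₀, v₁, v₂, v₃, t, w₀, w₁, w₂, w₃⟩, hv, hvl⟩ := List.mem_map.1 hm
  obtain ⟨hc1, hc2, hc3⟩ := certificates_valid _ hv
  obtain ⟨g, hg⟩ := exists_aff hc1 hc2 hc3
  refine ⟨h⁻¹ * g, ?_⟩
  rw [act_mul, stdCap, act_pts hg isCodeList_stdList, pts_congr hvl, pts_codes e, act_inv_act]

theorem third_comm {x y : ℕ} (hx : x < 81) (hy : y < 81) : third x y = third y x :=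
  dec_injective (third_lt hx hy) (third_lt hy hx)
    (by rw [dec_third hx hy, dec_third hy hx, add_comm])

theorem hasBit_killPairs_of_mem {kill : ℕ → ℕ → ℕ} {l : List ℕ} {x y z : ℕ} (hx : x ∈ l)
    (hy : y ∈ l) (hxy : x ≠ y) (h : hasBit (kill x y) z = true) (h' : hasBit (kill y x) z = true) :
    hasBit (killPairs kill l) z = true := by
  induction l with
  | nil => cases hx
  | cons a l ih =>
    rw [killPairs, hasBit_lor, Bool.or_eq_true]
    rcases List.mem_cons.1 hx with rfl | hx'
    · exact .inl (hasBit_killAll.2 ⟨y, (List.mem_cons.1 hy).resolve_left hxy.symm, h⟩)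
    · rcases List.mem_cons.1 hy with rfl | hy'
      · exact .inl (hasBit_killAll.2 ⟨x, hx', h'⟩)
      · exact .inr (ih hx' hy')

theorem exists_of_hasBit_killPairs {kill : ℕ → ℕ → ℕ} {l : List ℕ} (hl : l.Nodup) {z : ℕ}
    (h : hasBit (killPairs kill l) z = true) :
    ∃ x ∈ l, ∃ y ∈ l, x ≠ y ∧ hasBit (kill x y) z = true := by
  induction l with
  | nil => rw [killPairs, hasBit_zero] at h; cases h
  | cons a l ih =>
    rw [List.nodup_cons] at hl
    rw [killPairs, hasBit_lor, Bool.or_eq_true] at h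
    rcases h with h | h
    · obtain ⟨y, hy, hk⟩ := hasBit_killAll.1 h
      exact ⟨a, List.mem_cons_self, y, List.mem_cons_of_mem _ hy, by rintro rfl; exact hl.1 hy, hk⟩
    · obtain ⟨x, hx, y, hy, hk⟩ := ih hl.2 h
      exact ⟨x, List.mem_cons_of_mem _ hx, y, List.mem_cons_of_mem _ hy, hk⟩

theorem hasBit_land (m m' z : ℕ) : hasBit (Nat.land m m') z = (hasBit m z && hasBit m' z) := by
  simp only [hasBit_eq]
  exact Nat.testBit_and ..

/-- No two elements of the list forbid another element of the list. -/
def isFreeList (kill : ℕ → ℕ → ℕ) (l : List ℕ) : Bool :=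
  Nat.beq (Nat.land (maskOf l) (killPairs kill l)) 0

theorem isFreeList_spec {kill : ℕ → ℕ → ℕ} {l : List ℕ} (h : isFreeList kill l = true) {z : ℕ}
    (hz : z ∈ l) : hasBit (killPairs kill l) z = false := by
  have h1 : hasBit (Nat.land (maskOf l) (killPairs kill l)) z = false := by
    rw [Nat.eq_of_beq_eq_true h, hasBit_zero]
  rwa [hasBit_land, hasBit_maskOf.2 hz, Bool.true_and] at h1

theorem isCap_pts {l : List ℕ} (hl : IsCodeList l) (h : isFreeList killLine l = true) :
    IsCap (pts l) := by
  rw [isCap_iff]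
  intro x hx y hy hxy hz
  obtain ⟨a, ha, rfl⟩ := mem_pts.1 hx
  obtain ⟨b, hb, rfl⟩ := mem_pts.1 hy
  have ha' := hl a ha
  have hb' := hl b hb
  rw [← dec_third ha' hb', dec_mem_pts hl (third_lt ha' hb')] at hz
  have hk := hasBit_killPairs_of_mem (kill := killLine) (z := third a b) ha hb
    (fun h => hxy (congrArg dec h)) ((hasBit_bit _ _).2 rfl)
    ((hasBit_bit _ _).2 (third_comm ha' hb'))
  rw [isFreeList_spec h hz] at hk
  cases hk

theorem isCap_stdCap : IsCap stdCap := isCap_pts isCodeList_stdList (by decide +kernel)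

theorem card_stdCap : stdCap.card = 20 := card_pts isCodeList_stdList (by decide +kernel)

/-- Each point outside the cap is the third point on a line through two points of the cap, which one
mask computation confirms. -/
theorem stdCap_complete {p : Pt} (hp : p ∉ stdCap) : ¬ IsCap (insert p stdCap) := by
  rw [isCap_iff]
  push Not
  have hk : ∀ c < 81, c ∉ stdList → hasBit (killPairs killLine stdList) c = true := by
    decide +kernel
  have hp' : enc p ∉ stdList := fun h => hp (mem_pts.2 ⟨_, h, dec_enc p⟩)
  obtain ⟨x, hx, y, hy, hxy, h⟩ := exists_of_hasBit_killPairs (by decide +kernel)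
    (hk _ (enc_lt p) hp')
  have hx' := isCodeList_stdList x hx
  have hy' := isCodeList_stdList y hy
  rw [killLine, hasBit_bit] at h
  refine ⟨dec x, mem_insert_of_mem (mem_pts.2 ⟨x, hx, rfl⟩), dec y,
    mem_insert_of_mem (mem_pts.2 ⟨y, hy, rfl⟩), fun h => hxy (dec_injective hx' hy' h), ?_⟩
  rw [← dec_third hx' hy', ← h, dec_enc]
  exact mem_insert_self _ _

/-- A larger cap would properly contain a 20-point cap, which is an affine image of `stdCap` and so
cannot be extended. -/
theorem IsCap.card_le_twenty {S : Finset Pt} (hS : IsCap S) : S.card ≤ 20 := by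
  by_contra! h
  obtain ⟨T, hTS, hT⟩ := exists_subset_card_eq h.le
  obtain ⟨g, rfl⟩ := exists_eq_act_stdCap (hS.mono hTS) hT
  obtain ⟨p, hp, hpT⟩ := exists_mem_notMem_of_card_lt_card (hT.trans_lt h)
  obtain ⟨p, rfl⟩ := g.surjective p
  rw [apply_mem_act] at hpT
  refine stdCap_complete hpT ?_
  have h2 : IsCap (AG43.act g (insert p stdCap)) := by
    refine hS.mono ?_
    rw [AG43.act, image_insert]
    exact insert_subset hp hTS
  simpa [act_inv_act] using h2.act g⁻¹

theorem isMaximalCap_iff {M : Finset Pt} : IsMaximalCap M ↔ IsCap M ∧ M.card = 20 := by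
  constructor
  · intro h
    refine ⟨h.1, le_antisymm h.1.card_le_twenty ?_⟩
    rw [← card_stdCap]
    exact h.2 _ isCap_stdCap
  · exact fun h => ⟨h.1, fun S hS => h.2 ▸ hS.card_le_twenty⟩

theorem isMaximalCap_stdCap : IsMaximalCap stdCap :=
  isMaximalCap_iff.2 ⟨isCap_stdCap, card_stdCap⟩

theorem IsMaximalCap.exists_eq {M : Finset Pt} (hM : IsMaximalCap M) :
    ∃ g : Aff, M = AG43.act g stdCap :=
  exists_eq_act_stdCap hM.1 (isMaximalCap_iff.1 hM).2

end MaximalCaps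

end AG43

namespace AG43

open Finset

/-! ### The standard families of demicaps -/

section StandardFamilies

/-- The codes of a set that is symmetric about the origin, from the codes of one point of each
pair. -/
def symList (l : List ℕ) : List ℕ := l ++ l.map negc

/-- The set that is symmetric about the origin, from the codes of one point of each pair. -/
def sym (l : List ℕ) : Finset Pt := pts (symList l)

/-- One point of each pair of the demicaps of the first standard family. -/
def rowList : Fin 6 → List ℕ :=
  ![[0, 21, 27, 36, 39], [1, 23, 28, 37, 39], [4, 20, 31, 36, 37], [11, 13, 27, 28, 31],
    [0, 1, 4, 13, 15], [11, 15, 20, 21, 23]]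

/-- One point of each pair of the demicaps of the second standard family. -/
def colList : Fin 6 → List ℕ :=
  ![[3, 9, 14, 19, 33], [5, 10, 12, 18, 33], [3, 10, 17, 24, 32], [5, 9, 16, 24, 30],
    [6, 14, 16, 18, 32], [6, 12, 17, 19, 30]]

/-- The first standard family of demicaps. -/
def stdRow (i : Fin 6) : Finset Pt := sym (rowList i)

/-- The second standard family of demicaps. -/
def stdCol (j : Fin 6) : Finset Pt := sym (colList j)

/-- The action of the adjacent transpositions on the second family. -/
def synthemes : Fin 5 → Equiv.Perm (Fin 6) :=
  ![Equiv.swap 0 1 * Equiv.swap 2 3 * Equiv.swap 4 5,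
    Equiv.swap 0 5 * Equiv.swap 1 3 * Equiv.swap 2 4,
    Equiv.swap 0 1 * Equiv.swap 2 5 * Equiv.swap 3 4,
    Equiv.swap 0 5 * Equiv.swap 1 4 * Equiv.swap 2 3,
    Equiv.swap 0 1 * Equiv.swap 2 4 * Equiv.swap 3 5]

/-- The linear maps inducing the adjacent transpositions on the first family. -/
def reflections : Fin 5 → ℕ × ℕ × ℕ × ℕ :=
  ![(39, 44, 49, 67), (44, 37, 52, 67), (41, 52, 31, 76), (41, 43, 76, 13), (41, 43, 49, 11)]

theorem isCodeList_symList {l : List ℕ} (hl : IsCodeList l) : IsCodeList (symList l) := by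
  intro c hc
  rcases List.mem_append.1 hc with hc | hc
  · exact hl c hc
  · obtain ⟨d, -, rfl⟩ := List.mem_map.1 hc
    exact negc_lt

theorem isCodeList_row (i : Fin 6) : IsCodeList (rowList i) := by
  revert i; decide +kernel

theorem isCodeList_col (i : Fin 6) : IsCodeList (colList i) := by
  revert i; decide +kernel

/-- In the model these maps transpose two adjacent symbols. They are involutions, so the same four
codes also serve as inverse matrix. -/
theorem reflections_valid : ∀ k : Fin 5,
    match reflections k with
    | (v₀, v₁, v₂, v₃) => IsCodeList [v₀, v₁, v₂, v₃, 40] ∧ IsCodeList [v₀, v₁, v₂, v₃] ∧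
      [41, 43, 49, 67].map (fun c => linc v₀ v₁ v₂ v₃ (linc v₀ v₁ v₂ v₃ c)) = [41, 43, 49, 67] ∧
      maskOf (stdList.map (affc v₀ v₁ v₂ v₃ 40)) = maskOf stdList ∧
      (∀ i, maskOf ((symList (rowList i)).map (affc v₀ v₁ v₂ v₃ 40)) =
        maskOf (symList (rowList (Equiv.swap k.castSucc k.succ i)))) ∧
      ∀ j, maskOf ((symList (colList j)).map (affc v₀ v₁ v₂ v₃ 40)) =
        maskOf (symList (colList (synthemes k j))) := by
  decide +kernel

theorem exists_reflection (k : Fin 5) : ∃ g : Aff, act g stdCap = stdCap ∧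
    PermutesBy g stdRow stdCol (Equiv.swap k.castSucc k.succ) (synthemes k) := by
  have h := reflections_valid k
  obtain ⟨⟨v₀, v₁, v₂, v₃⟩, hv⟩ : ∃ v, reflections k = v := ⟨_, rfl⟩
  rw [hv] at h
  obtain ⟨h1, h2, h3, h4, h5, h6⟩ := h
  obtain ⟨g, hg⟩ := exists_aff h1 h2 h3
  refine ⟨g, ?_, fun i => ?_, fun j => ?_⟩
  · rw [stdCap, act_pts hg isCodeList_stdList, pts_congr h4]
  · rw [stdRow, sym, act_pts hg (isCodeList_symList (isCodeList_row i)), pts_congr (h5 i)]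
    rfl
  · rw [stdCol, sym, act_pts hg (isCodeList_symList (isCodeList_col j)), pts_congr (h6 j)]
    rfl

/-- The numberings are matched so that row i and column i are exchanged in both directions; this is
what later makes the linking automorphism an involution. The inverse matrix is the negative of the
matrix, so the square of the map is -I. -/
theorem duality_valid : IsCodeList [47, 70, 56, 16, 40] ∧ IsCodeList [33, 10, 24, 64] ∧
    [41, 43, 49, 67].map (fun c => linc 33 10 24 64 (linc 47 70 56 16 c)) = [41, 43, 49, 67] ∧
    maskOf (stdList.map (affc 47 70 56 16 40)) = maskOf stdList ∧
    (∀ i, maskOf ((symList (rowList i)).map (affc 47 70 56 16 40)) =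
      maskOf (symList (colList i))) ∧
    ∀ j, maskOf ((symList (colList j)).map (affc 47 70 56 16 40)) =
      maskOf (symList (rowList j)) := by
  decide +kernel

theorem exists_duality : ∃ g : Aff, act g stdCap = stdCap ∧ SwapsBy g stdRow stdCol 1 1 := by
  obtain ⟨h1, h2, h3, h4, h5, h6⟩ := duality_valid
  obtain ⟨g, hg⟩ := exists_aff h1 h2 h3
  refine ⟨g, ?_, fun i => ?_, fun j => ?_⟩
  · rw [stdCap, act_pts hg isCodeList_stdList, pts_congr h4]
  · rw [stdRow, sym, act_pts hg (isCodeList_symList (isCodeList_row i)), pts_congr (h5 i)]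
    rfl
  · rw [stdCol, sym, act_pts hg (isCodeList_symList (isCodeList_col j)), pts_congr (h6 j)]
    rfl

theorem mem_sym {l : List ℕ} (hl : IsCodeList l) {c : ℕ} (hc : c < 81) :
    dec c ∈ sym l ↔ c ∈ symList l :=
  dec_mem_pts (isCodeList_symList hl) hc

end StandardFamilies

/-! ### Pairs of points of a maximal cap on lines through a point -/

section Anchors

/-- Bounds the part of the cap that can be paired off about a point other than the origin. Hence the
anchor is unique, even for subsets with seven or more points. -/
theorem card_partners_le : ∀ c : ℕ, c < 81 → c ≠ 40 →
    (stdList.filter fun x => stdList.contains (third c x)).length ≤ 6 := by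
  decide +kernel

theorem anchor_eq_zero {D : Finset Pt} (hD : D ⊆ stdCap) (h7 : 7 ≤ #D) {b : Pt}
    (hb : IsAnchor b D) : b = 0 := by
  by_contra hne
  rw [isAnchor_iff] at hb
  have h40 : enc b ≠ 40 := by
    intro h
    rw [← dec_enc b, h, dec_forty] at hne
    exact hne rfl
  have hle := card_partners_le _ (enc_lt b) h40
  have hsub : codes D ⊆ (stdList.filter fun x => stdList.contains (third (enc b) x)).toFinset := by
    intro x hx
    obtain ⟨hx1, hx2⟩ := mem_codes.1 hx
    rw [List.mem_toFinset, List.mem_filter, List.contains_iff_mem]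
    refine ⟨(dec_mem_pts isCodeList_stdList hx1).1 (hD hx2), ?_⟩
    rw [← dec_mem_pts isCodeList_stdList (third_lt (enc_lt b) hx1), dec_third (enc_lt b) hx1,
      dec_enc]
    exact hD (hb _ hx2).2
  have := (card_le_card hsub).trans (List.toFinset_card_le _)
  rw [card_codes] at this
  omega

theorem isAnchor_zero_iff {S : Finset Pt} : IsAnchor 0 S ↔ 0 ∉ S ∧ ∀ x ∈ S, -x ∈ S := by
  rw [isAnchor_iff]
  simp only [zero_add]
  exact ⟨fun h => ⟨fun h0 => (h 0 h0).1 rfl, fun x hx => (h x hx).2⟩,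
    fun h x hx => ⟨fun h0 => h.1 (h0 ▸ hx), h.2 x hx⟩⟩

theorem isAnchor_sym {l : List ℕ} (hl : IsCodeList l) (h40 : 40 ∉ symList l) :
    IsAnchor 0 (sym l) := by
  rw [isAnchor_zero_iff]
  constructor
  · rwa [← dec_forty, mem_sym hl (by norm_num)]
  · intro x hx
    obtain ⟨c, hc, rfl⟩ := mem_pts.1 hx
    have hc81 := isCodeList_symList hl c hc
    rw [← dec_negc hc81]
    refine mem_pts.2 ⟨negc c, ?_, rfl⟩
    rcases List.mem_append.1 hc with hc | hc
    · exact List.mem_append_right _ (List.mem_map_of_mem hc)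
    · obtain ⟨d, hd, rfl⟩ := List.mem_map.1 hc
      have : negc (negc d) = d := by
        have := hl d hd
        change 80 - (80 - d) = d
        omega
      rw [this]
      exact List.mem_append_left _ hd

theorem stdCap_eq_sym : stdCap = sym (filt (maskOf (List.range' 40 41)) stdList) :=
  pts_congr (by decide +kernel)

theorem isAnchor_stdCap : IsAnchor 0 stdCap := by
  rw [stdCap_eq_sym]
  exact isAnchor_sym (by decide +kernel) (by decide +kernel)

/-- The form with subsets of at least seven points is what forces a demicap inside a maximal cap to
have the same anchor as the cap. -/
theorem IsMaximalCap.exists_anchor {M : Finset Pt} (hM : IsMaximalCap M) :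
    ∃ a, IsAnchor a M ∧ ∀ D ⊆ M, 7 ≤ #D → ∀ b, IsAnchor b D → b = a := by
  obtain ⟨g, rfl⟩ := hM.exists_eq
  refine ⟨g 0, isAnchor_act.2 isAnchor_stdCap, fun D hD h7 b hb => ?_⟩
  obtain ⟨b, rfl⟩ := g.surjective b
  obtain ⟨D, rfl⟩ : ∃ D', D = AG43.act g D' := ⟨_, (act_act_inv g D).symm⟩
  rw [anchor_eq_zero (act_subset_act.1 hD) (by rwa [card_act] at h7) (isAnchor_act.1 hb)]

end Anchors

end AG43

namespace AG43

open Finset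

/-! ### Maximal caps with anchor point `0` as sets of ten pairs -/

section Ovoids

/-- The mask that forbids all points completing a line with `±x` and `±y`. -/
def killPair (x y : ℕ) : ℕ :=
  let f := fun a => Nat.lor (bit a) (bit (negc a))
  Nat.lor (f (third x y)) (f (third x (negc y)))

theorem hasBit_killPair {x y z : ℕ} : hasBit (killPair x y) z = true ↔
    (z = third x y ∨ z = negc (third x y)) ∨ z = third x (negc y) ∨ z = negc (third x (negc y)) := by
  unfold killPair
  simp only [hasBit_lor, Bool.or_eq_true, hasBit_bit]

/-- The codes of representatives of the pairs of points of a set with anchor point `0`. -/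
def reps (M : Finset Pt) : Finset ℕ := {c ∈ codes M | c < 40}

theorem mem_reps {M : Finset Pt} {c : ℕ} : c ∈ reps M ↔ c < 40 ∧ dec c ∈ M := by
  rw [reps, mem_filter, mem_codes]
  exact ⟨fun h => ⟨h.2, h.1.2⟩, fun h => ⟨⟨by omega, h.2⟩, h.1⟩⟩

/-- All entries are codes of chosen representatives of pairs. -/
def IsRepList (l : List ℕ) : Prop := ∀ c ∈ l, c < 40

instance : DecidablePred IsRepList := fun l => inferInstanceAs (Decidable (∀ c ∈ l, c < 40))

theorem IsRepList.isCodeList {l : List ℕ} (hl : IsRepList l) : IsCodeList l :=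
  fun c hc => (hl c hc).trans (by norm_num)

theorem negc_eq (c : ℕ) : negc c = 80 - c := rfl

theorem dec_mem_sym {l : List ℕ} (hl : IsRepList l) {c : ℕ} (hc : c < 81) :
    dec c ∈ sym l ↔ c ∈ l ∨ negc c ∈ l := by
  rw [mem_sym hl.isCodeList hc, symList, List.mem_append, List.mem_map]
  refine or_congr Iff.rfl ⟨?_, fun h => ⟨_, h, by rw [negc_eq, negc_eq]; omega⟩⟩
  rintro ⟨d, hd, rfl⟩
  have := hl d hd
  rwa [negc_eq, negc_eq, Nat.sub_sub_self (by omega)]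

theorem dec_mem_sym_of_lt {l : List ℕ} (hl : IsRepList l) {c : ℕ} (hc : c < 40) :
    dec c ∈ sym l ↔ c ∈ l := by
  rw [dec_mem_sym hl (by omega)]
  refine or_iff_left fun h => ?_
  have := hl _ h
  rw [negc_eq] at this
  omega

theorem sym_sdiff {l n : List ℕ} (hl : IsRepList l) (hn : IsRepList n) :
    sym l \ sym n = sym (filt (maskOf n) l) := by
  have hf : IsRepList (filt (maskOf n) l) := fun c hc => hl c (mem_filt.1 hc).1
  ext p
  rw [← dec_enc p, mem_sdiff, dec_mem_sym hl (enc_lt p), dec_mem_sym hn (enc_lt p),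
    dec_mem_sym hf (enc_lt p), mem_filt, mem_filt, Bool.eq_false_iff, ne_eq, hasBit_maskOf,
    Bool.eq_false_iff, ne_eq, hasBit_maskOf]
  constructor
  · rintro ⟨h | h, h'⟩
    · exact .inl ⟨h, fun h1 => h' (.inl h1)⟩
    · exact .inr ⟨h, fun h1 => h' (.inr h1)⟩
  · rintro (h | h)
    · refine ⟨.inl h.1, ?_⟩
      rintro (h1 | h1)
      · exact h.2 h1
      · have h2 := hl _ h.1
        have h3 := hn _ h1
        rw [negc_eq] at h3
        omega
    · refine ⟨.inr h.1, ?_⟩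
      rintro (h1 | h1)
      · have h2 := hl _ h.1
        have h3 := hn _ h1
        rw [negc_eq] at h2
        omega
      · exact h.2 h1

theorem card_sym {l : List ℕ} (hl : IsRepList l) (hnd : l.Nodup) : #(sym l) = 2 * l.length := by
  rw [sym, card_pts (isCodeList_symList hl.isCodeList), symList, List.length_append,
    List.length_map]
  · ring
  · rw [symList, List.nodup_append]
    refine ⟨hnd, hnd.map_on fun x hx y hy h => ?_, fun a ha b hb => ?_⟩
    · have := hl x hx
      have := hl y hy
      rw [negc_eq, negc_eq] at h
      omega
    · obtain ⟨d, hd, rfl⟩ := List.mem_map.1 hb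
      have := hl a ha
      have := hl d hd
      rw [negc_eq]
      omega

theorem sym_eq_of_reps {M : Finset Pt} (hM : IsAnchor 0 M) {l : List ℕ}
    (h : l.toFinset = reps M) : sym l = M := by
  rw [isAnchor_zero_iff] at hM
  have hmem (c : ℕ) : c ∈ l ↔ c < 40 ∧ dec c ∈ M := by rw [← mem_reps, ← h, List.mem_toFinset]
  have hl : IsRepList l := fun c hc => ((hmem c).1 hc).1
  ext p
  rw [← dec_enc p]
  set c := enc p
  have hc : c < 81 := enc_lt p
  rw [dec_mem_sym hl hc, hmem, hmem, dec_negc hc]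
  constructor
  · rintro (h | h)
    · exact h.2
    · simpa using hM.2 _ h.2
  · intro hp
    have h40 : c ≠ 40 := by
      rintro h
      rw [h, dec_forty] at hp
      exact hM.1 hp
    by_cases h : c < 40
    · exact .inl ⟨h, hp⟩
    · exact .inr ⟨by rw [negc_eq]; omega, hM.2 _ hp⟩

theorem card_eq_two_mul_card_reps {M : Finset Pt} (hM : IsAnchor 0 M) : #M = 2 * #(reps M) := by
  have h := sym_eq_of_reps hM (l := (reps M).toList) (toList_toFinset _)
  conv_lhs => rw [← h]
  rw [card_sym (fun c hc => (mem_reps.1 (mem_toList.1 hc)).1) (nodup_toList _), length_toList]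

/-- Passing to antipodal pairs means passing to points of PG(3,3). By symmetry of the cap, two pairs
±x, ±y exclude both further pairs ±(x + y), ±(x - y) on their projective line. -/
theorem IsCap.free_reps {M : Finset Pt} (hM : IsCap M) (ha : IsAnchor 0 M) :
    Free killPair (reps M) := by
  rw [isAnchor_zero_iff] at ha
  rw [isCap_iff] at hM
  intro x hx y hy z hz hxy _ _
  rw [mem_reps] at hx hy hz
  have hx' : x < 81 := by omega
  have hy' : y < 81 := by omega
  have hz' : z < 81 := by omega
  have hny : negc y < 81 := negc_lt
  have h1 := hM _ hx.2 _ hy.2 fun h => hxy (dec_injective hx' hy' h)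
  have h2 := hM _ hx.2 _ (dec_negc hy' ▸ ha.2 _ hy.2) fun h => by
    have := dec_injective hx' hny h
    rw [negc_eq] at this
    omega
  rw [← dec_third hx' hy'] at h1
  rw [← dec_third hx' hny] at h2
  rw [Bool.eq_false_iff]
  intro h
  rcases hasBit_killPair.1 h with (rfl | rfl) | rfl | rfl
  · exact h1 hz.2
  · apply h1
    have := ha.2 _ hz.2
    rwa [dec_negc (third_lt hx' hy'), neg_neg] at this
  · exact h2 hz.2
  · apply h2
    have := ha.2 _ hz.2
    rwa [dec_negc (third_lt hx' hny), neg_neg] at this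

theorem IsMaximalCap.mem_extensions {M : Finset Pt} (hM : IsMaximalCap M) (ha : IsAnchor 0 M)
    (cur av : List ℕ) (n : ℕ) (hnd : (cur ++ av).Nodup) (hrep : IsRepList cur)
    (hcur : ∀ c ∈ cur, dec c ∈ M) (hsub : ∀ c < 40, dec c ∈ M → c ∈ cur ∨ c ∈ av)
    (hn : cur.length + n = 10) : ∃ l ∈ extensions killPair cur av n, IsRepList l ∧ sym l = M := by
  obtain ⟨l, hl, h⟩ := AG43.mem_extensions (hM.1.free_reps ha) cur av n hnd
    (fun y hy => mem_reps.2 ⟨hrep y hy, hcur y hy⟩)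
    (fun y hy => hsub y (mem_reps.1 hy).1 (mem_reps.1 hy).2) (by
      have h1 := card_eq_two_mul_card_reps ha
      have h2 := (isMaximalCap_iff.1 hM).2
      omega)
  exact ⟨l, hl, fun c hc => (mem_reps.1 (h ▸ List.mem_toFinset.2 hc)).1, sym_eq_of_reps ha h⟩

/-- The list gives a maximal cap with anchor point `0`. -/
def IsOvoidList (l : List ℕ) : Prop :=
  IsRepList l ∧ l.Nodup ∧ l.length = 10 ∧ isFreeList killLine (symList l) = true

instance : DecidablePred IsOvoidList := fun l =>
  inferInstanceAs (Decidable (IsRepList l ∧ l.Nodup ∧ l.length = 10 ∧ _ = true))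

theorem forty_notMem_symList {l : List ℕ} (hl : IsRepList l) : 40 ∉ symList l := by
  intro h
  rcases List.mem_append.1 h with h | h
  · exact absurd (hl _ h) (by norm_num)
  · obtain ⟨d, hd, h⟩ := List.mem_map.1 h
    have := hl d hd
    rw [negc_eq] at h
    omega

theorem IsRepList.isAnchor {l : List ℕ} (hl : IsRepList l) : IsAnchor 0 (sym l) :=
  isAnchor_sym hl.isCodeList (forty_notMem_symList hl)

theorem IsOvoidList.isMaximalCap {l : List ℕ} (h : IsOvoidList l) : IsMaximalCap (sym l) := by
  obtain ⟨h1, h2, h3, h4⟩ := h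
  exact isMaximalCap_iff.2 ⟨isCap_pts (isCodeList_symList h1.isCodeList) h4,
    by rw [card_sym h1 h2, h3]⟩

end Ovoids

/-! ### Partitions into maximal caps -/

section Partitions

/-- The points other than `0` outside the standard cap and `M`. -/
def outside (M : Finset Pt) : Finset Pt := univ \ insert 0 (stdCap ∪ M)

/-- `N` completes the standard cap and `M` to a partition. -/
def Completes (M N : Finset Pt) : Prop :=
  N ⊆ outside M ∧ IsMaximalCap N ∧ IsAnchor 0 N ∧
    IsMaximalCap (outside M \ N) ∧ IsAnchor 0 (outside M \ N)

theorem mem_outside {M : Finset Pt} {x : Pt} :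
    x ∈ outside M ↔ x ≠ 0 ∧ x ∉ stdCap ∧ x ∉ M := by
  simp [outside]

theorem IsMaximalCap.nonempty {M : Finset Pt} (hM : IsMaximalCap M) : M.Nonempty :=
  card_pos.1 (by rw [(isMaximalCap_iff.1 hM).2]; norm_num)

theorem ne_of_mem_of_notMem {M N : Finset Pt} {x : Pt} (h : x ∈ M) (h' : x ∉ N) : M ≠ N := by
  rintro rfl
  exact h' h

theorem isCapPartition_of_completes {M N : Finset Pt} (hM : IsMaximalCap M) (hMa : IsAnchor 0 M)
    (hd : Disjoint stdCap M) (h : Completes M N) :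
    IsCapPartition {stdCap, M, N, outside M \ N} := by
  obtain ⟨h1, h2, h3, h4, h5⟩ := h
  obtain ⟨x, hx⟩ := h2.nonempty
  obtain ⟨y, hy⟩ := h4.nonempty
  obtain ⟨z, hz⟩ := hM.nonempty
  have hx' := mem_outside.1 (h1 hx)
  obtain ⟨hy1, hy2⟩ := mem_sdiff.1 hy
  have hy' := mem_outside.1 hy1
  have hz' : z ∉ stdCap := fun h => disjoint_left.1 hd h hz
  have dN : Disjoint stdCap N :=
    disjoint_left.2 fun p hp hp' => (mem_outside.1 (h1 hp')).2.1 hp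
  have dMN : Disjoint M N := disjoint_left.2 fun p hp hp' => (mem_outside.1 (h1 hp')).2.2 hp
  have dK : Disjoint stdCap (outside M \ N) :=
    disjoint_left.2 fun p hp hp' => (mem_outside.1 (mem_sdiff.1 hp').1).2.1 hp
  have dMK : Disjoint M (outside M \ N) :=
    disjoint_left.2 fun p hp hp' => (mem_outside.1 (mem_sdiff.1 hp').1).2.2 hp
  have dNK : Disjoint N (outside M \ N) := disjoint_sdiff
  refine ⟨?_, ?_, ?_, 0, ?_, ?_⟩
  · rw [card_insert_of_notMem, card_insert_of_notMem, card_insert_of_notMem, card_singleton]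
    · rw [mem_singleton]
      exact (ne_of_mem_of_notMem hy hy2).symm
    · rw [mem_insert, mem_singleton, not_or]
      exact ⟨(ne_of_mem_of_notMem hx hx'.2.2).symm, (ne_of_mem_of_notMem hy hy'.2.2).symm⟩
    · rw [mem_insert, mem_insert, mem_singleton, not_or, not_or]
      exact ⟨(ne_of_mem_of_notMem hz hz').symm, (ne_of_mem_of_notMem hx hx'.2.1).symm,
        (ne_of_mem_of_notMem hy hy'.2.1).symm⟩
  · simp only [mem_insert, mem_singleton, forall_eq_or_imp, forall_eq]
    exact ⟨isMaximalCap_stdCap, hM, h2, h4⟩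
  · simp only [mem_insert, mem_singleton, forall_eq_or_imp, forall_eq]
    simp only [hd, hd.symm, dN, dN.symm, dMN, dMN.symm, dK, dK.symm, dMK, dMK.symm, dNK, dNK.symm,
      implies_true, ne_eq, not_true_eq_false, IsEmpty.forall_iff, and_self]
  · simp only [mem_insert, mem_singleton, forall_eq_or_imp, forall_eq]
    exact ⟨isAnchor_stdCap, hMa, h3, h5⟩
  · ext p
    simp only [biUnion_insert, singleton_biUnion, id, mem_union, mem_sdiff, mem_outside, mem_erase,
      mem_univ, and_true]
    have e1 := (isAnchor_zero_iff.1 isAnchor_stdCap).1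
    have e2 := (isAnchor_zero_iff.1 hMa).1
    constructor
    · rintro (h | h | h | h) rfl
      · exact e1 h
      · exact e2 h
      · exact (mem_outside.1 (h1 h)).1 rfl
      · exact h.1.1 rfl
    · intro h0
      by_cases k1 : p ∈ stdCap
      · exact .inl k1
      by_cases k2 : p ∈ M
      · exact .inr (.inl k2)
      by_cases k3 : p ∈ N
      · exact .inr (.inr (.inl k3))
      · exact .inr (.inr (.inr ⟨⟨h0, k1, k2⟩, k3⟩))

theorem IsCapPartition.anchor_zero {P : Finset (Finset Pt)} (hP : IsCapPartition P)
    (hC : stdCap ∈ P) : (∀ M ∈ P, IsAnchor 0 M) ∧ P.biUnion id = univ.erase 0 := by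
  obtain ⟨-, -, -, a, ha, hu⟩ := hP
  obtain rfl : a = 0 := anchor_eq_zero (Subset.refl _) (by rw [card_stdCap]; norm_num) (ha _ hC)
  exact ⟨ha, hu⟩

theorem IsCapPartition.exists_completes {P : Finset (Finset Pt)} (hP : IsCapPartition P)
    (hC : stdCap ∈ P) {M : Finset Pt} (hM : M ∈ P) (hd : Disjoint stdCap M) {y : Pt}
    (hy : y ∈ outside M) :
    ∃ N, y ∈ N ∧ Completes M N ∧ P = {stdCap, M, N, outside M \ N} := by
  obtain ⟨ha, hu⟩ := hP.anchor_zero hC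
  obtain ⟨hcard, hmax, hdis, -⟩ := hP
  have hyo := mem_outside.1 hy
  have hne : stdCap ≠ M := by
    rintro rfl
    exact (hmax _ hC).nonempty.ne_empty (disjoint_self_iff_empty _ |>.1 hd)
  obtain ⟨N, hN, hyN⟩ : ∃ N ∈ P, y ∈ N := by
    have : y ∈ P.biUnion id := hu ▸ mem_erase.2 ⟨hyo.1, mem_univ _⟩
    simpa using this
  have hNC : N ≠ stdCap := ne_of_mem_of_notMem hyN hyo.2.1
  have hNM : N ≠ M := ne_of_mem_of_notMem hyN hyo.2.2
  have hM' : M ∈ P.erase stdCap := mem_erase.2 ⟨hne.symm, hM⟩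
  have hN' : N ∈ (P.erase stdCap).erase M := mem_erase.2 ⟨hNM, mem_erase.2 ⟨hNC, hN⟩⟩
  obtain ⟨K, hK⟩ : ∃ K, ((P.erase stdCap).erase M).erase N = {K} := by
    rw [← card_eq_one, card_erase_of_mem hN', card_erase_of_mem hM', card_erase_of_mem hC, hcard]
  have hKm : K ∈ ((P.erase stdCap).erase M).erase N := hK ▸ mem_singleton_self K
  simp only [mem_erase] at hKm
  obtain ⟨hKN, hKM, hKC, hKP⟩ := hKm
  have hPe : P = {stdCap, M, N, K} := by
    rw [← hK, insert_erase hN', insert_erase hM', insert_erase hC]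
  have hKe : outside M \ N = K := by
    ext p
    rw [mem_sdiff, mem_outside]
    constructor
    · rintro ⟨⟨h0, h1, h2⟩, h3⟩
      have : p ∈ P.biUnion id := hu ▸ mem_erase.2 ⟨h0, mem_univ _⟩
      rw [hPe] at this
      simp only [biUnion_insert, singleton_biUnion, id, mem_union] at this
      tauto
    · intro h
      refine ⟨⟨?_, ?_, ?_⟩, ?_⟩
      · rintro rfl
        exact (isAnchor_zero_iff.1 (ha K hKP)).1 h
      · exact fun h' => disjoint_left.1 (hdis _ hKP _ hC hKC) h h'
      · exact fun h' => disjoint_left.1 (hdis _ hKP _ hM hKM) h h'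
      · exact fun h' => disjoint_left.1 (hdis _ hKP _ hN hKN) h h'
  refine ⟨N, hyN, ⟨fun p hp => mem_outside.2 ⟨?_, ?_, ?_⟩, hmax N hN, ha N hN, ?_, ?_⟩, ?_⟩
  · rintro rfl
    exact (isAnchor_zero_iff.1 (ha N hN)).1 hp
  · exact fun h' => disjoint_left.1 (hdis _ hN _ hC hNC) hp h'
  · exact fun h' => disjoint_left.1 (hdis _ hN _ hM hNM) hp h'
  · rw [hKe]
    exact hmax K hKP
  · rw [hKe]
    exact ha K hKP
  · rw [hKe, hPe]

/-- Exactly one of the two remaining caps of a partition contains the marked point `y`, and the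
other is its complement in `outside M`; so choosing the cap through `y` counts every partition once.
-/
theorem ncard_partitions {M : Finset Pt} (hM : IsMaximalCap M) (hMa : IsAnchor 0 M)
    (hd : Disjoint stdCap M) {y : Pt} (hy : y ∈ outside M) :
    {P | IsCapPartition P ∧ stdCap ∈ P ∧ M ∈ P}.ncard = {N | y ∈ N ∧ Completes M N}.ncard := by
  have hyo := mem_outside.1 hy
  have e : {P | IsCapPartition P ∧ stdCap ∈ P ∧ M ∈ P} =
      (fun N : Finset Pt => ({stdCap, M, N, outside M \ N} : Finset (Finset Pt))) ''
        {N | y ∈ N ∧ Completes M N} := by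
    ext P
    constructor
    · rintro ⟨h1, h2, h3⟩
      obtain ⟨N, h4, h5, rfl⟩ := h1.exists_completes h2 h3 hd hy
      exact ⟨N, ⟨h4, h5⟩, rfl⟩
    · rintro ⟨N, ⟨h4, h5⟩, rfl⟩
      exact ⟨isCapPartition_of_completes hM hMa hd h5, by simp, by simp⟩
  rw [e, Set.InjOn.ncard_image]
  rintro N ⟨h1, -⟩ N' ⟨h1', -⟩ h
  have : N ∈ ({stdCap, M, N', outside M \ N'} : Finset (Finset Pt)) := by
    have h' : ({stdCap, M, N, outside M \ N} : Finset (Finset Pt)) =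
      {stdCap, M, N', outside M \ N'} := h
    rw [← h']
    simp
  simp only [mem_insert, mem_singleton] at this
  rcases this with rfl | rfl | h | rfl
  · exact absurd h1 hyo.2.1
  · exact absurd h1 hyo.2.2
  · exact h
  · exact absurd h1' (mem_sdiff.1 h1).2

/-- Representatives of the pairs of points outside the standard cap. -/
def outerList : List ℕ := filt (maskOf stdList) (List.range 40)

theorem isRepList_outerList : IsRepList outerList := by decide +kernel

theorem outside_sym {l : List ℕ} (hl : IsRepList l) :
    outside (sym l) = sym (filt (maskOf l) outerList) := by
  have h : univ \ insert 0 stdCap = sym outerList := by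
    have hc : ∀ c < 81, (c ≠ 40 ∧ c ∉ stdList ↔ c ∈ outerList ∨ negc c ∈ outerList) := by
      decide +kernel
    ext p
    rw [← dec_enc p, dec_mem_sym isRepList_outerList (enc_lt p), ← hc _ (enc_lt p), mem_sdiff,
      mem_insert, stdCap, dec_mem_pts isCodeList_stdList (enc_lt p), not_or, ← dec_forty]
    simp only [mem_univ, true_and]
    refine and_congr_left fun _ => not_congr ⟨fun h => ?_, fun h => by rw [h]⟩
    exact dec_injective (enc_lt p) (by norm_num) h
  rw [← sym_sdiff isRepList_outerList hl, ← h, outside, ← insert_union, sdiff_sdiff_left]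
  rfl

/-- The sets containing the first point outside that complete the standard cap and the cap given
by `l` to a partition. -/
def completions (l : List ℕ) : List (List ℕ) :=
  match filt (maskOf l) outerList with
  | [] => []
  | y :: ys => (extensions killPair [y] ys 9).filter fun n =>
      decide (IsOvoidList (filt (maskOf n) (y :: ys)))

end Partitions

end AG43

namespace AG43

open Finset

/-! ### Finite search for completions of a pair of disjoint maximal caps -/

section Search

theorem isFreeList_of_isCap {l : List ℕ} (hl : IsCodeList l) (hnd : l.Nodup)
    (h : IsCap (pts l)) : isFreeList killLine l = true := by
  rw [isFreeList, Nat.beq_eq]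
  refine Nat.eq_of_testBit_eq fun z => ?_
  rw [← hasBit_eq, hasBit_land, Nat.zero_testBit, Bool.eq_false_iff, ne_eq, Bool.and_eq_true,
    hasBit_maskOf]
  rintro ⟨hz, hk⟩
  obtain ⟨x, hx, y, hy, hxy, hk⟩ := exists_of_hasBit_killPairs hnd hk
  rw [killLine, hasBit_bit] at hk
  rw [isCap_iff] at h
  refine h _ (mem_pts.2 ⟨x, hx, rfl⟩) _ (mem_pts.2 ⟨y, hy, rfl⟩)
    (fun h => hxy (dec_injective (hl x hx) (hl y hy) h)) ?_
  rw [← dec_third (hl x hx) (hl y hy), ← hk]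
  exact mem_pts.2 ⟨z, hz, rfl⟩

theorem IsMaximalCap.isOvoidList {l : List ℕ} (hl : IsRepList l) (hnd : l.Nodup)
    (h : IsMaximalCap (sym l)) : IsOvoidList l := by
  have hc := (isMaximalCap_iff.1 h).2
  rw [card_sym hl hnd] at hc
  refine ⟨hl, hnd, by omega, isFreeList_of_isCap (isCodeList_symList hl.isCodeList) ?_ h.1⟩
  rw [symList, List.nodup_append]
  refine ⟨hnd, hnd.map_on fun x hx y hy h => ?_, fun a ha b hb => ?_⟩
  · have := hl x hx
    have := hl y hy
    rw [negc_eq, negc_eq] at h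
    omega
  · obtain ⟨d, hd, rfl⟩ := List.mem_map.1 hb
    have := hl a ha
    have := hl d hd
    rw [negc_eq]
    omega

theorem nodup_outerList : outerList.Nodup := by decide +kernel

/-- Completeness of the list is needed only to see that the first pair has a single completion. To
exclude a pair, two explicit completions suffice. -/
theorem exists_mem_completions {l : List ℕ} (hl : IsRepList l) {y : ℕ} {ys : List ℕ}
    (hy : filt (maskOf l) outerList = y :: ys) {N : Finset Pt} (hN : Completes (sym l) N)
    (hyN : dec y ∈ N) : ∃ n ∈ completions l, sym n = N := by
  obtain ⟨h1, h2, h3, h4, -⟩ := hN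
  rw [outside_sym hl, hy] at h1 h4
  have hnd : (y :: ys).Nodup := hy ▸ nodup_outerList.sublist (filt_sublist _ _)
  have hrep : IsRepList (y :: ys) := fun c hc => isRepList_outerList c (by
    rw [← hy] at hc
    exact (mem_filt.1 hc).1)
  obtain ⟨n, hn, hnr, rfl⟩ := h2.mem_extensions h3 [y] ys 9 hnd
    (fun c hc => hrep c (by rw [List.mem_singleton.1 hc]; exact List.mem_cons_self))
    (fun c hc => by rwa [List.mem_singleton.1 hc])
    (fun c hc hcN => by
      have := (dec_mem_sym_of_lt hrep hc).1 (h1 hcN)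
      rcases List.mem_cons.1 this with rfl | h
      · exact .inl (List.mem_singleton_self c)
      · exact .inr h) rfl
  refine ⟨n, ?_, rfl⟩
  unfold completions
  rw [hy]
  refine List.mem_filter.2 ⟨hn, decide_eq_true ?_⟩
  rw [sym_sdiff hrep hnr] at h4
  exact h4.isOvoidList (fun c hc => hrep c (mem_filt.1 hc).1) (hnd.sublist (filt_sublist _ _))

/-- The caps given by `n` and by the complement of `n` complete the standard cap and the cap given
by `l` to a partition. -/
def IsCompletion (l n : List ℕ) : Prop :=
  IsOvoidList n ∧ IsOvoidList (filt (maskOf n) (filt (maskOf l) outerList)) ∧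
    ∀ c ∈ n, hasBit (maskOf (filt (maskOf l) outerList)) c = true

instance (l n : List ℕ) : Decidable (IsCompletion l n) := inferInstanceAs (Decidable (_ ∧ _))

theorem IsCompletion.completes {l n : List ℕ} (hl : IsRepList l) (h : IsCompletion l n) :
    Completes (sym l) (sym n) := by
  obtain ⟨h1, h2, h3⟩ := h
  have hf : IsRepList (filt (maskOf l) outerList) :=
    fun c hc => isRepList_outerList c (mem_filt.1 hc).1
  rw [Completes, outside_sym hl, sym_sdiff hf h1.1]
  refine ⟨fun p hp => ?_, h1.isMaximalCap, h1.1.isAnchor, h2.isMaximalCap, h2.1.isAnchor⟩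
  rw [← dec_enc p, dec_mem_sym h1.1 (enc_lt p)] at hp
  rw [← dec_enc p, dec_mem_sym hf (enc_lt p)]
  exact hp.imp (fun h => hasBit_maskOf.1 (h3 _ h)) (fun h => hasBit_maskOf.1 (h3 _ h))

/-- The maximal caps with anchor point `0` that contain the point with code `39` and are disjoint
from the standard cap. -/
def ovoids : List (List ℕ) := extensions killPair [39] (filt (bit 39) outerList) 9

/-- The list is one of the unions of members of the two standard families, or the corresponding
cap has at least two completions. -/
def OvoidAlternative (l : List ℕ) : Prop :=
  (∃ i j, maskOf l = maskOf (rowList i ++ colList j)) ∨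
    match filt (maskOf l) outerList, completions l with
    | y :: _, n₁ :: n₂ :: _ => IsCompletion l n₁ ∧ IsCompletion l n₂ ∧ y ∈ n₁ ∧ y ∈ n₂ ∧
        ∃ c ∈ n₁, c ∉ n₂
    | _, _ => False

instance (l : List ℕ) : Decidable (OvoidAlternative l) := by
  unfold OvoidAlternative
  have : Decidable (match filt (maskOf l) outerList, completions l with
    | y :: _, n₁ :: n₂ :: _ => IsCompletion l n₁ ∧ IsCompletion l n₂ ∧ y ∈ n₁ ∧ y ∈ n₂ ∧
        ∃ c ∈ n₁, c ∉ n₂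
    | _, _ => False) := by
    split <;> infer_instance
  infer_instance

/-- A candidate that is not row ∪ column comes with two different completions through the same
marked point, verified independently by `IsCompletion`, so it is not 1-completable. -/
theorem ovoids_alternative : ∀ l ∈ ovoids, OvoidAlternative l := by
  decide +kernel

theorem completions_first : (completions (rowList 0 ++ colList 0)).length = 1 ∧
    ∀ n ∈ completions (rowList 0 ++ colList 0),
      IsCompletion (rowList 0 ++ colList 0) n ∧ 1 ∈ n := by
  decide +kernel

theorem filt_first : filt (maskOf (rowList 0 ++ colList 0)) outerList =
    1 :: (filt (maskOf (rowList 0 ++ colList 0)) outerList).tail := by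
  decide +kernel

end Search

end AG43

namespace AG43

open Finset

/-! ### Invariance of completable pairs -/

section Invariance

theorem IsCapPartition.image_act {P : Finset (Finset Pt)} (hP : IsCapPartition P) (g : Aff) :
    IsCapPartition (P.image (act g)) := by
  obtain ⟨h1, h2, h3, a, h4, h5⟩ := hP
  refine ⟨?_, ?_, ?_, g a, ?_, ?_⟩
  · rw [card_image_of_injective _ (act_injective g), h1]
  · intro M hM
    obtain ⟨M, hM', rfl⟩ := mem_image.1 hM
    exact (h2 M hM').act g
  · intro M hM N hN hMN
    obtain ⟨M, hM', rfl⟩ := mem_image.1 hM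
    obtain ⟨N, hN', rfl⟩ := mem_image.1 hN
    exact disjoint_act.2 (h3 M hM' N hN' fun h => hMN (congrArg _ h))
  · intro M hM
    obtain ⟨M, hM', rfl⟩ := mem_image.1 hM
    exact isAnchor_act.2 (h4 M hM')
  · ext p
    obtain ⟨p, rfl⟩ := g.surjective p
    have : p ∈ P.biUnion id ↔ p ≠ a := by rw [h5]; simp
    rw [mem_erase, and_iff_left (mem_univ _), g.injective.ne_iff, ← this]
    simp only [mem_biUnion, mem_image, id, exists_exists_and_eq_and, apply_mem_act]

theorem IsCompletablePair.act {k : ℕ} {C M : Finset Pt} (h : IsCompletablePair k C M) (g : Aff) :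
    IsCompletablePair k (act g C) (act g M) := by
  obtain ⟨h1, h2, h3, h4⟩ := h
  refine ⟨h1.act g, h2.act g, disjoint_act.2 h3, ?_⟩
  rw [← h4, ← Set.ncard_image_of_injective
    {P : Finset (Finset Pt) | IsCapPartition P ∧ C ∈ P ∧ M ∈ P}
    (image_injective (act_injective g))]
  congr 1
  ext P
  constructor
  · rintro ⟨k1, k2, k3⟩
    refine ⟨P.image (AG43.act g⁻¹), ⟨k1.image_act g⁻¹, ?_, ?_⟩, ?_⟩
    · exact mem_image.2 ⟨_, k2, act_inv_act g C⟩
    · exact mem_image.2 ⟨_, k3, act_inv_act g M⟩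
    · rw [image_image, (funext (act_act_inv g) : AG43.act g ∘ AG43.act g⁻¹ = id), image_id]
  · rintro ⟨Q, ⟨k1, k2, k3⟩, rfl⟩
    exact ⟨k1.image_act g, mem_image_of_mem _ k2, mem_image_of_mem _ k3⟩

theorem isCompletablePair_act {k : ℕ} {C M : Finset Pt} {g : Aff} :
    IsCompletablePair k (act g C) (act g M) ↔ IsCompletablePair k C M :=
  ⟨fun h => by simpa only [act_inv_act] using h.act g⁻¹, fun h => h.act g⟩

end Invariance

/-! ### Products of elements acting on the two families -/

section Products

variable {r c : Fin 6 → Finset Pt} {g h : Aff} {σ τ σ' τ' : Equiv.Perm (Fin 6)}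

theorem PermutesBy.mul (hg : PermutesBy g r c σ τ) (hh : PermutesBy h r c σ' τ') :
    PermutesBy (g * h) r c (σ * σ') (τ * τ') :=
  ⟨fun i => by rw [act_mul, hh.1, hg.1]; rfl, fun j => by rw [act_mul, hh.2, hg.2]; rfl⟩

theorem SwapsBy.mul_permutesBy (hg : SwapsBy g r c σ τ) (hh : PermutesBy h r c σ' τ') :
    SwapsBy (g * h) r c (σ * σ') (τ * τ') :=
  ⟨fun i => by rw [act_mul, hh.1, hg.1]; rfl, fun j => by rw [act_mul, hh.2, hg.2]; rfl⟩

theorem SwapsBy.mul (hg : SwapsBy g r c σ τ) (hh : SwapsBy h r c σ' τ') :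
    PermutesBy (g * h) r c (τ * σ') (σ * τ') :=
  ⟨fun i => by rw [act_mul, hh.1, hg.2]; rfl, fun j => by rw [act_mul, hh.2, hg.1]; rfl⟩

theorem permutesBy_one : PermutesBy 1 r c 1 1 :=
  ⟨fun _ => act_one _, fun _ => act_one _⟩

theorem PermutesBy.inv (hg : PermutesBy g r c σ τ) : PermutesBy g⁻¹ r c σ⁻¹ τ⁻¹ := by
  refine ⟨fun i => ?_, fun j => ?_⟩
  · rw [act_eq_iff, inv_inv, hg.1]
    exact congrArg r (σ.apply_symm_apply i).symm
  · rw [act_eq_iff, inv_inv, hg.2]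
    exact congrArg c (τ.apply_symm_apply j).symm

end Products

/-! ### Transitivity of the stabilizer on row-column pairs and on outer points -/

section Transitivity

theorem exists_word {C : Finset Pt} {r c : Fin 6 → Finset Pt}
    (h : ∀ k : Fin 5, ∃ g : Aff, act g C = C ∧
      PermutesBy g r c (Equiv.swap k.castSucc k.succ) (synthemes k))
    (l : List (Fin 5)) : ∃ g : Aff, act g C = C ∧
    PermutesBy g r c (l.map fun k => Equiv.swap k.castSucc k.succ).prod
      (l.map synthemes).prod := by
  induction l with
  | nil => exact ⟨1, act_one _, permutesBy_one⟩
  | cons k l ih =>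
    obtain ⟨g, hg, hg'⟩ := h k
    obtain ⟨h, hh, hh'⟩ := ih
    refine ⟨g * h, by rw [act_mul, hh, hg], ?_⟩
    rw [List.map_cons, List.map_cons, List.prod_cons, List.prod_cons]
    exact hg'.mul hh'

/-- Adjacent transpositions generate S₆, so the five reflections realise every permutation of the
rows; the accompanying permutation of the columns is left open here. -/
theorem exists_permutesBy {C : Finset Pt} {r c : Fin 6 → Finset Pt}
    (h : ∀ k : Fin 5, ∃ g : Aff, act g C = C ∧
      PermutesBy g r c (Equiv.swap k.castSucc k.succ) (synthemes k))
    (σ : Equiv.Perm (Fin 6)) : ∃ g : Aff, act g C = C ∧ ∃ τ, PermutesBy g r c σ τ := by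
  have hσ : σ ∈ Submonoid.closure (Set.range fun i : Fin 5 ↦ Equiv.swap i.castSucc i.succ) := by
    rw [Equiv.Perm.mclosure_swap_castSucc_succ]
    trivial
  obtain ⟨l, hl, rfl⟩ := Submonoid.exists_list_of_mem_closure hσ
  obtain ⟨l, rfl⟩ : ∃ l' : List (Fin 5), l = l'.map fun k => Equiv.swap k.castSucc k.succ := by
    clear hσ
    induction l with
    | nil => exact ⟨[], rfl⟩
    | cons a l ih =>
      obtain ⟨k, rfl⟩ := hl a List.mem_cons_self
      obtain ⟨l', rfl⟩ := ih fun y hy => hl y (List.mem_cons_of_mem _ hy)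
      exact ⟨k :: l', rfl⟩
  obtain ⟨g, hg, hg'⟩ := exists_word h l
  exact ⟨g, hg, _, hg'⟩

/-- The stabilizer of one symbol acts transitively on the six totals. The words use only
transpositions that do not move the symbol 0. -/
theorem exists_move_col (k : Fin 6) : ∃ l : List (Fin 5),
    (l.map fun k => Equiv.swap k.castSucc k.succ).prod 0 = (0 : Fin 6) ∧
      (l.map synthemes).prod k = 0 := by
  fin_cases k
  · exact ⟨[], by decide +kernel⟩
  · exact ⟨[2], by decide +kernel⟩
  · exact ⟨[2, 1, 3], by decide +kernel⟩
  · exact ⟨[2, 1], by decide +kernel⟩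
  · exact ⟨[2, 3], by decide +kernel⟩
  · exact ⟨[1], by decide +kernel⟩

theorem exists_move_pair (i j : Fin 6) : ∃ g : Aff, act g stdCap = stdCap ∧
    ∃ σ τ, PermutesBy g stdRow stdCol σ τ ∧ σ i = 0 ∧ τ j = 0 := by
  obtain ⟨g, hg, τ, hg'⟩ := exists_permutesBy exists_reflection (Equiv.swap i 0)
  obtain ⟨l, hl, hl'⟩ := exists_move_col (τ j)
  obtain ⟨h, hh, hh'⟩ := exists_word exists_reflection l
  refine ⟨h * g, by rw [act_mul, hg, hh], _, _, hh'.mul hg', ?_, ?_⟩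
  · rw [Equiv.Perm.mul_apply, Equiv.swap_apply_left, hl]
  · rw [Equiv.Perm.mul_apply, hl']

/-- Outer points are duads, each in two rows, or synthemes, each in two columns. With double
transitivity on the rows and the duality this makes the stabilizer transitive on outer antipodal
pairs. -/
theorem outer_cover : ∀ c < 81, (c = 40 ∨ c ∈ stdList) ∨
    (∃ i j : Fin 6, i ≠ j ∧ c ∈ symList (rowList i) ∧ c ∈ symList (rowList j)) ∨
      ∃ i j : Fin 6, i ≠ j ∧ c ∈ symList (colList i) ∧ c ∈ symList (colList j) := by
  decide +kernel

theorem mem_rows_zero_one : ∀ c < 81, c ∈ symList (rowList 0) → c ∈ symList (rowList 1) →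
    c = 39 ∨ c = negc 39 := by
  decide +kernel

theorem exists_move_point {x : Pt} (h0 : x ≠ 0) (hx : x ∉ stdCap) : ∃ g : Aff,
    act g stdCap = stdCap ∧ (∃ σ τ, PermutesBy g stdRow stdCol σ τ ∨ SwapsBy g stdRow stdCol σ τ) ∧
      (g x = dec 39 ∨ g x = -dec 39) := by
  have key {y : Pt} {i j : Fin 6} (hij : i ≠ j) (hi : y ∈ stdRow i) (hj : y ∈ stdRow j) :
      ∃ g : Aff, act g stdCap = stdCap ∧ (∃ σ τ, PermutesBy g stdRow stdCol σ τ) ∧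
        (g y = dec 39 ∨ g y = -dec 39) := by
    obtain ⟨σ, h1, h2⟩ : ∃ σ : Equiv.Perm (Fin 6), σ i = 0 ∧ σ j = 1 := by
      revert i j
      intro i j hij _ _
      refine ⟨Equiv.swap (Equiv.swap i 0 j) 1 * Equiv.swap i 0, ?_, ?_⟩
      · rw [Equiv.Perm.mul_apply, Equiv.swap_apply_left, Equiv.swap_apply_of_ne_of_ne]
        · intro h
          exact hij ((Equiv.swap i 0).injective ((Equiv.swap_apply_left i 0).trans h))
        · decide
      · rw [Equiv.Perm.mul_apply, Equiv.swap_apply_left]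
    obtain ⟨g, hg, τ, hg'⟩ := exists_permutesBy exists_reflection σ
    refine ⟨g, hg, ⟨σ, τ, hg'⟩, ?_⟩
    have k1 : g y ∈ stdRow 0 := by rw [← h1, ← hg'.1, apply_mem_act]; exact hi
    have k2 : g y ∈ stdRow 1 := by rw [← h2, ← hg'.1, apply_mem_act]; exact hj
    rw [← dec_enc (g y), stdRow, mem_sym (isCodeList_row _) (enc_lt _)] at k1 k2
    rw [← dec_negc (by norm_num), ← dec_enc (g y)]
    exact (mem_rows_zero_one _ (enc_lt _) k1 k2).imp (congrArg dec) (congrArg dec)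
  have hc := (outer_cover (enc x) (enc_lt x)).resolve_left fun h => h.elim
    (fun h => h0 (by rw [← dec_enc x, h, dec_forty])) fun h => hx (mem_pts.2 ⟨_, h, dec_enc x⟩)
  rcases hc with ⟨i, j, hij, hi, hj⟩ | ⟨i, j, hij, hi, hj⟩
  · obtain ⟨g, hg, ⟨σ, τ, hp⟩, hx⟩ := key (y := x) hij (mem_pts.2 ⟨_, hi, dec_enc x⟩)
      (mem_pts.2 ⟨_, hj, dec_enc x⟩)
    exact ⟨g, hg, ⟨σ, τ, .inl hp⟩, hx⟩
  · obtain ⟨s, hs, hs'⟩ := exists_duality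
    have k (j : Fin 6) (hj : enc x ∈ symList (colList j)) : s x ∈ stdRow j := by
      rw [← Equiv.Perm.one_apply j, ← hs'.2, apply_mem_act]
      exact mem_pts.2 ⟨_, hj, dec_enc x⟩
    obtain ⟨g, hg, ⟨σ, τ, hp⟩, hx⟩ := key hij (k i hi) (k j hj)
    refine ⟨g * s, by rw [act_mul, hs, hg], ?_, hx⟩
    refine ⟨τ, σ, .inr ⟨fun i => ?_, fun j => ?_⟩⟩
    · rw [act_mul, hs'.1, hp.2]
      rfl
    · rw [act_mul, hs'.2, hp.1]
      rfl

end Transitivity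

/-! ### The caps forming a 1-completable pair with the standard cap -/

section CompletablePairs

theorem IsCompletablePair.isAnchor_zero {M : Finset Pt} (h : IsCompletablePair 1 stdCap M) :
    IsAnchor 0 M := by
  obtain ⟨h1, h2, h3, h4⟩ := h
  obtain ⟨P, hP⟩ := Set.ncard_eq_one.1 h4
  obtain ⟨k1, k2, k3⟩ : P ∈ {P | IsCapPartition P ∧ stdCap ∈ P ∧ M ∈ P} := by
    rw [hP]
    exact Set.mem_singleton P
  exact (k1.anchor_zero k2).1 M k3

theorem isRepList_union (i j : Fin 6) : IsRepList (rowList i ++ colList j) := by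
  revert i j
  decide +kernel

theorem sym_append (l l' : List ℕ) : sym (l ++ l') = sym l ∪ sym l' := by
  rw [sym, sym, sym, ← pts_append]
  ext p
  simp only [mem_pts, symList, List.map_append, List.mem_append]
  refine exists_congr fun c => and_congr_left fun _ => ?_
  tauto

theorem sym_congr {l l' : List ℕ} (h : maskOf l = maskOf l') : sym l = sym l' := by
  have (c : ℕ) : c ∈ l ↔ c ∈ l' := by rw [← hasBit_maskOf, h, hasBit_maskOf]
  ext p
  simp only [sym, mem_pts, symList, List.mem_append, List.mem_map, this]

theorem IsCompletablePair.eq_union_of_mem {M : Finset Pt} (h : IsCompletablePair 1 stdCap M)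
    (hM : dec 39 ∈ M) : ∃ i j, M = stdRow i ∪ stdCol j := by
  have ha := h.isAnchor_zero
  obtain ⟨-, h2, h3, h4⟩ := h
  obtain ⟨l, hl, hlr, rfl⟩ := h2.mem_extensions ha [39] (filt (bit 39) outerList) 9
    (by decide +kernel) (by decide +kernel) (fun c hc => by rwa [List.mem_singleton.1 hc])
    (fun c hc hcM => by
      by_cases h39 : c = 39
      · exact .inl (List.mem_singleton.2 h39)
      · refine .inr (mem_filt.2 ⟨mem_filt.2 ⟨List.mem_range.2 hc, ?_⟩, ?_⟩)
        · rw [Bool.eq_false_iff, ne_eq, hasBit_maskOf,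
            ← dec_mem_pts isCodeList_stdList (by omega)]
          exact fun h => disjoint_left.1 h3 h hcM
        · rwa [Bool.eq_false_iff, ne_eq, hasBit_bit]) rfl
  rcases ovoids_alternative l hl with ⟨i, j, hij⟩ | halt
  · exact ⟨i, j, by rw [sym_congr hij, sym_append]; rfl⟩
  · exfalso
    split at halt
    · rename_i y ys n₁ n₂ ns hy hn
      obtain ⟨c1, c2, hy1, hy2, c, hc1, hc2⟩ := halt
      have hrep : IsRepList (filt (maskOf l) outerList) :=
        fun c hc => isRepList_outerList c (mem_filt.1 hc).1
      have hyo : dec y ∈ outside (sym l) := by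
        have : y ∈ filt (maskOf l) outerList := hy ▸ List.mem_cons_self
        rw [outside_sym hlr, dec_mem_sym_of_lt hrep (hrep y this)]
        exact this
      rw [ncard_partitions h2 ha h3 hyo] at h4
      obtain ⟨N, hN⟩ := Set.ncard_eq_one.1 h4
      have m1 : sym n₁ ∈ ({N} : Set (Finset Pt)) := by
        rw [← hN]
        exact ⟨(dec_mem_sym_of_lt c1.1.1 (c1.1.1 y hy1)).2 hy1, c1.completes hlr⟩
      have m2 : sym n₂ ∈ ({N} : Set (Finset Pt)) := by
        rw [← hN]
        exact ⟨(dec_mem_sym_of_lt c2.1.1 (c2.1.1 y hy2)).2 hy2, c2.completes hlr⟩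
      rw [Set.mem_singleton_iff] at m1 m2
      apply hc2
      rw [← dec_mem_sym_of_lt c2.1.1 (c1.1.1 c hc1), m2, ← m1,
        dec_mem_sym_of_lt c1.1.1 (c1.1.1 c hc1)]
      exact hc1
    · exact halt

theorem isOvoidList_first : IsOvoidList (rowList 0 ++ colList 0) := by decide +kernel

theorem isCompletablePair_first : IsCompletablePair 1 stdCap (stdRow 0 ∪ stdCol 0) := by
  have hrep := isRepList_union 0 0
  have e : stdRow 0 ∪ stdCol 0 = sym (rowList 0 ++ colList 0) := (sym_append _ _).symm
  rw [e]
  have hd : Disjoint stdCap (sym (rowList 0 ++ colList 0)) := by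
    rw [disjoint_left, forall_pt]
    intro c hc h1 h2
    rw [stdCap, dec_mem_pts isCodeList_stdList hc] at h1
    rw [mem_sym hrep.isCodeList hc] at h2
    revert h2
    revert c
    decide +kernel
  have hmax := isOvoidList_first.isMaximalCap
  refine ⟨isMaximalCap_stdCap, hmax, hd, ?_⟩
  obtain ⟨hlen, hcomp⟩ := completions_first
  obtain ⟨n, hn⟩ := List.length_eq_one_iff.1 hlen
  obtain ⟨hcn, h1n⟩ := hcomp n (hn ▸ List.mem_singleton_self n)
  have hout : IsRepList (filt (maskOf (rowList 0 ++ colList 0)) outerList) :=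
    fun c hc => isRepList_outerList c (mem_filt.1 hc).1
  have hyo : dec 1 ∈ outside (sym (rowList 0 ++ colList 0)) := by
    rw [outside_sym hrep, dec_mem_sym_of_lt hout (by norm_num), filt_first]
    exact List.mem_cons_self
  rw [ncard_partitions hmax hrep.isAnchor hd hyo, Set.ncard_eq_one]
  refine ⟨sym n, Set.eq_singleton_iff_unique_mem.2 ⟨⟨?_, hcn.completes hrep⟩, ?_⟩⟩
  · exact (dec_mem_sym_of_lt hcn.1.1 (by norm_num)).2 h1n
  · rintro N ⟨hN1, hN2⟩
    obtain ⟨m, hm, rfl⟩ := exists_mem_completions hrep filt_first hN2 hN1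
    rw [hn, List.mem_singleton] at hm
    rw [hm]

theorem isCompletablePair_std {M : Finset Pt} :
    IsCompletablePair 1 stdCap M ↔ ∃ i j, M = stdRow i ∪ stdCol j := by
  constructor
  · intro h
    obtain ⟨x, hx⟩ := h.2.1.nonempty
    have ha := isAnchor_zero_iff.1 h.isAnchor_zero
    -- Some point of `M` is moved to ±`dec 39`, where the search `ovoids` applies; the sign is
    -- harmless because the moved cap is symmetric about 0.
    obtain ⟨g, hg, ⟨σ, τ, hp⟩, hgx⟩ := exists_move_point (x := x) (fun h0 => ha.1 (h0 ▸ hx))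
      (fun h' => disjoint_left.1 h.2.2.1 h' hx)
    have h' := h.act g
    rw [hg] at h'
    have hmem : dec 39 ∈ act g M := by
      have k := apply_mem_act (g := g).2 hx
      rcases hgx with e | e <;> rw [e] at k
      · exact k
      · simpa using (isAnchor_zero_iff.1 h'.isAnchor_zero).2 _ k
    obtain ⟨i, j, e⟩ := h'.eq_union_of_mem hmem
    rw [act_eq_iff, act_union] at e
    rw [e]
    rcases hp with hp | hp
    · refine ⟨σ⁻¹ i, τ⁻¹ j, ?_⟩
      rw [← hp.inv.1, ← hp.inv.2]
    · refine ⟨σ⁻¹ j, τ⁻¹ i, ?_⟩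
      have h1 := hp.2 (τ⁻¹ i)
      have h2 := hp.1 (σ⁻¹ j)
      have e1 : τ (τ⁻¹ i) = i := τ.apply_symm_apply i
      have e2 : σ (σ⁻¹ j) = j := σ.apply_symm_apply j
      rw [e1, act_eq_iff] at h1
      rw [e2, act_eq_iff] at h2
      rw [h1, h2, union_comm]
  · rintro ⟨i, j, rfl⟩
    obtain ⟨g, hg, σ, τ, hp, hi, hj⟩ := exists_move_pair i j
    rw [← isCompletablePair_act (g := g), hg, act_union, hp.1, hp.2, hi, hj]
    exact isCompletablePair_first

end CompletablePairs

end AG43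

namespace AG43

open Finset

/-! ### Counting lines completed by a point -/

section LinesCompleted

/-- The map x ↦ {x, -(p + x)} is two-to-one onto the pairs that complete a line with p, so a count
of 2-subsets becomes a count of points. -/
theorem two_mul_linesCompleted (p : Pt) (S : Finset Pt) :
    2 * linesCompleted p S = #{x ∈ S | x ≠ p ∧ -(p + x) ∈ S} := by
  set T := {x ∈ S | x ≠ p ∧ -(p + x) ∈ S} with hT
  set F := (S.powersetCard 2).filter fun s => IsLine (insert p s) with hF
  have hinv (u : Pt) : -(p + -(p + u)) = u := by abel
  have hmaps : Set.MapsTo (fun x => ({x, -(p + x)} : Finset Pt)) T F := by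
    intro x hx
    obtain ⟨h1, h2, h3⟩ := mem_filter.1 hx
    have hl : IsLine {p, x, -(p + x)} := isLine_triple.2 ⟨h2.symm, rfl⟩
    refine mem_filter.2 ⟨mem_powersetCard.2 ⟨?_, ?_⟩, hl⟩
    · intro y hy
      rcases mem_insert.1 hy with rfl | hy
      · exact h1
      · rw [mem_singleton.1 hy]
        exact h3
    · have h3 := hl.1
      have h4 := card_insert_le p {x, -(p + x)}
      rw [h3] at h4
      exact le_antisymm card_le_two (by simpa using h4)
  rw [card_eq_sum_card_fiberwise hmaps, sum_congr rfl (g := fun _ => 2), sum_const, smul_eq_mul,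
    mul_comm]
  · rfl
  · intro s hs
    obtain ⟨hs1, hs2⟩ := mem_filter.1 hs
    obtain ⟨hs3, hs4⟩ := mem_powersetCard.1 hs1
    obtain ⟨u, v, huv, rfl⟩ := card_eq_two.1 hs4
    obtain ⟨h1, h2⟩ := isLine_triple.1 hs2
    have h3 : -(p + v) = u := by rw [h2, hinv]
    have hpv : v ≠ p := by
      rintro rfl
      have h := hs2.1
      rw [insert_comm, pair_eq_singleton, card_pair huv] at h
      omega
    rw [← hs4]
    congr 1
    ext x
    rw [mem_filter]
    constructor
    · rintro ⟨-, hx⟩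
      rw [← hx]
      exact mem_insert_self _ _
    · intro hx
      rcases mem_insert.1 hx with rfl | hx
      · exact ⟨mem_filter.2 ⟨hs3 hx, h1.symm, h2 ▸ hs3 (by simp)⟩, by rw [h2]⟩
      · rw [mem_singleton.1 hx]
        refine ⟨mem_filter.2 ⟨hs3 (by simp), hpv, ?_⟩, by rw [h3, pair_comm]⟩
        rw [h3]
        exact hs3 (by simp)

theorem linesCompleted_act (g : Aff) (p : Pt) (S : Finset Pt) :
    linesCompleted (g p) (act g S) = linesCompleted p S := by
  refine Nat.eq_of_mul_eq_mul_left two_pos ?_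
  rw [two_mul_linesCompleted, two_mul_linesCompleted,
    ← card_act g {x ∈ S | x ≠ p ∧ -(p + x) ∈ S}]
  congr 1
  ext y
  obtain ⟨y, rfl⟩ := g.surjective y
  rw [apply_mem_act, mem_filter, mem_filter, apply_mem_act, g.injective.ne_iff, ← map_third,
    apply_mem_act]

theorem correspondingCap_act (g : Aff) (D E : Finset Pt) :
    correspondingCap (act g D) (act g E) = act g (correspondingCap D E) := by
  ext y
  obtain ⟨y, rfl⟩ := g.surjective y
  simp only [correspondingCap, mem_filter_univ, linesCompleted_act, apply_mem_act]

/-- Twice the number of lines that the point with code `c` completes with pairs of points of a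
list. -/
def countPartners (c : ℕ) (l : List ℕ) : ℕ :=
  (l.filter fun x => !Nat.beq x c && hasBit (maskOf l) (third c x)).length

theorem two_mul_linesCompleted_pts {l : List ℕ} (hl : IsCodeList l) (hnd : l.Nodup) {c : ℕ}
    (hc : c < 81) : 2 * linesCompleted (dec c) (pts l) = countPartners c l := by
  rw [two_mul_linesCompleted, countPartners, ← List.toFinset_card_of_nodup (hnd.filter _),
    ← card_codes]
  congr 1
  ext x
  rw [mem_codes, mem_filter, List.mem_toFinset, List.mem_filter, Bool.and_eq_true, hasBit_maskOf,
    Bool.not_eq_true', ← Bool.not_eq_true, Nat.beq_eq]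
  constructor
  · rintro ⟨h1, h2, h3, h4⟩
    refine ⟨(dec_mem_pts hl h1).1 h2, fun h => h3 (congrArg dec h), ?_⟩
    rwa [← dec_third hc h1, dec_mem_pts hl (third_lt hc h1)] at h4
  · rintro ⟨h1, h2, h3⟩
    have hx := hl x h1
    refine ⟨hx, (dec_mem_pts hl hx).2 h1, fun h => h2 (dec_injective hx hc h), ?_⟩
    rwa [← dec_third hc hx, dec_mem_pts hl (third_lt hc hx)]

end LinesCompleted

/-! ### Demicaps -/

section Demicaps

theorem IsDemicapAt.act {a : Pt} {D : Finset Pt} (h : IsDemicapAt a D) (g : Aff) :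
    IsDemicapAt (g a) (act g D) := by
  obtain ⟨h1, h2, d, d', h3, h4, h5⟩ := h
  refine ⟨h1.act g, by rw [card_act, h2], fun i => g (d i), fun i => g (d' i), fun i => ?_, ?_, ?_⟩
  · obtain ⟨k1, k2⟩ := isLine_triple.1 (h3 i)
    exact isLine_triple.2 ⟨fun h => k1 (g.injective h), (congrArg g k2).trans (map_third g _ _)⟩
  · rw [h4, act_union, AG43.act, AG43.act, image_image, image_image]
    rfl
  · rintro s hs ⟨H, hH, hi⟩
    refine h5 s hs ⟨H.map g.symm.toAffineMap, ?_, fun i his => ?_⟩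
    · rw [AffineSubspace.map_direction]
      exact (LinearEquiv.finrank_map_eq g.symm.linear H.direction).trans hH
    · obtain ⟨k1, k2, k3⟩ := hi i his
      refine ⟨AffineSubspace.mem_map.2 ⟨_, k1, ?_⟩, AffineSubspace.mem_map.2 ⟨_, k2, ?_⟩,
        AffineSubspace.mem_map.2 ⟨_, k3, ?_⟩⟩ <;> exact g.symm_apply_apply _

theorem IsDemicap.act {D : Finset Pt} (h : IsDemicap D) (g : Aff) : IsDemicap (act g D) :=
  let ⟨a, ha⟩ := h
  ⟨g a, ha.act g⟩

theorem IsDemicapAt.isAnchor {a : Pt} {D : Finset Pt} (h : IsDemicapAt a D) : IsAnchor a D := by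
  obtain ⟨-, -, d, d', h3, rfl, -⟩ := h
  intro x hx
  rcases mem_union.1 hx with hx | hx
  · obtain ⟨i, -, rfl⟩ := mem_image.1 hx
    exact ⟨d' i, mem_union_right _ (mem_image_of_mem _ (mem_univ i)), h3 i⟩
  · obtain ⟨i, -, rfl⟩ := mem_image.1 hx
    refine ⟨d i, mem_union_left _ (mem_image_of_mem _ (mem_univ i)), ?_⟩
    have := h3 i
    rwa [pair_comm] at this

/-- Any four of the five vectors of row 0 form a basis. The matrices are composed in the order that
writes the standard basis vectors as combinations of the v's, which is the spanning statement. -/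
theorem row_frame : ∀ k : Fin 5, ∃ v₀ v₁ v₂ v₃ w₀ w₁ w₂ w₃ : ℕ,
    (rowList 0).eraseIdx k = [v₀, v₁, v₂, v₃] ∧ IsCodeList [v₀, v₁, v₂, v₃] ∧
      [41, 43, 49, 67].map (fun c => linc v₀ v₁ v₂ v₃ (linc w₀ w₁ w₂ w₃ c)) =
        [41, 43, 49, 67] := by
  intro k
  fin_cases k
  · exact ⟨21, 27, 36, 39, 13, 58, 46, 72, by decide +kernel⟩
  · exact ⟨0, 27, 36, 39, 13, 58, 46, 42, by decide +kernel⟩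
  · exact ⟨0, 21, 36, 39, 13, 58, 56, 8, by decide +kernel⟩
  · exact ⟨0, 21, 27, 39, 13, 20, 24, 48, by decide +kernel⟩
  · exact ⟨0, 21, 27, 36, 74, 60, 58, 48, by decide +kernel⟩

theorem eq_top_of_frame {W : Submodule (ZMod 3) Pt} {v₀ v₁ v₂ v₃ w₀ w₁ w₂ w₃ : ℕ}
    (hv : IsCodeList [v₀, v₁, v₂, v₃])
    (hinv : [41, 43, 49, 67].map (fun c => linc v₀ v₁ v₂ v₃ (linc w₀ w₁ w₂ w₃ c)) =
      [41, 43, 49, 67])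
    (hW : ∀ v ∈ [v₀, v₁, v₂, v₃], dec v ∈ W) : W = ⊤ := by
  simp only [IsCodeList, List.forall_mem_cons, List.not_mem_nil, IsEmpty.forall_iff,
    implies_true, and_true] at hv hW
  obtain ⟨h₀, h₁, h₂, h₃⟩ := hv
  obtain ⟨k₀, k₁, k₂, k₃⟩ := hW
  have hmem (c : ℕ) : dec (linc v₀ v₁ v₂ v₃ c) ∈ W := by
    rw [dec_linc h₀ h₁ h₂ h₃, linMap, Matrix.vecMulLinear_apply, Matrix.vecMul_eq_sum,
      Fin.sum_univ_four]
    exact W.add_mem (W.add_mem (W.add_mem (W.smul_mem _ k₀) (W.smul_mem _ k₁)) (W.smul_mem _ k₂))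
      (W.smul_mem _ k₃)
  simp only [List.map_cons, List.map_nil, List.cons.injEq, and_true] at hinv
  obtain ⟨i₀, i₁, i₂, i₃⟩ := hinv
  obtain ⟨b₀, b₁, b₂, b₃⟩ := dec_basis
  have hsingle (i : Fin 4) : Pi.single i 1 ∈ W := by
    fin_cases i
    · exact b₀ ▸ i₀ ▸ hmem _
    · exact b₁ ▸ i₁ ▸ hmem _
    · exact b₂ ▸ i₂ ▸ hmem _
    · exact b₃ ▸ i₃ ▸ hmem _
  rw [eq_top_iff, ← (Pi.basisFun (ZMod 3) (Fin 4)).span_eq, Submodule.span_le]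
  rintro _ ⟨i, rfl⟩
  rw [Pi.basisFun_apply]
  exact hsingle i

theorem isRepList_row (i : Fin 6) : IsRepList (rowList i) := by
  revert i; decide +kernel

theorem isRepList_col (i : Fin 6) : IsRepList (colList i) := by
  revert i; decide +kernel

theorem isDemicapAt_first : IsDemicapAt 0 (stdRow 0) := by
  have hrow := isRepList_row 0
  refine ⟨isCap_pts (isCodeList_symList hrow.isCodeList) (by decide +kernel),
    card_sym hrow (by decide +kernel), fun i => dec ((rowList 0).get i),
    fun i => -dec ((rowList 0).get i), fun i => ?_, ?_, ?_⟩
  · refine isLine_triple.2 ⟨?_, by rw [zero_add]⟩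
    rw [← dec_forty]
    intro h
    have hi := hrow _ ((rowList 0).get_mem i)
    have := dec_injective (by norm_num) (by omega) h
    omega
  · ext p
    simp only [stdRow, sym, mem_pts, symList, List.mem_append, List.mem_map, mem_union, mem_image,
      mem_univ, true_and]
    constructor
    · rintro ⟨c, h | ⟨d, h, rfl⟩, rfl⟩
      · obtain ⟨i, rfl⟩ := List.get_of_mem h
        exact .inl ⟨i, rfl⟩
      · obtain ⟨i, rfl⟩ := List.get_of_mem h
        exact .inr ⟨i, (dec_negc (hrow.isCodeList _ h)).symm⟩
    · rintro (⟨i, rfl⟩ | ⟨i, rfl⟩)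
      · exact ⟨_, .inl ((rowList 0).get_mem i), rfl⟩
      · have h := (rowList 0).get_mem i
        exact ⟨_, .inr ⟨_, h, rfl⟩, dec_negc (hrow.isCodeList _ h)⟩
  · rintro s hs ⟨H, hH, hi⟩
    obtain ⟨k, rfl⟩ : ∃ k, s = univ.erase k := by
      obtain ⟨k, hk⟩ : ∃ k, sᶜ = {k} := by
        rw [← card_eq_one, card_compl, hs]
        rfl
      exact ⟨k, by rw [← compl_singleton, ← hk, compl_compl]⟩
    have hdir : ∀ i, i ≠ k → dec ((rowList 0).get i) ∈ H.direction := by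
      intro i hik
      obtain ⟨k1, k2, -⟩ := hi i (mem_erase.2 ⟨hik, mem_univ i⟩)
      simpa using AffineSubspace.vsub_mem_direction k2 k1
    have hall : ∀ v ∈ (rowList 0).eraseIdx k, dec v ∈ H.direction := by
      intro v hv
      obtain ⟨i, hik, hiv⟩ := List.mem_eraseIdx_iff_getElem?.1 hv
      obtain ⟨hlt, hv⟩ := List.getElem?_eq_some_iff.1 hiv
      rw [← hv]
      exact hdir ⟨i, hlt⟩ fun h => hik (by rw [← h])
    obtain ⟨v₀, v₁, v₂, v₃, w₀, w₁, w₂, w₃, e, hv, hinv⟩ := row_frame k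
    have htop : H.direction = ⊤ := eq_top_of_frame hv hinv (e ▸ hall)
    rw [htop, finrank_top] at hH
    simp at hH

end Demicaps

end AG43

namespace AG43

open Finset

/-! ### Decompositions and complements for the standard cap -/

section Decompositions

theorem disjoint_stdRow_stdCol (i j : Fin 6) : Disjoint (stdRow i) (stdCol j) := by
  have h : ∀ i j : Fin 6, ∀ c ∈ symList (rowList i), c ∉ symList (colList j) := by
    decide +kernel
  rw [disjoint_left]
  intro p hp hp'
  obtain ⟨c, hc, rfl⟩ := mem_pts.1 hp
  exact h i j c hc ((mem_sym (isCodeList_col j)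
    (isCodeList_symList (isCodeList_row i) c hc)).1 hp')

theorem isAnchor_stdRow (i : Fin 6) : IsAnchor 0 (stdRow i) := (isRepList_row i).isAnchor

theorem card_stdRow (i : Fin 6) : #(stdRow i) = 10 := by
  have h : ∀ i, (rowList i).Nodup ∧ (rowList i).length = 5 := by decide +kernel
  rw [stdRow, card_sym (isRepList_row i) (h i).1, (h i).2]

theorem card_stdCol (j : Fin 6) : #(stdCol j) = 10 := by
  have h : ∀ i, (colList i).Nodup ∧ (colList i).length = 5 := by decide +kernel
  rw [stdCol, card_sym (isRepList_col j) (h j).1, (h j).2]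

theorem anchor_fixed {g : Aff} (hg : act g stdCap = stdCap) : g 0 = 0 := by
  refine anchor_eq_zero (D := stdCap) (Subset.refl _) (by rw [card_stdCap]; norm_num) ?_
  have := isAnchor_act (g := g).2 isAnchor_stdCap
  rwa [hg] at this

theorem isDemicapAt_stdRow (i : Fin 6) : IsDemicapAt 0 (stdRow i) := by
  obtain ⟨g, hg, τ, hp⟩ := exists_permutesBy exists_reflection (Equiv.swap 0 i)
  have h := isDemicapAt_first.act g
  rwa [hp.1, Equiv.swap_apply_left, anchor_fixed hg] at h

theorem isDemicapAt_stdCol (j : Fin 6) : IsDemicapAt 0 (stdCol j) := by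
  obtain ⟨s, hs, hp⟩ := exists_duality
  have h := (isDemicapAt_stdRow j).act s
  rwa [hp.1, Equiv.Perm.one_apply, anchor_fixed hs] at h

theorem isCorrespondingDecomposition_act {C C' D E : Finset Pt}
    (h : IsCorrespondingDecomposition C C' D E) (g : Aff) :
    IsCorrespondingDecomposition (act g C) (act g C') (act g D) (act g E) :=
  ⟨h.pair.act g, h.left.act g, h.right.act g, disjoint_act.2 h.disj, by rw [← act_union, h.union],
    by rw [correspondingCap_act, h.corr]⟩

theorem countPartners_first : ∀ c < 81,
    (countPartners c (symList (rowList 0)) = 2 ∧ countPartners c (symList (colList 0)) = 2 ↔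
      c ∈ stdList) := by
  decide +kernel

theorem correspondingCap_first : correspondingCap (stdRow 0) (stdCol 0) = stdCap := by
  ext p
  rw [correspondingCap, mem_filter_univ, ← dec_enc p, stdCap,
    dec_mem_pts isCodeList_stdList (enc_lt p), ← countPartners_first _ (enc_lt p),
    ← two_mul_linesCompleted_pts (isCodeList_symList (isCodeList_row 0)) (by decide +kernel)
      (enc_lt p),
    ← two_mul_linesCompleted_pts (isCodeList_symList (isCodeList_col 0)) (by decide +kernel)
      (enc_lt p)]
  change linesCompleted _ (stdRow 0) = 1 ∧ linesCompleted _ (stdCol 0) = 1 ↔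
    2 * linesCompleted _ (stdRow 0) = 2 ∧ 2 * linesCompleted _ (stdCol 0) = 2
  omega

theorem decomposition_first :
    IsCorrespondingDecomposition stdCap (stdRow 0 ∪ stdCol 0) (stdRow 0) (stdCol 0) :=
  ⟨isCompletablePair_first, ⟨0, isDemicapAt_stdRow 0⟩, ⟨0, isDemicapAt_stdCol 0⟩,
    disjoint_stdRow_stdCol 0 0, rfl, correspondingCap_first⟩

theorem decomposition_std (i j : Fin 6) :
    IsCorrespondingDecomposition stdCap (stdRow i ∪ stdCol j) (stdRow i) (stdCol j) := by
  obtain ⟨g, hg, σ, τ, hp, hi, hj⟩ := exists_move_pair i j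
  have h := isCorrespondingDecomposition_act decomposition_first g⁻¹
  have e1 : act g (stdRow i) = stdRow 0 := by rw [hp.1, hi]
  have e2 : act g (stdCol j) = stdCol 0 := by rw [hp.2, hj]
  rwa [act_union, ← act_eq_iff.1 hg, ← act_eq_iff.1 e1, ← act_eq_iff.1 e2] at h

/-- A demicap in a decomposition shares the anchor 0, so it is a union of five of the ten antipodal
pairs, which leaves 252 candidates. The line condition on one half alone leaves only the row and the
column. -/
theorem half_candidates : ∀ l ∈ (rowList 0 ++ colList 0).sublistsLen 5,
    (stdList.all fun c => Nat.beq (countPartners c (symList l)) 2) = true →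
      maskOf l = maskOf (rowList 0) ∨ maskOf l = maskOf (colList 0) := by
  decide +kernel

theorem decomposition_first_unique {D E : Finset Pt}
    (h : IsCorrespondingDecomposition stdCap (stdRow 0 ∪ stdCol 0) D E) :
    D = stdRow 0 ∧ E = stdCol 0 ∨ D = stdCol 0 ∧ E = stdRow 0 := by
  have hE : E = (stdRow 0 ∪ stdCol 0) \ D := by
    rw [← h.union, union_sdiff_cancel_left h.disj]
  obtain ⟨b, hb⟩ := h.left
  have hsub : D ⊆ stdRow 0 ∪ stdCol 0 := h.union ▸ subset_union_left
  obtain ⟨a, -, ha'⟩ := h.pair.2.1.exists_anchor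
  have h0 := h.pair.isAnchor_zero
  have hb0 : b = 0 := by
    rw [ha' D hsub (by rw [hb.2.1]; norm_num) b hb.isAnchor]
    exact (ha' _ (Subset.refl _) (by rw [(isMaximalCap_iff.1 h.pair.2.1).2]; norm_num) 0 h0).symm
  subst hb0
  have hanch := hb.isAnchor
  have hrep := isRepList_union 0 0
  set l := (rowList 0 ++ colList 0).filter fun c => decide (dec c ∈ D) with hl
  have hlr : IsRepList l := fun c hc => hrep c (List.mem_filter.1 hc).1
  have hlnd : l.Nodup := isOvoidList_first.2.1.filter _
  have hlD : sym l = D := by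
    apply sym_eq_of_reps hanch
    ext c
    rw [List.mem_toFinset, mem_reps, hl, List.mem_filter, decide_eq_true_iff]
    refine and_congr_left fun hc => ⟨fun h => hrep c h, fun hc40 => ?_⟩
    have := hsub hc
    rw [stdRow, stdCol, ← sym_append] at this
    exact (dec_mem_sym_of_lt hrep hc40).1 this
  have hlen : l.length = 5 := by
    have h1 := card_sym hlr hlnd
    rw [hlD, hb.2.1] at h1
    omega
  have hcand := half_candidates l (List.mem_sublistsLen.2 ⟨List.filter_sublist, hlen⟩) (by
    rw [List.all_eq_true]
    intro c hc
    have hc81 := isCodeList_stdList c hc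
    have hmem : dec c ∈ correspondingCap D E := by
      rw [h.corr]
      exact mem_pts.2 ⟨c, hc, rfl⟩
    have h1 := (mem_filter.1 hmem).2.1
    rw [Nat.beq_eq, ← two_mul_linesCompleted_pts (isCodeList_symList hlr.isCodeList) ?_ hc81]
    · change 2 * linesCompleted (dec c) (sym l) = 2
      rw [hlD, h1]
    · rw [symList, List.nodup_append]
      refine ⟨hlnd, hlnd.map_on fun x hx y hy h => ?_, fun a ha b hb => ?_⟩
      · have := hlr x hx
        have := hlr y hy
        rw [negc_eq, negc_eq] at h
        omega
      · obtain ⟨d, hd, rfl⟩ := List.mem_map.1 hb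
        have := hlr a ha
        have := hlr d hd
        rw [negc_eq]
        omega)
  have hdis := disjoint_stdRow_stdCol 0 0
  rcases hcand with e | e
  · have hD : D = stdRow 0 := by
      rw [← hlD, sym_congr e]
      rfl
    left
    rw [hE, hD, union_sdiff_cancel_left hdis]
    exact ⟨rfl, rfl⟩
  · have hD : D = stdCol 0 := by
      rw [← hlD, sym_congr e]
      rfl
    right
    rw [hE, hD, union_sdiff_cancel_right hdis]
    exact ⟨rfl, rfl⟩

theorem decomposition_std_cases {C' D E : Finset Pt}
    (h : IsCorrespondingDecomposition stdCap C' D E) :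
    ∃ i j, D = stdRow i ∧ E = stdCol j ∨ D = stdCol j ∧ E = stdRow i := by
  obtain ⟨i, j, rfl⟩ := isCompletablePair_std.1 h.pair
  refine ⟨i, j, ?_⟩
  obtain ⟨g, hg, σ, τ, hp, hi, hj⟩ := exists_move_pair i j
  have h' := isCorrespondingDecomposition_act h g
  rw [act_union, hg, hp.1, hp.2, hi, hj] at h'
  have e1 : act g (stdRow i) = stdRow 0 := by rw [hp.1, hi]
  have e2 : act g (stdCol j) = stdCol 0 := by rw [hp.2, hj]
  rcases decomposition_first_unique h' with ⟨h1, h2⟩ | ⟨h1, h2⟩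
  · rw [← e1] at h1
    rw [← e2] at h2
    exact .inl ⟨act_injective g h1, act_injective g h2⟩
  · rw [← e2] at h1
    rw [← e1] at h2
    exact .inr ⟨act_injective g h1, act_injective g h2⟩

theorem complements_act (g : Aff) (D : Finset Pt) :
    complements (act g D) = act g '' complements D := by
  ext E
  constructor
  · rintro ⟨M, h1, h2, rfl⟩
    refine ⟨act g⁻¹ M \ D, ⟨_, h1.act g⁻¹, ?_, rfl⟩, ?_⟩
    · rwa [← act_subset_act (g := g), act_act_inv]
    · rw [act_sdiff, act_act_inv]
  · rintro ⟨_, ⟨M, h1, h2, rfl⟩, rfl⟩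
    exact ⟨act g M, h1.act g, act_subset_act.2 h2, act_sdiff g M D⟩

/-- A maximal cap through a row has anchor 0 as well, so only five further antipodal pairs have to
be searched for. -/
theorem row_extensions : ∀ l ∈ extensions killPair (rowList 0)
    (filt (maskOf (rowList 0)) (List.range 40)) 5,
    ∃ j, maskOf l = maskOf (rowList 0 ++ colList j) := by
  decide +kernel

theorem complements_first : complements (stdRow 0) = Set.range stdCol := by
  have hdiff (j : Fin 6) : (stdRow 0 ∪ stdCol j) \ stdRow 0 = stdCol j :=
    union_sdiff_cancel_left (disjoint_stdRow_stdCol 0 j)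
  ext E
  constructor
  · rintro ⟨M, h1, h2, rfl⟩
    obtain ⟨a, ha, ha'⟩ := h1.exists_anchor
    have h0 := ha' _ h2 (by rw [card_stdRow]; norm_num) 0 (isAnchor_stdRow 0)
    subst h0
    obtain ⟨l, hl, -, rfl⟩ := h1.mem_extensions ha (rowList 0)
      (filt (maskOf (rowList 0)) (List.range 40)) 5 (by decide +kernel) (isRepList_row 0)
      (fun c hc => h2 ((dec_mem_sym_of_lt (isRepList_row 0) (isRepList_row 0 c hc)).2 hc))
      (fun c hc _ => by
        by_cases h : c ∈ rowList 0
        · exact .inl h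
        · refine .inr (mem_filt.2 ⟨List.mem_range.2 hc, ?_⟩)
          rwa [Bool.eq_false_iff, ne_eq, hasBit_maskOf]) rfl
    obtain ⟨j, hj⟩ := row_extensions l hl
    refine ⟨j, ?_⟩
    rw [sym_congr hj, sym_append]
    exact (hdiff j).symm
  · rintro ⟨j, rfl⟩
    exact ⟨_, (isCompletablePair_std.2 ⟨0, j, rfl⟩).2.1, subset_union_left, (hdiff j).symm⟩

theorem image_range_of_perm {f : Finset Pt → Finset Pt} {r c : Fin 6 → Finset Pt}
    {σ : Equiv.Perm (Fin 6)} (h : ∀ i, f (r i) = c (σ i)) : f '' Set.range r = Set.range c := by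
  rw [← Set.range_comp, ← σ.surjective.range_comp c]
  exact congrArg Set.range (funext h)

theorem complements_stdRow (i : Fin 6) : complements (stdRow i) = Set.range stdCol := by
  obtain ⟨g, hg, τ, hp⟩ := exists_permutesBy exists_reflection (Equiv.swap 0 i)
  have h := complements_act g (stdRow 0)
  rwa [complements_first, hp.1, Equiv.swap_apply_left, image_range_of_perm hp.2] at h

theorem complements_stdCol (j : Fin 6) : complements (stdCol j) = Set.range stdRow := by
  obtain ⟨s, hs, hp⟩ := exists_duality
  have h := complements_act s (stdRow j)
  rwa [complements_stdRow, hp.1, image_range_of_perm hp.2] at h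

end Decompositions

end AG43

namespace AG43

open Finset

/-! ### The stabilizer of the standard cap -/

section Stabilizer

theorem stdRow_injective : Function.Injective stdRow := by
  have h : ∀ i j : Fin 6, (∀ c ∈ rowList i, c ∈ rowList j) → i = j := by decide +kernel
  intro i j hij
  refine h i j fun c hc => ?_
  have hc' := isRepList_row i c hc
  rw [← dec_mem_sym_of_lt (isRepList_row j) hc']
  change dec c ∈ stdRow j
  rw [← hij]
  exact (dec_mem_sym_of_lt (isRepList_row i) hc').2 hc

theorem stdCol_injective : Function.Injective stdCol := by
  obtain ⟨s, hs, hp⟩ := exists_duality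
  intro i j hij
  apply stdRow_injective
  apply act_injective s
  rw [hp.1, hp.1]
  exact hij

theorem nonempty_stdCol (i : Fin 6) : (stdCol i).Nonempty :=
  card_pos.1 (by rw [card_stdCol]; norm_num)

theorem stdRow_ne_stdCol (i j : Fin 6) : stdRow i ≠ stdCol j := by
  intro h
  have := disjoint_stdRow_stdCol i j
  rw [h, disjoint_self_iff_empty] at this
  exact (nonempty_stdCol j).ne_empty this

theorem exists_perm_of_injective {f : Finset Pt → Finset Pt} (hf : Function.Injective f)
    {r c : Fin 6 → Finset Pt} (hr : Function.Injective r) (h : ∀ i, ∃ k, f (r i) = c k) :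
    ∃ σ : Equiv.Perm (Fin 6), ∀ i, f (r i) = c (σ i) := by
  choose σ hσ using h
  have hinj : Function.Injective σ := by
    intro i j hij
    apply hr
    apply hf
    rw [hσ, hσ, hij]
  exact ⟨Equiv.ofBijective σ (Finite.injective_iff_bijective.1 hinj), hσ⟩

/-- Every decomposition (row i, column j) goes to a decomposition for the same cap, hence to a row
and a column in one of the two orders. The image of row 0 decides the order for all of them. -/
theorem stabilizer_cases {g : Aff} (hg : act g stdCap = stdCap) :
    (∃ σ τ, PermutesBy g stdRow stdCol σ τ) ∨ ∃ σ τ, SwapsBy g stdRow stdCol σ τ := by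
  have h (i j : Fin 6) : ∃ k l, act g (stdRow i) = stdRow k ∧ act g (stdCol j) = stdCol l ∨
      act g (stdRow i) = stdCol l ∧ act g (stdCol j) = stdRow k := by
    have := isCorrespondingDecomposition_act (decomposition_std i j) g
    rw [hg] at this
    exact decomposition_std_cases this
  obtain ⟨k, l, hkl⟩ := h 0 0
  rcases hkl with ⟨h1, -⟩ | ⟨h1, -⟩
  · left
    have hc (j : Fin 6) : ∃ l, act g (stdCol j) = stdCol l := by
      obtain ⟨k', l', ⟨-, e⟩ | ⟨e, -⟩⟩ := h 0 j
      · exact ⟨l', e⟩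
      · exact (stdRow_ne_stdCol _ _ (h1.symm.trans e)).elim
    have hr (i : Fin 6) : ∃ k, act g (stdRow i) = stdRow k := by
      obtain ⟨k', l', ⟨e, -⟩ | ⟨-, e⟩⟩ := h i 0
      · exact ⟨k', e⟩
      · obtain ⟨l, hl⟩ := hc 0
        exact (stdRow_ne_stdCol _ _ (e.symm.trans hl)).elim
    obtain ⟨σ, hσ⟩ := exists_perm_of_injective (act_injective g) stdRow_injective hr
    obtain ⟨τ, hτ⟩ := exists_perm_of_injective (act_injective g) stdCol_injective hc
    exact ⟨σ, τ, hσ, hτ⟩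
  · right
    have hc (j : Fin 6) : ∃ l, act g (stdCol j) = stdRow l := by
      obtain ⟨k', l', ⟨e, -⟩ | ⟨-, e⟩⟩ := h 0 j
      · exact (stdRow_ne_stdCol _ _ (e.symm.trans h1)).elim
      · exact ⟨k', e⟩
    have hr (i : Fin 6) : ∃ k, act g (stdRow i) = stdCol k := by
      obtain ⟨k', l', ⟨-, e⟩ | ⟨e, -⟩⟩ := h i 0
      · obtain ⟨l, hl⟩ := hc 0
        exact (stdRow_ne_stdCol _ _ (hl.symm.trans e)).elim
      · exact ⟨l', e⟩
    obtain ⟨σ, hσ⟩ := exists_perm_of_injective (act_injective g) stdRow_injective hr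
    obtain ⟨τ, hτ⟩ := exists_perm_of_injective (act_injective g) stdCol_injective hc
    exact ⟨σ, τ, hσ, hτ⟩

theorem pointReflection_eq (a x : Pt) :
    AffineEquiv.pointReflection (ZMod 3) a x = -(a + x) := by
  rw [AffineEquiv.pointReflection_apply, vsub_eq_sub, vadd_eq_add]
  have := three_smul_pt a
  calc a - x + a = (a + a + a) - (a + x) := by abel
    _ = -(a + x) := by rw [this, zero_sub]

theorem act_pointReflection {a : Pt} {S : Finset Pt} (h : IsAnchor a S) :
    act (AffineEquiv.pointReflection (ZMod 3) a) S = S := by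
  rw [isAnchor_iff] at h
  apply eq_of_subset_of_card_le
  · intro y hy
    obtain ⟨x, hx, rfl⟩ := mem_act.1 hy
    rw [pointReflection_eq]
    exact (h x hx).2
  · rw [card_act]

/-- Rows i and j meet only in the duad ±(ε_i - ε_j). The seven chosen intersections are the basis
vectors e_k and the sums e_k + e_{k+1}. -/
theorem common_points : ∀ x ∈ [((0 : Fin 6), (1 : Fin 6), 41), (1, 2, 43), (2, 3, 49), (3, 4, 67),
    (0, 2, addc 41 43), (1, 3, addc 43 49), (2, 4, addc 49 67)], ∀ c < 81,
    c ∈ symList (rowList x.1) → c ∈ symList (rowList x.2.1) → c = x.2.2 ∨ c = negc x.2.2 := by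
  decide +kernel

theorem common_points_mem : ([41, 43, 49, 67, addc 41 43, addc 43 49, addc 49 67].zip
    [((0 : Fin 6), (1 : Fin 6)), (1, 2), (2, 3), (3, 4), (0, 2), (1, 3), (2, 4)]).all (fun x =>
      decide (x.1 ∈ symList (rowList x.2.1) ∧ x.1 ∈ symList (rowList x.2.2))) = true := by
  decide +kernel

/-- The anchor is fixed, so g is linear, and it preserves every intersection of two rows. Thus each
e_k goes to ±e_k, and the sums e_k + e_{k+1} force neighbouring signs to agree. -/
theorem eq_one_or_eq_pointReflection {g : Aff} (hg : act g stdCap = stdCap)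
    (hr : ∀ i, act g (stdRow i) = stdRow i) :
    g = 1 ∨ g = AffineEquiv.pointReflection (ZMod 3) (0 : Pt) := by
  have h0 := anchor_fixed hg
  have hlin (x : Pt) : g x = g.linear x := by
    have := g.map_vadd 0 x
    simpa [h0] using this
  have hmem {i : Fin 6} {c : ℕ} (hc : c ∈ symList (rowList i)) :
      enc (g (dec c)) ∈ symList (rowList i) := by
    rw [← mem_sym (isCodeList_row i) (enc_lt _), dec_enc]
    change g (dec c) ∈ stdRow i
    rw [← hr i, apply_mem_act]
    exact mem_pts.2 ⟨c, hc, rfl⟩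
  have key {c : ℕ} (hc : c < 81) (h : enc (g (dec c)) = c ∨ enc (g (dec c)) = negc c) :
      g (dec c) = dec c ∨ g (dec c) = -dec c := by
    rw [← dec_negc hc]
    exact h.imp (fun h => by rw [← dec_enc (g (dec c)), h])
      (fun h => by rw [← dec_enc (g (dec c)), h])
  have hall := common_points_mem
  simp only [List.zip_cons_cons, List.zip_nil_right, List.all_cons, List.all_nil, Bool.and_true,
    Bool.and_eq_true, decide_eq_true_iff] at hall
  obtain ⟨m1, m2, m3, m4, m5, m6, m7⟩ := hall
  have e1 := key (by norm_num) (common_points (0, 1, 41) (by simp) _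
    (enc_lt _) (hmem m1.1) (hmem m1.2))
  have e2 := key (by norm_num) (common_points (1, 2, 43) (by simp) _
    (enc_lt _) (hmem m2.1) (hmem m2.2))
  have e3 := key (by norm_num) (common_points (2, 3, 49) (by simp) _
    (enc_lt _) (hmem m3.1) (hmem m3.2))
  have e4 := key (by norm_num) (common_points (3, 4, 67) (by simp) _
    (enc_lt _) (hmem m4.1) (hmem m4.2))
  have e5 := key addc_lt (common_points (0, 2, addc 41 43) (by simp) _
    (enc_lt _) (hmem m5.1) (hmem m5.2))
  have e6 := key addc_lt (common_points (1, 3, addc 43 49) (by simp) _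
    (enc_lt _) (hmem m6.1) (hmem m6.2))
  have e7 := key addc_lt (common_points (2, 4, addc 49 67) (by simp) _
    (enc_lt _) (hmem m7.1) (hmem m7.2))
  rw [dec_addc (by norm_num) (by norm_num)] at e5 e6 e7
  have hne {a b : ℕ} (h : (addc a b ≠ addc a (negc b) ∧ negc (addc a b) ≠ addc a (negc b)) ∧
      a < 81 ∧ b < 81) (hs : g (dec a + dec b) = dec a + dec b ∨
        g (dec a + dec b) = -(dec a + dec b)) (ha : g (dec a) = dec a ∨ g (dec a) = -dec a)
      (hb : g (dec b) = dec b ∨ g (dec b) = -dec b) :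
      (g (dec a) = dec a ∧ g (dec b) = dec b) ∨ (g (dec a) = -dec a ∧ g (dec b) = -dec b) := by
    obtain ⟨⟨n1, n2⟩, ha', hb'⟩ := h
    have hnb : negc b < 81 := negc_lt
    have hlt1 : addc a b < 81 := addc_lt
    have hlt2 : addc a (negc b) < 81 := addc_lt
    have hlt3 : negc (addc a b) < 81 := negc_lt
    have f1 : dec a + dec b ≠ dec a - dec b := by
      rw [sub_eq_add_neg, ← dec_negc hb', ← dec_addc ha' hb', ← dec_addc ha' hnb]
      exact fun h => n1 (dec_injective hlt1 hlt2 h)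
    have f2 : -(dec a + dec b) ≠ dec a - dec b := by
      rw [sub_eq_add_neg, ← dec_negc hb', ← dec_addc ha' hb', ← dec_addc ha' hnb, ← dec_negc hlt1]
      exact fun h => n2 (dec_injective hlt3 hlt2 h)
    rw [hlin, map_add, ← hlin, ← hlin] at hs
    rcases ha with ha | ha <;> rcases hb with hb | hb <;> rw [ha, hb] at hs ⊢
    · exact .inl ⟨rfl, rfl⟩
    · rw [← sub_eq_add_neg] at hs
      rcases hs with hs | hs
      · exact absurd hs.symm f1
      · exact absurd hs.symm f2
    · have hs' : dec a - dec b = -(dec a + dec b) ∨ dec a - dec b = dec a + dec b := by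
        refine hs.imp (fun h => ?_) fun h => ?_
        · rw [← h]; abel
        · rw [← neg_inj, ← h]; abel
      rcases hs' with hs | hs
      · exact absurd hs.symm f2
      · exact absurd hs.symm f1
    · exact .inr ⟨rfl, rfl⟩
  have s1 := hne (by decide +kernel) e5 e1 e2
  have s2 := hne (by decide +kernel) e6 e2 e3
  have s3 := hne (by decide +kernel) e7 e3 e4
  have n43 : dec 43 ≠ -dec 43 := by
    rw [← dec_negc (by norm_num)]
    exact fun h => absurd (dec_injective (by norm_num) negc_lt h) (by decide)
  have n49 : dec 49 ≠ -dec 49 := by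
    rw [← dec_negc (by norm_num)]
    exact fun h => absurd (dec_injective (by norm_num) negc_lt h) (by decide)
  obtain ⟨b₀, b₁, b₂, b₃⟩ := dec_basis
  rcases s1 with ⟨k1, k2⟩ | ⟨k1, k2⟩
  · left
    have k3 := (s2.resolve_right fun h => n43 (k2.symm.trans h.1)).2
    have k4 := (s3.resolve_right fun h => n49 (k3.symm.trans h.1)).2
    have : g.linear.toLinearMap = LinearMap.id := by
      refine (Pi.basisFun (ZMod 3) (Fin 4)).ext fun i => ?_
      rw [Pi.basisFun_apply, LinearMap.id_apply]
      change g.linear _ = _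
      rw [← hlin]
      fin_cases i
      · exact b₀ ▸ k1
      · exact b₁ ▸ k2
      · exact b₂ ▸ k3
      · exact b₃ ▸ k4
    refine AffineEquiv.ext fun x => ?_
    rw [hlin]
    exact LinearMap.congr_fun this x
  · right
    have k3 := (s2.resolve_left fun h => n43 (h.1.symm.trans k2)).2
    have k4 := (s3.resolve_left fun h => n49 (h.1.symm.trans k3)).2
    have : g.linear.toLinearMap = -LinearMap.id := by
      refine (Pi.basisFun (ZMod 3) (Fin 4)).ext fun i => ?_
      rw [Pi.basisFun_apply, LinearMap.neg_apply, LinearMap.id_apply]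
      change g.linear _ = _
      rw [← hlin]
      fin_cases i
      · exact b₀ ▸ k1
      · exact b₁ ▸ k2
      · exact b₂ ▸ k3
      · exact b₃ ▸ k4
    refine AffineEquiv.ext fun x => ?_
    rw [hlin, pointReflection_eq, zero_add]
    exact LinearMap.congr_fun this x

end Stabilizer

/-! ### The configuration of demicaps belonging to a maximal cap -/

section Configuration

/-- The properties of a maximal cap `C` with anchor point `a` and its two families of demicaps from
which the structure of the stabilizer of `C` is derived. -/
structure IsConfiguration (C : Finset Pt) (a : Pt) (r c : Fin 6 → Finset Pt) : Prop where
  anchor : IsAnchor a C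
  anchor_unique : ∀ b, IsAnchor b C → b = a
  row_injective : Function.Injective r
  col_injective : Function.Injective c
  row_demicap : ∀ i, IsDemicapAt a (r i)
  col_demicap : ∀ j, IsDemicapAt a (c j)
  disjoint : ∀ i j, Disjoint (r i) (c j)
  pair_iff : ∀ M, IsCompletablePair 1 C M ↔ ∃ i j, M = r i ∪ c j
  reflection : ∀ k : Fin 5, ∃ g : Aff, act g C = C ∧
    PermutesBy g r c (Equiv.swap k.castSucc k.succ) (synthemes k)
  duality : ∃ g : Aff, act g C = C ∧ SwapsBy g r c 1 1
  cases : ∀ g : Aff, act g C = C → (∃ σ τ, PermutesBy g r c σ τ) ∨ ∃ σ τ, SwapsBy g r c σ τ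
  kernel : ∀ g : Aff, act g C = C → (∀ i, act g (r i) = r i) →
    g = 1 ∨ g = AffineEquiv.pointReflection (ZMod 3) a

theorem isConfiguration_std : IsConfiguration stdCap 0 stdRow stdCol where
  anchor := isAnchor_stdCap
  anchor_unique b hb := anchor_eq_zero (Subset.refl _) (by rw [card_stdCap]; norm_num) hb
  row_injective := stdRow_injective
  col_injective := stdCol_injective
  row_demicap := isDemicapAt_stdRow
  col_demicap := isDemicapAt_stdCol
  disjoint := disjoint_stdRow_stdCol
  pair_iff _ := isCompletablePair_std
  reflection := exists_reflection
  duality := exists_duality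
  cases _ := stabilizer_cases
  kernel _ := eq_one_or_eq_pointReflection

variable {C : Finset Pt} {a : Pt} {r c : Fin 6 → Finset Pt} {σ τ : Equiv.Perm (Fin 6)}

theorem act_conj {g h : Aff} {S T : Finset Pt} :
    act (h * g * h⁻¹) (act h S) = act h T ↔ act g S = T := by
  rw [act_mul, act_inv_act, act_mul, (act_injective h).eq_iff]

theorem PermutesBy.conj {g : Aff} (hg : PermutesBy g r c σ τ) (h : Aff) :
    PermutesBy (h * g * h⁻¹) (fun i => act h (r i)) (fun j => act h (c j)) σ τ :=
  ⟨fun i => act_conj.2 (hg.1 i), fun j => act_conj.2 (hg.2 j)⟩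

theorem SwapsBy.conj {g : Aff} (hg : SwapsBy g r c σ τ) (h : Aff) :
    SwapsBy (h * g * h⁻¹) (fun i => act h (r i)) (fun j => act h (c j)) σ τ :=
  ⟨fun i => act_conj.2 (hg.1 i), fun j => act_conj.2 (hg.2 j)⟩

theorem conj_pointReflection (h : Aff) (a : Pt) :
    h * AffineEquiv.pointReflection (ZMod 3) a * h⁻¹ =
      AffineEquiv.pointReflection (ZMod 3) (h a) := by
  refine AffineEquiv.ext fun x => ?_
  obtain ⟨x, rfl⟩ := h.surjective x
  rw [pointReflection_eq, ← map_third, ← pointReflection_eq]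
  exact congrArg (fun y => h (AffineEquiv.pointReflection (ZMod 3) a y)) (h.symm_apply_apply x)

/-- Every clause is invariant under affine maps, with stabilizer elements transported by
conjugation. -/
theorem IsConfiguration.act (hC : IsConfiguration C a r c) (h : Aff) :
    IsConfiguration (act h C) (h a) (fun i => act h (r i)) fun j => act h (c j) := by
  have hconj (g : Aff) : ∃ g', g = h * g' * h⁻¹ := ⟨h⁻¹ * g * h, by group⟩
  refine ⟨isAnchor_act.2 hC.anchor, fun b hb => ?_, (act_injective h).comp hC.row_injective,
    (act_injective h).comp hC.col_injective, fun i => (hC.row_demicap i).act h,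
    fun j => (hC.col_demicap j).act h, fun i j => disjoint_act.2 (hC.disjoint i j), fun M => ?_,
    fun k => ?_, ?_, fun g hg => ?_, fun g hg hr => ?_⟩
  · obtain ⟨b, rfl⟩ := h.surjective b
    rw [hC.anchor_unique b (isAnchor_act.1 hb)]
  · obtain ⟨M, rfl⟩ : ∃ M', M = AG43.act h M' := ⟨_, (act_act_inv h M).symm⟩
    rw [isCompletablePair_act, hC.pair_iff]
    simp only [← act_union, (act_injective h).eq_iff]
  · obtain ⟨g, hg, hp⟩ := hC.reflection k
    exact ⟨_, act_conj.2 hg, hp.conj h⟩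
  · obtain ⟨g, hg, hp⟩ := hC.duality
    exact ⟨_, act_conj.2 hg, hp.conj h⟩
  · obtain ⟨g, rfl⟩ := hconj g
    rcases hC.cases g (act_conj.1 hg) with ⟨σ, τ, hp⟩ | ⟨σ, τ, hp⟩
    · exact .inl ⟨σ, τ, hp.conj h⟩
    · exact .inr ⟨σ, τ, hp.conj h⟩
  · obtain ⟨g, rfl⟩ := hconj g
    rcases hC.kernel g (act_conj.1 hg) (fun i => act_conj.1 (hr i)) with rfl | rfl
    · left
      group
    · exact .inr (conj_pointReflection h a)

theorem IsMaximalCap.exists_decomposition {C : Finset Pt} (hC : IsMaximalCap C) :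
    ∃ C' C₁ R₁, IsCorrespondingDecomposition C C' C₁ R₁ := by
  obtain ⟨h, rfl⟩ := hC.exists_eq
  exact ⟨_, _, _, isCorrespondingDecomposition_act decomposition_first h⟩

theorem IsCorrespondingDecomposition.exists_configuration {C C' C₁ R₁ : Finset Pt}
    (h : IsCorrespondingDecomposition C C' C₁ R₁) :
    ∃ a r c, IsConfiguration C a r c ∧ complements C₁ = Set.range r ∧
      complements R₁ = Set.range c := by
  obtain ⟨g, rfl⟩ := h.pair.1.exists_eq
  have hC := isConfiguration_std.act g
  have h' := isCorrespondingDecomposition_act h g⁻¹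
  rw [act_inv_act] at h'
  obtain ⟨i, j, ⟨h1, h2⟩ | ⟨h1, h2⟩⟩ := decomposition_std_cases h'
  -- Complements of a row are columns. When C₁ comes from a row, composing with the duality
  -- renumbers the configuration so that its first family consists of the complements of C₁.
  · obtain ⟨s, hs, hp⟩ := exists_duality
    have hC := isConfiguration_std.act (g * s)
    rw [act_mul, hs] at hC
    refine ⟨_, _, _, hC, ?_, ?_⟩
    · rw [← act_act_inv g C₁, h1, complements_act, complements_stdRow, ← Set.range_comp]
      refine congrArg Set.range (funext fun k => ?_)
      rw [act_mul, hp.1]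
      rfl
    · rw [← act_act_inv g R₁, h2, complements_act, complements_stdCol, ← Set.range_comp]
      refine congrArg Set.range (funext fun k => ?_)
      rw [act_mul, hp.2]
      rfl
  · refine ⟨_, _, _, hC, ?_, ?_⟩
    · rw [← act_act_inv g C₁, h1, complements_act, complements_stdCol, ← Set.range_comp]
      rfl
    · rw [← act_act_inv g R₁, h2, complements_act, complements_stdRow, ← Set.range_comp]
      rfl

end Configuration

end AG43

namespace AG43

open Finset

/-! ### Automorphisms of the symmetric group of degree six -/

section Automorphisms

open Equiv

theorem cycleType_map_eq (α : MulAut (Perm (Fin 6))) {σ τ : Perm (Fin 6)}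
    (h : σ.cycleType = τ.cycleType) : (α σ).cycleType = (α τ).cycleType := by
  rw [← Perm.isConj_iff_cycleType_eq] at h ⊢
  exact α.toMonoidHom.map_isConj h

theorem isSwap_map {α : MulAut (Perm (Fin 6))} (hα : (α (swap 0 1)).IsSwap) {σ : Perm (Fin 6)}
    (hσ : σ.IsSwap) : (α σ).IsSwap := by
  rw [Perm.isSwap_iff_cycleType] at hα hσ ⊢
  rw [← hα]
  apply cycleType_map_eq
  rw [hσ, eq_comm, ← Perm.isSwap_iff_cycleType]
  exact ⟨0, 1, by decide, rfl⟩

theorem swap_disjoint_or : ∀ a b x y : Fin 6, swap a b * swap x y = swap x y * swap a b ∨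
    swap x y = swap a x ∨ swap x y = swap a y ∨ swap x y = swap b x ∨ swap x y = swap b y := by
  decide +kernel

theorem swap_mul_swap_mul_swap_zero {i j : Fin 6} (hj : j ≠ 0) (hij : i ≠ j) :
    swap 0 i * swap 0 j * swap 0 i = swap i j := by
  rw [swap_comm 0 j]
  exact swap_mul_swap_mul_swap hj hij.symm

/-- The transpositions (0 i) pairwise do not commute, and neither do their images. These images turn
out to share a symbol `a`, and their other symbols define π, which agrees with α on generators. -/
theorem eq_conj_of_isSwap {α : MulAut (Perm (Fin 6))} (hα : (α (swap 0 1)).IsSwap) :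
    ∃ π, α = MulAut.conj π := by
  have hcomm {i j : Fin 6} (hi : i ≠ 0) (hj : j ≠ 0) (hij : i ≠ j) :
      α (swap 0 i) * α (swap 0 j) ≠ α (swap 0 j) * α (swap 0 i) := by
    rw [← map_mul, ← map_mul, α.injective.ne_iff]
    revert i j
    decide
  have hsw {i : Fin 6} (hi : i ≠ 0) : ∃ x y, α (swap 0 i) = swap x y := by
    obtain ⟨x, y, -, h⟩ := isSwap_map hα ⟨0, i, hi.symm, rfl⟩
    exact ⟨x, y, h⟩
  obtain ⟨a, b, c, hb, hc⟩ : ∃ a b c, α (swap 0 1) = swap a b ∧ α (swap 0 2) = swap a c := by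
    obtain ⟨a, b, hb⟩ := hsw (i := 1) (by decide)
    obtain ⟨x, y, hxy⟩ := hsw (i := 2) (by decide)
    have h := hcomm (i := 1) (j := 2) (by decide) (by decide) (by decide)
    rw [hb, hxy] at h
    rcases (swap_disjoint_or a b x y).resolve_left h with h | h | h | h
    · exact ⟨a, b, x, hb, hxy.trans h⟩
    · exact ⟨a, b, y, hb, hxy.trans h⟩
    · exact ⟨b, a, x, hb.trans (swap_comm _ _), hxy.trans h⟩
    · exact ⟨b, a, y, hb.trans (swap_comm _ _), hxy.trans h⟩
  have hf (i : Fin 6) : ∃ y, α (swap 0 i) = swap a y := by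
    by_cases h0 : i = 0
    · exact ⟨a, by rw [h0, swap_self, swap_self]; exact map_one α⟩
    by_cases h1 : i = 1
    · exact ⟨b, h1 ▸ hb⟩
    by_cases h2 : i = 2
    · exact ⟨c, h2 ▸ hc⟩
    obtain ⟨x, y, hxy⟩ := hsw h0
    have n1 := hcomm (i := 1) (by decide) h0 (Ne.symm h1)
    have n2 := hcomm (i := 2) (by decide) h0 (Ne.symm h2)
    have n3 : α (swap 0 i) ≠ α (swap 1 2) := by
      rw [α.injective.ne_iff]
      clear n1 n2 hxy
      revert i
      decide
    rw [← swap_mul_swap_mul_swap_zero (i := 1) (j := 2) (by decide) (by decide),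
      map_mul, map_mul] at n3
    rw [hb, hxy] at n1 n3
    rw [hc, hxy] at n2
    rw [hc] at n3
    have n0 := hcomm (i := 1) (j := 2) (by decide) (by decide) (by decide)
    rw [hb, hc] at n0
    -- A transposition commuting with neither (a b) nor (a c) moves a or equals (b c). The second
    -- case is excluded, since (b c) is already the image of (1 2).
    have key : ∀ a b c x y : Fin 6, swap a b * swap a c = swap a c * swap a b ∨
        swap a b * swap x y = swap x y * swap a b ∨
        swap a c * swap x y = swap x y * swap a c ∨
        swap x y = swap a b * swap a c * swap a b ∨ swap x y = swap a x ∨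
        swap x y = swap a y := by
      decide +kernel
    rcases key a b c x y with h | h | h | h | h | h
    · exact (n0 h).elim
    · exact (n1 h).elim
    · exact (n2 h).elim
    · exact (n3 h).elim
    · exact ⟨x, hxy.trans h⟩
    · exact ⟨y, hxy.trans h⟩
  choose f hf using hf
  have hinj : Function.Injective f := by
    have : ∀ i j : Fin 6, swap 0 i = swap 0 j → i = j := by decide +kernel
    intro i j hij
    apply this
    apply α.injective
    rw [hf, hf, hij]
  have hf0 : f 0 = a := by
    have h := hf 0
    rw [swap_self, show (Equiv.refl (Fin 6)) = 1 from rfl, map_one, eq_comm, Perm.one_def,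
      swap_eq_refl_iff] at h
    exact h.symm
  refine ⟨Equiv.ofBijective f (Finite.injective_iff_bijective.1 hinj), ?_⟩
  set π := Equiv.ofBijective f (Finite.injective_iff_bijective.1 hinj)
  have hπ (i : Fin 6) : π i = f i := rfl
  have hzero (i : Fin 6) : α (swap 0 i) = MulAut.conj π (swap 0 i) := by
    rw [hf, MulAut.conj_apply, mul_swap_eq_swap_mul, mul_inv_cancel_right, hπ, hπ, hf0]
  have hswap (i j : Fin 6) (hij : i ≠ j) : α (swap i j) = MulAut.conj π (swap i j) := by
    by_cases hi : i = 0
    · rw [hi, hzero]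
    by_cases hj : j = 0
    · rw [hj, swap_comm, hzero]
    rw [← swap_mul_swap_mul_swap_zero hj hij, map_mul, map_mul, map_mul, map_mul, hzero, hzero]
  ext1 σ
  induction σ using Perm.swap_induction_on with
  | one => rw [map_one, map_one]
  | swap_mul σ i j hij ih => rw [map_mul, map_mul, ih, hswap i j hij]

theorem swap_mul_swap_pow : ∀ a b x y : Fin 6, (swap a b * swap x y) ^ 6 = 1 := by
  decide +kernel

theorem cycleType_swap : (swap (0 : Fin 6) 1).cycleType = {2} :=
  Perm.isSwap_iff_cycleType.1 ⟨0, 1, by decide, rfl⟩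

theorem cycleType_triple :
    (swap 0 1 * swap 2 3 * swap 4 5 : Perm (Fin 6)).cycleType = {2, 2, 2} := by
  decide +kernel

theorem cycleType_double_left : (swap 0 1 * swap 2 3 : Perm (Fin 6)).cycleType = {2, 2} := by
  decide +kernel

theorem cycleType_double_right : (swap 1 2 * swap 3 4 : Perm (Fin 6)).cycleType = {2, 2} := by
  decide +kernel

/-- Double transpositions are excluded by orders: two transpositions have a product of order 1, 2 or
3, whereas (0 1)(2 3) times (1 2)(3 4) is a 5-cycle. -/
theorem cycleType_map_swap (α : MulAut (Perm (Fin 6))) :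
    (α (swap 0 1)).cycleType = {2} ∨ (α (swap 0 1)).cycleType = {2, 2, 2} := by
  have ho : orderOf (α (swap 0 1)) = 2 := by
    rw [orderOf_eq_prime_iff]
    refine ⟨?_, ?_⟩
    · rw [← map_pow, sq, swap_mul_self, map_one]
    · rw [← map_one α, α.injective.ne_iff]
      decide
  obtain ⟨n, hn⟩ := Perm.cycleType_prime_order (ho ▸ Nat.prime_two)
  rw [ho] at hn
  have hsum := (α (swap 0 1)).sum_cycleType
  have hle := (α (swap 0 1)).support.card_le_univ
  rw [hn, Multiset.sum_replicate] at hsum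
  rw [← hsum, Fintype.card_fin, smul_eq_mul] at hle
  obtain rfl | rfl | rfl : n = 0 ∨ n = 1 ∨ n = 2 := by omega
  · exact .inl hn
  · exfalso
    have hback {σ : Perm (Fin 6)} (hσ : σ.cycleType = {2, 2}) : (α⁻¹ σ).IsSwap := by
      have h := cycleType_map_eq α⁻¹ (hσ.trans hn.symm)
      rw [MulAut.inv_apply_self, cycleType_swap] at h
      exact Perm.isSwap_iff_cycleType.2 h
    obtain ⟨a, b, -, h1⟩ := hback cycleType_double_left
    obtain ⟨x, y, -, h2⟩ := hback cycleType_double_right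
    have h := swap_mul_swap_pow a b x y
    rw [← h1, ← h2, ← map_mul, ← map_pow, ← map_one α⁻¹] at h
    exact absurd (α⁻¹.injective h) (by decide +kernel)
  · exact .inr hn

/-- Given an automorphism that does not preserve the class of transpositions, every automorphism is
inner or the product of the given one and an inner one. -/
theorem exists_eq_conj_or {ω : MulAut (Perm (Fin 6))}
    (hω : (ω (swap 0 1)).cycleType = {2, 2, 2}) (α : MulAut (Perm (Fin 6))) :
    ∃ π, α = MulAut.conj π ∨ α = ω * MulAut.conj π := by
  rcases cycleType_map_swap α with h | h
  · obtain ⟨π, hπ⟩ := eq_conj_of_isSwap (Perm.isSwap_iff_cycleType.2 h)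
    exact ⟨π, .inl hπ⟩
  · have h' := cycleType_map_eq ω⁻¹ (h.trans hω.symm)
    rw [MulAut.inv_apply_self, cycleType_swap, ← Perm.isSwap_iff_cycleType,
      ← MulAut.mul_apply] at h'
    obtain ⟨π, hπ⟩ := eq_conj_of_isSwap h'
    exact ⟨π, .inr (by rw [← hπ, mul_inv_cancel_left])⟩

theorem isOuter_of_cycleType {ω : MulAut (Perm (Fin 6))}
    (hω : (ω (swap 0 1)).cycleType = {2, 2, 2}) : IsOuter ω := by
  rintro π rfl
  rw [MulAut.conj_apply, Perm.cycleType_conj, cycleType_swap] at hω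
  exact absurd hω (by decide)

/-- The centre of S₆ is trivial: if σ commutes with (i j) and moves i, then σ i = j, which cannot
hold for two different j. -/
theorem conj_injective : Function.Injective (MulAut.conj : Perm (Fin 6) →* _) := by
  rw [injective_iff_map_eq_one]
  intro σ hσ
  have h (i : Fin 6) (hi : σ i ≠ i) : ∀ j, j ≠ i → j = σ i := by
    intro j hj
    by_contra hne
    have := Equiv.congr_fun (MulEquiv.congr_fun hσ (swap i j)) (σ i)
    rw [MulAut.conj_apply, mul_swap_eq_swap_mul, mul_inv_cancel_right, swap_apply_left,
      MulAut.one_apply, swap_apply_of_ne_of_ne hi (Ne.symm hne)] at this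
    exact hj (σ.injective this)
  ext1 i
  by_contra hi
  obtain ⟨j, k, h1, h2, h3⟩ : ∃ j k : Fin 6, j ≠ i ∧ k ≠ i ∧ j ≠ k := by
    clear h hi
    revert i
    decide
  exact h3 ((h i hi j h1).trans (h i hi k h2).symm)

end Automorphisms

end AG43

namespace AG43

open Finset

/-! ### The action of the stabilizer on the two families -/

section Action

open Equiv

variable {C : Finset Pt} {a : Pt} {r c : Fin 6 → Finset Pt} {g h : Aff}
  {σ τ σ' τ' : Perm (Fin 6)} {ω : MulAut (Perm (Fin 6))}

theorem PermutesBy.mul_swapsBy (hg : PermutesBy g r c σ τ) (hh : SwapsBy h r c σ' τ') :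
    SwapsBy (g * h) r c (τ * σ') (σ * τ') :=
  ⟨fun i => by rw [act_mul, hh.1, hg.2]; rfl, fun j => by rw [act_mul, hh.2, hg.1]; rfl⟩

theorem PermutesBy.preserves (hg : PermutesBy g r c σ τ) :
    Preserves g (Set.range r) (Set.range c) := by
  constructor
  · rw [← Set.range_comp, (funext hg.1 : act g ∘ r = r ∘ σ), σ.surjective.range_comp]
  · rw [← Set.range_comp, (funext hg.2 : act g ∘ c = c ∘ τ), τ.surjective.range_comp]

theorem SwapsBy.interchanges (hg : SwapsBy g r c σ τ) :
    Interchanges g (Set.range r) (Set.range c) := by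
  constructor
  · rw [← Set.range_comp, (funext hg.1 : act g ∘ r = c ∘ σ), σ.surjective.range_comp]
  · rw [← Set.range_comp, (funext hg.2 : act g ∘ c = r ∘ τ), τ.surjective.range_comp]

theorem mem_capStabilizer : g ∈ capStabilizer C ↔ act g C = C := Iff.rfl

namespace IsConfiguration

variable (hC : IsConfiguration C a r c)
include hC

theorem row_ne_col (i j : Fin 6) : r i ≠ c j := by
  intro h
  have hd := hC.disjoint i j
  rw [h, disjoint_self_iff_empty] at hd
  have := (hC.col_demicap j).2.1
  rw [hd] at this
  simp at this

theorem disjoint_range : Disjoint (Set.range r) (Set.range c) := by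
  rw [Set.disjoint_left]
  rintro _ ⟨i, rfl⟩ ⟨j, hj⟩
  exact hC.row_ne_col i j hj.symm

theorem not_preserves_and_interchanges (h1 : Preserves g (Set.range r) (Set.range c))
    (h2 : Interchanges g (Set.range r) (Set.range c)) : False := by
  have h := h1.1.symm.trans h2.1
  obtain ⟨j, hj⟩ := h ▸ Set.mem_range_self (f := r) 0
  exact hC.row_ne_col 0 j hj.symm

theorem permutesBy_unique (h1 : PermutesBy g r c σ τ) (h2 : PermutesBy g r c σ' τ') :
    σ = σ' ∧ τ = τ' :=
  ⟨Equiv.ext fun i => hC.row_injective ((h1.1 i).symm.trans (h2.1 i)),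
    Equiv.ext fun j => hC.col_injective ((h1.2 j).symm.trans (h2.2 j))⟩

theorem swapsBy_unique (h1 : SwapsBy g r c σ τ) (h2 : SwapsBy g r c σ' τ') : σ = σ' ∧ τ = τ' :=
  ⟨Equiv.ext fun i => hC.col_injective ((h1.1 i).symm.trans (h2.1 i)),
    Equiv.ext fun j => hC.row_injective ((h1.2 j).symm.trans (h2.2 j))⟩

theorem permutesBy_pointReflection :
    PermutesBy (AffineEquiv.pointReflection (ZMod 3) a) r c 1 1 :=
  ⟨fun i => act_pointReflection (hC.row_demicap i).isAnchor,
    fun j => act_pointReflection (hC.col_demicap j).isAnchor⟩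

theorem permutesBy_one_of_fixes (hg : AG43.act g C = C) (h : PermutesBy g r c 1 τ) : τ = 1 := by
  have h1 : PermutesBy g r c 1 1 := by
    obtain rfl | rfl := hC.kernel g hg h.1
    · exact permutesBy_one
    · exact hC.permutesBy_pointReflection
  exact (hC.permutesBy_unique h h1).2

/-- The automorphism of `S₆` by which the actions of the stabilizer on the two families of demicaps
are linked. -/
theorem exists_link : ∃ ω : MulAut (Perm (Fin 6)), ω * ω = 1 ∧
    (∀ σ, ∃ g : capStabilizer C, PermutesBy g r c σ (ω σ)) ∧
    (∀ σ, ∃ g : capStabilizer C, SwapsBy g r c σ (ω σ)) ∧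
    (∀ g : capStabilizer C,
      (∃ σ, PermutesBy g r c σ (ω σ)) ∨ ∃ σ, SwapsBy g r c σ (ω σ)) ∧
    ∀ k : Fin 5, ω (swap k.castSucc k.succ) = synthemes k := by
  choose p hp τ hτ using exists_permutesBy hC.reflection
  obtain ⟨s, hs, hs'⟩ := hC.duality
  -- The row permutation determines the column permutation, since an element fixing all rows is ±I
  -- and fixes all columns too.
  have huniq {g : Aff} (hg : AG43.act g C = C) {σ τ'} (h : PermutesBy g r c σ τ') : τ' = τ σ := by
    have h1 := (hτ σ).inv.mul h
    rw [inv_mul_cancel] at h1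
    have h2 := hC.permutesBy_one_of_fixes (mul_mem (inv_mem (mem_capStabilizer.2 (hp σ))) hg) h1
    exact (eq_of_inv_mul_eq_one h2).symm
  -- With s the duality and g acting by (σ, τ σ), the product s g s acts on the rows by τ σ and on
  -- the columns by σ; hence τ ∘ τ is the identity.
  have hinv (σ) : τ (τ σ) = σ := by
    have h := ((hs'.mul_permutesBy (hτ σ)).mul hs')
    rw [one_mul, one_mul, mul_one, mul_one] at h
    exact (huniq (mul_mem (mul_mem (mem_capStabilizer.2 hs) (hp σ)) hs) h).symm
  have hmul (σ σ') : τ (σ * σ') = τ σ * τ σ' :=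
    (huniq (mul_mem (mem_capStabilizer.2 (hp σ)) (hp σ')) ((hτ σ).mul (hτ σ'))).symm
  refine ⟨{ toFun := τ, invFun := τ, left_inv := hinv, right_inv := hinv, map_mul' := hmul },
    MulEquiv.ext hinv, fun σ => ⟨⟨p σ, hp σ⟩, hτ σ⟩, fun σ => ⟨⟨s * p σ,
      mul_mem (mem_capStabilizer.2 hs) (hp σ)⟩, ?_⟩, fun g => ?_, fun k => ?_⟩
  · have h := hs'.mul_permutesBy (hτ σ)
    rwa [one_mul, one_mul] at h
  · rcases hC.cases g g.2 with ⟨σ, τ', h⟩ | ⟨σ, τ', h⟩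
    · obtain rfl := huniq g.2 h
      exact .inl ⟨σ, h⟩
    · have h' := hs'.mul h
      rw [one_mul, one_mul] at h'
      obtain rfl := huniq (mul_mem (mem_capStabilizer.2 hs) g.2) h'
      exact .inr ⟨σ, h⟩
  · obtain ⟨g, hg, h⟩ := hC.reflection k
    exact (huniq hg h).symm

theorem mem_signSubgroup_iff (g : capStabilizer C) :
    g ∈ signSubgroup C a ↔ PermutesBy g r c 1 1 := by
  rw [signSubgroup, Subgroup.mem_subgroupOf]
  constructor
  · rintro ⟨k, hk⟩
    have h (n : ℕ) : PermutesBy (AffineEquiv.pointReflection (ZMod 3) a ^ n) r c 1 1 := by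
      induction n with
      | zero => exact permutesBy_one
      | succ n ih => exact ih.mul hC.permutesBy_pointReflection
    change _ ^ k = (g : Aff) at hk
    rw [← hk]
    obtain ⟨n, rfl | rfl⟩ := k.eq_nat_or_neg
    · exact_mod_cast h n
    · rw [zpow_neg, zpow_natCast]
      exact (h n).inv
  · intro h
    rcases hC.kernel g g.2 h.1 with h | h
    · rw [h]
      exact one_mem _
    · rw [h]
      exact Subgroup.mem_zpowers _

theorem mem_signSubgroup_iff_fixes (g : capStabilizer C) :
    g ∈ signSubgroup C a ↔ ∀ D ∈ Set.range r ∪ Set.range c, AG43.act g D = D := by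
  rw [hC.mem_signSubgroup_iff]
  constructor
  · rintro h D (⟨i, rfl⟩ | ⟨j, rfl⟩)
    · exact h.1 i
    · exact h.2 j
  · exact fun h => ⟨fun i => h _ (.inl ⟨i, rfl⟩), fun j => h _ (.inr ⟨j, rfl⟩)⟩

theorem card_signSubgroup : Nat.card (signSubgroup C a) = 2 := by
  have hle : Subgroup.zpowers (AffineEquiv.pointReflection (ZMod 3) a) ≤ capStabilizer C := by
    rw [Subgroup.zpowers_le]
    exact act_pointReflection hC.anchor
  rw [signSubgroup, Nat.card_congr (Subgroup.subgroupOfEquivOfLe hle).toEquiv, Nat.card_zpowers,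
    orderOf_eq_prime_iff]
  constructor
  · refine AffineEquiv.ext fun x => ?_
    rw [sq]
    exact AffineEquiv.pointReflection_involutive (ZMod 3) a x
  · intro h
    have h1 := DFunLike.congr_fun h (a + Pi.single 0 1)
    rw [pointReflection_eq] at h1
    have h2 : a + a + a = 0 := three_smul_pt a
    have h3 : (Pi.single 0 1 : Pt) = -Pi.single 0 1 := by
      have h4 : -(a + (a + Pi.single 0 1)) = a + Pi.single 0 1 := h1
      calc (Pi.single 0 1 : Pt) = (a + Pi.single 0 1) - a := by abel
        _ = -(a + a + a) - Pi.single 0 1 := by rw [← h4]; abel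
        _ = _ := by rw [h2, neg_zero, zero_sub]
    exact absurd (congrFun h3 0) (by simp; decide)

theorem xor_preserves_interchanges (hg : AG43.act g C = C) :
    Xor (Preserves g (Set.range r) (Set.range c)) (Interchanges g (Set.range r) (Set.range c)) := by
  rcases hC.cases g hg with ⟨σ, τ, h⟩ | ⟨σ, τ, h⟩
  · exact .inl ⟨h.preserves, fun h' => hC.not_preserves_and_interchanges h.preserves h'⟩
  · exact .inr ⟨h.interchanges, fun h' => hC.not_preserves_and_interchanges h' h.interchanges⟩

theorem union_eq_union_iff {i j i' j' : Fin 6} : r i ∪ c j = r i' ∪ c j' ↔ i = i' ∧ j = j' := by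
  refine ⟨fun h => ?_, fun h => by rw [h.1, h.2]⟩
  have key {i j i' j' : Fin 6} (h : r i ∪ c j = r i' ∪ c j') : r i ⊆ r i' ∧ c j ⊆ c j' :=
    ⟨(hC.disjoint i j').left_le_of_le_sup_right (subset_union_left.trans h.subset),
      (hC.disjoint i' j).symm.left_le_of_le_sup_left (subset_union_right.trans h.subset)⟩
  exact ⟨hC.row_injective ((key h).1.antisymm (key h.symm).1),
    hC.col_injective ((key h).2.antisymm (key h.symm).2)⟩

theorem ncard_completable : {M | IsCompletablePair 1 C M}.ncard = 36 := by
  have h : {M | IsCompletablePair 1 C M} =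
      Set.range fun p : Fin 6 × Fin 6 => r p.1 ∪ c p.2 := by
    ext M
    rw [Set.mem_ofPred_eq, hC.pair_iff, Set.mem_range, Prod.exists]
    simp only [eq_comm]
  rw [h, ← Nat.card_coe_set_eq, Nat.card_range_of_injective, Nat.card_eq_fintype_card]
  · rfl
  · rintro ⟨i, j⟩ ⟨i', j'⟩ h
    exact Prod.ext_iff.2 (hC.union_eq_union_iff.1 h)

end IsConfiguration

end Action

end AG43

namespace AG43

open Finset

/-! ### The linking automorphism -/

section Link

open Equiv

/-- `ω` links the actions of the stabilizer of `C` on the families `r` and `c`. -/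
structure IsLink (C : Finset Pt) (r c : Fin 6 → Finset Pt) (ω : MulAut (Perm (Fin 6))) : Prop where
  involutive : ω * ω = 1
  permutes : ∀ σ, ∃ g : capStabilizer C, PermutesBy g r c σ (ω σ)
  swaps : ∀ σ, ∃ g : capStabilizer C, SwapsBy g r c σ (ω σ)
  cases : ∀ g : capStabilizer C,
    (∃ σ, PermutesBy g r c σ (ω σ)) ∨ ∃ σ, SwapsBy g r c σ (ω σ)
  map_swap : ∀ k : Fin 5, ω (swap k.castSucc k.succ) = synthemes k

variable {C : Finset Pt} {a : Pt} {r c : Fin 6 → Finset Pt} {g h : Aff}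
  {σ τ σ' τ' : Perm (Fin 6)} {ω : MulAut (Perm (Fin 6))}

theorem IsConfiguration.exists_isLink (hC : IsConfiguration C a r c) : ∃ ω, IsLink C r c ω := by
  obtain ⟨ω, h1, h2, h3, h4, h5⟩ := hC.exists_link
  exact ⟨ω, h1, h2, h3, h4, h5⟩

/-- The product of the five adjacent transpositions is a 6-cycle, so the type of the image of any
6-cycle can be read off from the product of the five `synthemes`. -/
theorem cycleType_six : ((List.finRange 5).map fun k : Fin 5 =>
    swap k.castSucc k.succ).prod.cycleType = {6} := by
  decide +kernel

theorem cycleType_synthemes : ((List.finRange 5).map synthemes).prod.cycleType = {2, 3} := by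
  decide +kernel

namespace IsLink

variable (hω : IsLink C r c ω)
include hω

theorem map_map (σ : Perm (Fin 6)) : ω (ω σ) = σ := MulEquiv.congr_fun hω.involutive σ

theorem map_swap_zero_one : ω (swap 0 1) = swap 0 1 * swap 2 3 * swap 4 5 := hω.map_swap 0

theorem cycleType_swap_zero_one : (ω (swap 0 1)).cycleType = {2, 2, 2} := by
  rw [hω.map_swap_zero_one, cycleType_triple]

theorem cycleType_of_two (hσ : σ.cycleType = {2}) : (ω σ).cycleType = {2, 2, 2} := by
  rw [cycleType_map_eq ω (hσ.trans cycleType_swap.symm), hω.cycleType_swap_zero_one]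

theorem cycleType_of_triple (hσ : σ.cycleType = {2, 2, 2}) : (ω σ).cycleType = {2} := by
  rw [cycleType_map_eq ω (hσ.trans hω.cycleType_swap_zero_one.symm), hω.map_map, cycleType_swap]

theorem cycleType_of_six (hσ : σ.cycleType = {6}) : (ω σ).cycleType = {2, 3} := by
  rw [cycleType_map_eq ω (hσ.trans cycleType_six.symm), map_list_prod, List.map_map,
    ← cycleType_synthemes]
  exact congrArg (fun f => ((List.finRange 5).map f).prod.cycleType) (funext hω.map_swap)

theorem isOuter : IsOuter ω := isOuter_of_cycleType hω.cycleType_swap_zero_one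

/-- Lets ω be moved to the front of a product, as needed for the multiplicativity of Φ. -/
theorem mul_conj (σ : Perm (Fin 6)) : MulAut.conj σ * ω = ω * MulAut.conj (ω σ) := by
  ext1 τ
  rw [MulAut.mul_apply, MulAut.mul_apply, MulAut.conj_apply, MulAut.conj_apply, map_mul, map_mul,
    map_inv, hω.map_map]

end IsLink

/-- The effect of a link on arbitrary numberings of the two families. -/
theorem IsLink.renumber (hω : IsLink C r c ω) (hC : IsConfiguration C a r c)
    {r' c' : Fin 6 → Finset Pt} (hr : IsNumbering r' (Set.range r))
    (hc : IsNumbering c' (Set.range c)) : ∃ ω' : MulAut (Perm (Fin 6)),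
    (∀ g : capStabilizer C, Preserves g (Set.range r) (Set.range c) →
      ∃ σ, PermutesBy g r' c' σ (ω' σ)) ∧
    (∀ σ, ∃ g : capStabilizer C, PermutesBy g r' c' σ (ω' σ)) ∧
    (∀ σ, ∃ g : capStabilizer C, ∃ τ, SwapsBy g r' c' σ τ) ∧
    ∀ σ, (ω' σ).cycleType = (ω σ).cycleType := by
  have hperm {f f' : Fin 6 → Finset Pt} (hf : IsNumbering f' (Set.range f)) :
      ∃ α : Perm (Fin 6), ∀ i, f' i = f (α i) := by
    have h (i : Fin 6) : ∃ k, f' i = f k := by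
      obtain ⟨k, hk⟩ := hf.2 ▸ Set.mem_range_self (f := f') i
      exact ⟨k, hk.symm⟩
    exact exists_perm_of_injective (f := id) Function.injective_id hf.1 h
  obtain ⟨α, hα⟩ := hperm hr
  obtain ⟨β, hβ⟩ := hperm hc
  have hp {g : Aff} {σ τ : Perm (Fin 6)} (h : PermutesBy g r c (α * σ * α⁻¹) (β * τ * β⁻¹)) :
      PermutesBy g r' c' σ τ := by
    refine ⟨fun i => ?_, fun j => ?_⟩
    · rw [hα, h.1, hα]
      exact congrArg (fun x => r (α (σ x))) (α.symm_apply_apply i)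
    · rw [hβ, h.2, hβ]
      exact congrArg (fun x => c (β (τ x))) (β.symm_apply_apply j)
  have hs {g : Aff} {σ τ : Perm (Fin 6)} (h : SwapsBy g r c (β * σ * α⁻¹) (α * τ * β⁻¹)) :
      SwapsBy g r' c' σ τ := by
    refine ⟨fun i => ?_, fun j => ?_⟩
    · rw [hα, h.1, hβ]
      exact congrArg (fun x => c (β (σ x))) (α.symm_apply_apply i)
    · rw [hβ, h.2, hα]
      exact congrArg (fun x => r (α (τ x))) (β.symm_apply_apply j)
  -- For other numberings ω is multiplied by inner automorphisms on both sides. The result need not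
  -- be an involution, but it has the same effect on cycle types.
  have hω' (σ : Perm (Fin 6)) : (MulAut.conj β⁻¹ * ω * MulAut.conj α) σ =
      β⁻¹ * ω (α * σ * α⁻¹) * β := by
    rw [MulAut.mul_apply, MulAut.mul_apply, MulAut.conj_apply, MulAut.conj_apply, inv_inv]
  refine ⟨MulAut.conj β⁻¹ * ω * MulAut.conj α, fun g hg => ?_, fun σ => ?_, fun σ => ?_,
    fun σ => ?_⟩
  · rcases hω.cases g with ⟨σ, h⟩ | ⟨σ, h⟩
    · refine ⟨α⁻¹ * σ * α, hp ?_⟩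
      rw [hω']
      convert h using 2 <;> group
    · exact (hC.not_preserves_and_interchanges hg h.interchanges).elim
  · obtain ⟨g, h⟩ := hω.permutes (α * σ * α⁻¹)
    refine ⟨g, hp ?_⟩
    rw [hω']
    convert h using 1
    group
  · obtain ⟨g, h⟩ := hω.swaps (β * σ * α⁻¹)
    refine ⟨g, α⁻¹ * ω (β * σ * α⁻¹) * β, hs ?_⟩
    convert h using 1
    group
  · rw [hω', ← inv_inv β, inv_inv β⁻¹, Perm.cycleType_conj]
    apply cycleType_map_eq
    rw [Perm.cycleType_conj]

end Link

/-! ### The order of the stabilizer -/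

section Order

open Equiv

variable {C : Finset Pt} {a : Pt} {r c : Fin 6 → Finset Pt} {ω : MulAut (Perm (Fin 6))}

theorem ncard_range_perm {α : Type*} {f : Perm (Fin 6) → α} (hf : Function.Injective f) :
    (Set.range f).ncard = 720 := by
  rw [← Nat.card_coe_set_eq, Nat.card_range_of_injective hf, Nat.card_eq_fintype_card,
    Fintype.card_perm, Fintype.card_fin]
  rfl

/-- Cosets of the sign subgroup correspond to actions on the twelve demicaps, so counting cosets
becomes counting permutations σ. -/
theorem IsConfiguration.mk_eq_mk_iff (hC : IsConfiguration C a r c) {g h : capStabilizer C} :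
    (QuotientGroup.mk g : capStabilizer C ⧸ signSubgroup C a) = QuotientGroup.mk h ↔
      (∀ i, AG43.act g (r i) = AG43.act h (r i)) ∧ ∀ j, AG43.act g (c j) = AG43.act h (c j) := by
  have key (S : Finset Pt) : AG43.act (g⁻¹ * h : capStabilizer C) S = S ↔ AG43.act g S = AG43.act h S := by
    change AG43.act ((g : Aff)⁻¹ * h) S = S ↔ _
    rw [act_mul, act_eq_iff, inv_inv, eq_comm]
  rw [QuotientGroup.eq, hC.mem_signSubgroup_iff]
  exact and_congr (forall_congr' fun i => key (r i)) (forall_congr' fun j => key (c j))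

theorem IsConfiguration.ncard_preserves (hC : IsConfiguration C a r c) :
    ((QuotientGroup.mk : capStabilizer C → capStabilizer C ⧸ signSubgroup C a) ''
      {g | Preserves g (Set.range r) (Set.range c)}).ncard = 720 := by
  obtain ⟨ω, hω⟩ := hC.exists_isLink
  choose p hp using hω.permutes
  have h : (QuotientGroup.mk : capStabilizer C → capStabilizer C ⧸ signSubgroup C a) ''
      {g | Preserves g (Set.range r) (Set.range c)} = Set.range fun σ => QuotientGroup.mk (p σ) := by
    ext q
    constructor
    · rintro ⟨g, hg, rfl⟩
      rcases hω.cases g with ⟨σ, h⟩ | ⟨σ, h⟩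
      · exact ⟨σ, hC.mk_eq_mk_iff.2 ⟨fun i => ((hp σ).1 i).trans (h.1 i).symm,
          fun j => ((hp σ).2 j).trans (h.2 j).symm⟩⟩
      · exact (hC.not_preserves_and_interchanges hg h.interchanges).elim
    · rintro ⟨σ, rfl⟩
      exact ⟨p σ, (hp σ).preserves, rfl⟩
  rw [h]
  refine ncard_range_perm fun σ σ' e => Equiv.ext fun i => hC.row_injective ?_
  rw [← (hp σ).1, ← (hp σ').1, (hC.mk_eq_mk_iff.1 e).1]

theorem IsConfiguration.ncard_interchanges (hC : IsConfiguration C a r c) :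
    ((QuotientGroup.mk : capStabilizer C → capStabilizer C ⧸ signSubgroup C a) ''
      {g | Interchanges g (Set.range r) (Set.range c)}).ncard = 720 := by
  obtain ⟨ω, hω⟩ := hC.exists_isLink
  choose p hp using hω.swaps
  have h : (QuotientGroup.mk : capStabilizer C → capStabilizer C ⧸ signSubgroup C a) ''
      {g | Interchanges g (Set.range r) (Set.range c)} =
        Set.range fun σ => QuotientGroup.mk (p σ) := by
    ext q
    constructor
    · rintro ⟨g, hg, rfl⟩
      rcases hω.cases g with ⟨σ, h⟩ | ⟨σ, h⟩
      · exact (hC.not_preserves_and_interchanges h.preserves hg).elim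
      · exact ⟨σ, hC.mk_eq_mk_iff.2 ⟨fun i => ((hp σ).1 i).trans (h.1 i).symm,
          fun j => ((hp σ).2 j).trans (h.2 j).symm⟩⟩
    · rintro ⟨σ, rfl⟩
      exact ⟨p σ, (hp σ).interchanges, rfl⟩
  rw [h]
  refine ncard_range_perm fun σ σ' e => Equiv.ext fun i => hC.col_injective ?_
  rw [← (hp σ).1, ← (hp σ').1, (hC.mk_eq_mk_iff.1 e).1]

theorem IsConfiguration.card_quotient (hC : IsConfiguration C a r c) :
    Nat.card (capStabilizer C ⧸ signSubgroup C a) = 1440 := by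
  have h1 := hC.ncard_preserves
  have h2 := hC.ncard_interchanges
  have hd : Disjoint
      ((QuotientGroup.mk : capStabilizer C → capStabilizer C ⧸ signSubgroup C a) ''
        {g | Preserves g (Set.range r) (Set.range c)})
      ((QuotientGroup.mk : capStabilizer C → capStabilizer C ⧸ signSubgroup C a) ''
        {g | Interchanges g (Set.range r) (Set.range c)}) := by
    rw [Set.disjoint_left]
    rintro _ ⟨g, hg, rfl⟩ ⟨h, hh, e⟩
    obtain ⟨e1, -⟩ := hC.mk_eq_mk_iff.1 e
    have hm : AG43.act g (r 0) ∈ Set.range r := hg.1 ▸ Set.mem_image_of_mem _ (Set.mem_range_self 0)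
    have hm' : AG43.act h (r 0) ∈ Set.range c := hh.1 ▸ Set.mem_image_of_mem _ (Set.mem_range_self 0)
    exact Set.disjoint_left.1 hC.disjoint_range hm (e1 0 ▸ hm')
  have h3 := Set.ncard_union_eq hd (Set.finite_of_ncard_ne_zero (by rw [h1]; norm_num))
    (Set.finite_of_ncard_ne_zero (by rw [h2]; norm_num))
  rw [h1, h2, ← Set.image_union] at h3
  have h4 : {g : capStabilizer C | Preserves g (Set.range r) (Set.range c)} ∪
      {g : capStabilizer C | Interchanges g (Set.range r) (Set.range c)} = Set.univ := by
    refine Set.eq_univ_of_forall fun g => ?_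
    exact (hC.xor_preserves_interchanges g.2).imp (fun h => h.1) fun h => h.1
  rwa [h4, Set.image_univ, QuotientGroup.range_mk, Set.ncard_univ] at h3

theorem IsConfiguration.card_capStabilizer (hC : IsConfiguration C a r c) :
    Nat.card (capStabilizer C) = 2880 := by
  rw [Subgroup.card_eq_card_quotient_mul_card_subgroup (signSubgroup C a), hC.card_quotient,
    hC.card_signSubgroup]

end Order

end AG43

namespace AG43

open Finset

/-! ### The action as the full automorphism group -/

section FullAutomorphismGroup

open Equiv

variable {C : Finset Pt} {a : Pt} {r c : Fin 6 → Finset Pt} {ω : MulAut (Perm (Fin 6))}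

theorem IsConfiguration.not_permutesBy_and_swapsBy (hC : IsConfiguration C a r c) {g : Aff}
    {σ τ σ' τ' : Perm (Fin 6)} (h : PermutesBy g r c σ τ) (h' : SwapsBy g r c σ' τ') : False :=
  hC.row_ne_col _ _ ((h.1 0).symm.trans (h'.1 0))

/-- The homomorphism from the stabilizer onto `Aut(S₆)`. -/
theorem IsConfiguration.exists_hom (hC : IsConfiguration C a r c) (hω : IsLink C r c ω) :
    ∃ Φ : capStabilizer C →* MulAut (Perm (Fin 6)),
      Function.Surjective Φ ∧ Φ.ker = signSubgroup C a ∧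
      (∀ (g : capStabilizer C) (σ : Perm (Fin 6)),
        PermutesBy g r c σ (ω σ) → Φ g = MulAut.conj σ) ∧
      ∀ (g : capStabilizer C) (σ : Perm (Fin 6)),
        SwapsBy g r c σ (ω σ) → Φ g = ω * MulAut.conj σ := by
  have hex (g : capStabilizer C) : ∃ φ : MulAut (Perm (Fin 6)),
      (∀ σ, PermutesBy g r c σ (ω σ) → φ = MulAut.conj σ) ∧
        ∀ σ, SwapsBy g r c σ (ω σ) → φ = ω * MulAut.conj σ := by
    rcases hω.cases g with ⟨σ, h⟩ | ⟨σ, h⟩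
    · exact ⟨MulAut.conj σ, fun σ' h' => by rw [(hC.permutesBy_unique h h').1],
        fun σ' h' => (hC.not_permutesBy_and_swapsBy h h').elim⟩
    · exact ⟨ω * MulAut.conj σ, fun σ' h' => (hC.not_permutesBy_and_swapsBy h' h).elim,
        fun σ' h' => by rw [(hC.swapsBy_unique h h').1]⟩
  choose φ hp hs using hex
  have hmul (g h : capStabilizer C) : φ (g * h) = φ g * φ h := by
    rcases hω.cases g with ⟨σ, hg⟩ | ⟨σ, hg⟩ <;> rcases hω.cases h with ⟨σ', hh⟩ | ⟨σ', hh⟩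
    · rw [hp g σ hg, hp h σ' hh, ← map_mul]
      apply hp
      rw [map_mul]
      exact hg.mul hh
    · rw [hp g σ hg, hs h σ' hh, ← mul_assoc, hω.mul_conj, mul_assoc, ← map_mul]
      apply hs
      rw [map_mul, hω.map_map]
      exact hg.mul_swapsBy hh
    · rw [hs g σ hg, hp h σ' hh, mul_assoc, ← map_mul]
      apply hs
      rw [map_mul]
      exact hg.mul_permutesBy hh
    -- Here ω·conj σ·ω·conj σ' = conj(ω σ · σ'), which matches the row action of a product of two
    -- interchanging elements.
    · rw [hs g σ hg, hs h σ' hh, mul_assoc, ← mul_assoc _ ω, hω.mul_conj, mul_assoc, ← mul_assoc,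
        hω.involutive, one_mul, ← map_mul]
      apply hp
      rw [map_mul, hω.map_map]
      exact hg.mul hh
  refine ⟨MonoidHom.mk' φ hmul, fun α => ?_, ?_, hp, hs⟩
  · obtain ⟨σ, rfl | rfl⟩ := exists_eq_conj_or hω.cycleType_swap_zero_one α
    · obtain ⟨g, h⟩ := hω.permutes σ
      exact ⟨g, hp g σ h⟩
    · obtain ⟨g, h⟩ := hω.swaps σ
      exact ⟨g, hs g σ h⟩
  · ext g
    rw [MonoidHom.mem_ker, hC.mem_signSubgroup_iff]
    change φ g = 1 ↔ _
    constructor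
    · intro h
      rcases hω.cases g with ⟨σ, hg⟩ | ⟨σ, hg⟩
      · rw [hp g σ hg, ← map_one MulAut.conj] at h
        obtain rfl := conj_injective h
        rwa [map_one] at hg
      · rw [hs g σ hg, mul_eq_one_iff_eq_inv, ← map_inv] at h
        exact (hω.isOuter _ h).elim
    · intro h
      rw [hp g 1 (by rwa [map_one]), map_one]

/-- The action of the stabilizer on the maximal caps forming a 1-completable pair with `C`. -/
def pairAction (C : Finset Pt) :
    capStabilizer C →* Perm {M : Finset Pt // IsCompletablePair 1 C M} where
  toFun g := {
    toFun := fun M => ⟨act g M, by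
      have h := M.2.act (g : Aff)
      rwa [mem_capStabilizer.1 g.2] at h⟩
    invFun := fun M => ⟨act (g : Aff)⁻¹ M, by
      have h := M.2.act (g : Aff)⁻¹
      rwa [mem_capStabilizer.1 (inv_mem g.2)] at h⟩
    left_inv := fun M => Subtype.ext (act_inv_act _ _)
    right_inv := fun M => Subtype.ext (act_act_inv _ _) }
  map_one' := Equiv.ext fun M => Subtype.ext (act_one _)
  map_mul' g h := Equiv.ext fun M => Subtype.ext (act_mul _ _ _)

theorem pairAction_apply (g : capStabilizer C) (M : {M : Finset Pt // IsCompletablePair 1 C M}) :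
    (pairAction C g M : Finset Pt) = act g M := rfl

theorem IsConfiguration.ker_pairAction (hC : IsConfiguration C a r c) :
    (pairAction C).ker = signSubgroup C a := by
  obtain ⟨ω, hω⟩ := hC.exists_isLink
  ext g
  rw [MonoidHom.mem_ker, hC.mem_signSubgroup_iff]
  constructor
  · intro h
    have hact (i j : Fin 6) : AG43.act g (r i) ∪ AG43.act g (c j) = r i ∪ c j := by
      rw [← act_union]
      exact congrArg Subtype.val (Equiv.congr_fun h ⟨r i ∪ c j, (hC.pair_iff _).2 ⟨i, j, rfl⟩⟩)
    rcases hω.cases g with ⟨σ, hg⟩ | ⟨σ, hg⟩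
    · simp only [hg.1, hg.2, hC.union_eq_union_iff] at hact
      exact ⟨fun i => by rw [hg.1, (hact i i).1, Perm.one_apply],
        fun j => by rw [hg.2, (hact j j).2, Perm.one_apply]⟩
    -- For an interchanging element the row contained in the image of r i ∪ c j depends on j alone,
    -- so not all 36 caps can be fixed.
    · simp only [hg.1, hg.2, union_comm (c _), hC.union_eq_union_iff] at hact
      exact absurd ((hact 0 0).1.symm.trans (hact 1 0).1) (by decide)
  · intro hg
    refine Equiv.ext fun M => Subtype.ext ?_
    obtain ⟨i, j, h⟩ := (hC.pair_iff M).1 M.2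
    rw [pairAction_apply, Perm.one_apply, h, act_union, hg.1, hg.2, Perm.one_apply, Perm.one_apply]

theorem exists_injective_lift {G H K : Type*} [Group G] [Group H] [Group K] {f : G →* H}
    (hf : Function.Surjective f) {k : G →* K} (h : f.ker = k.ker) :
    ∃ l : H →* K, Function.Injective l ∧ ∀ g, l (f g) = k g := by
  have hl (g : G) : f.liftOfSurjective hf ⟨k, h.le⟩ (f g) = k g :=
    f.liftOfRightInverse_comp_apply _ _ ⟨k, h.le⟩ g
  refine ⟨f.liftOfSurjective hf ⟨k, h.le⟩, ?_, hl⟩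
  rw [injective_iff_map_eq_one]
  intro x hx
  obtain ⟨g, rfl⟩ := hf x
  rw [hl, ← MonoidHom.mem_ker, ← h] at hx
  exact hx

end FullAutomorphismGroup

end AG43
-- The theorem for an arbitrary maximal cap
theorem mainTheorem10 (C : Finset AG43.Pt) (hC : AG43.IsMaximalCap C) :
    Nat.card (AG43.capStabilizer C) = 2880 ∧
    (∃ C' C₁ R₁, AG43.IsCorrespondingDecomposition C C' C₁ R₁) ∧
    ∃ a : AG43.Pt, (AG43.IsAnchor a C ∧ ∀ b, AG43.IsAnchor b C → b = a) ∧
    ∀ C' C₁ R₁ : Finset AG43.Pt, AG43.IsCorrespondingDecomposition C C' C₁ R₁ →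
    ∀ 𝓡 𝓒 : Set (Finset AG43.Pt),
      𝓡 = AG43.complements C₁ → 𝓒 = AG43.complements R₁ →
      -- the twelve demicaps and the 36 caps
      (𝓡.ncard = 6 ∧ 𝓒.ncard = 6 ∧ Disjoint 𝓡 𝓒 ∧ ∀ D ∈ 𝓡 ∪ 𝓒, AG43.IsDemicapAt a D) ∧
      ({M | AG43.IsCompletablePair 1 C M} = {M | ∃ R ∈ 𝓡, ∃ D ∈ 𝓒, M = R ∪ D} ∧
        {M | AG43.IsCompletablePair 1 C M}.ncard = 36) ∧
      -- the subgroup consisting of the identity and the point reflection in the anchor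
      (AG43.signSubgroup C a).Normal ∧
      Nat.card (AG43.signSubgroup C a) = 2 ∧
      Nat.card (AG43.capStabilizer C ⧸ AG43.signSubgroup C a) = 1440 ∧
      (∀ g : AG43.capStabilizer C,
        g ∈ AG43.signSubgroup C a ↔ ∀ D ∈ 𝓡 ∪ 𝓒, AG43.act g D = D) ∧
      -- 720 cosets preserve both families, the other 720 interchange them
      (∀ g : AG43.capStabilizer C,
        Xor (AG43.Preserves g 𝓡 𝓒) (AG43.Interchanges g 𝓡 𝓒)) ∧
      ((QuotientGroup.mk : AG43.capStabilizer C → AG43.capStabilizer C ⧸ AG43.signSubgroup C a) ''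
        {g | AG43.Preserves g 𝓡 𝓒}).ncard = 720 ∧
      ((QuotientGroup.mk : AG43.capStabilizer C → AG43.capStabilizer C ⧸ AG43.signSubgroup C a) ''
        {g | AG43.Interchanges g 𝓡 𝓒}).ncard = 720 ∧
      -- for every numbering, the two actions differ by an outer automorphism
      (∀ r c : Fin 6 → Finset AG43.Pt, AG43.IsNumbering r 𝓡 → AG43.IsNumbering c 𝓒 →
        ∃ ω : MulAut (Equiv.Perm (Fin 6)), AG43.IsOuter ω ∧
          (∀ g : AG43.capStabilizer C, AG43.Preserves g 𝓡 𝓒 →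
            ∃ σ, AG43.PermutesBy g r c σ (ω σ)) ∧
          (∀ σ, ∃ g : AG43.capStabilizer C, AG43.PermutesBy g r c σ (ω σ)) ∧
          (∀ σ, ∃ g : AG43.capStabilizer C, ∃ τ, AG43.SwapsBy g r c σ τ) ∧
          (∀ σ : Equiv.Perm (Fin 6), σ.cycleType = {2} → (ω σ).cycleType = {2, 2, 2}) ∧
          (∀ σ : Equiv.Perm (Fin 6), σ.cycleType = {2, 2, 2} → (ω σ).cycleType = {2}) ∧
          (∀ σ : Equiv.Perm (Fin 6), σ.cycleType = {6} → (ω σ).cycleType = {2, 3})) ∧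
      -- for a suitable numbering, the interchanging elements have the same form, and the action
      -- on the caps is that of the full automorphism group
      ∃ r c : Fin 6 → Finset AG43.Pt, AG43.IsNumbering r 𝓡 ∧ AG43.IsNumbering c 𝓒 ∧
        ∃ ω : MulAut (Equiv.Perm (Fin 6)), AG43.IsOuter ω ∧ ω * ω = 1 ∧
          ω (Equiv.swap 0 1) = Equiv.swap 0 1 * Equiv.swap 2 3 * Equiv.swap 4 5 ∧
          (∀ g : AG43.capStabilizer C,
            (∃ σ, AG43.PermutesBy g r c σ (ω σ)) ∨ ∃ σ, AG43.SwapsBy g r c σ (ω σ)) ∧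
          (∀ σ, ∃ g : AG43.capStabilizer C, AG43.PermutesBy g r c σ (ω σ)) ∧
          (∀ σ, ∃ g : AG43.capStabilizer C, AG43.SwapsBy g r c σ (ω σ)) ∧
          ∃ Φ : AG43.capStabilizer C →* MulAut (Equiv.Perm (Fin 6)),
            Function.Surjective Φ ∧ Φ.ker = AG43.signSubgroup C a ∧
            (∀ (g : AG43.capStabilizer C) (σ : Equiv.Perm (Fin 6)),
              AG43.PermutesBy g r c σ (ω σ) → Φ g = MulAut.conj σ) ∧
            (∀ (g : AG43.capStabilizer C) (σ : Equiv.Perm (Fin 6)),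
              AG43.SwapsBy g r c σ (ω σ) → Φ g = ω * MulAut.conj σ) ∧
            ∃ ρ : MulAut (Equiv.Perm (Fin 6)) →*
                Equiv.Perm {M : Finset AG43.Pt // AG43.IsCompletablePair 1 C M},
              Function.Injective ρ ∧
              ∀ (g : AG43.capStabilizer C)
                (M : {M : Finset AG43.Pt // AG43.IsCompletablePair 1 C M}),
                ((ρ (Φ g) M : {M : Finset AG43.Pt // AG43.IsCompletablePair 1 C M}) :
                  Finset AG43.Pt) = AG43.act g M := by
  obtain ⟨C₀, D₀, E₀, h₀⟩ := hC.exists_decomposition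
  obtain ⟨a, r₀, c₀, hconf, -, -⟩ := h₀.exists_configuration
  refine ⟨hconf.card_capStabilizer, ⟨C₀, D₀, E₀, h₀⟩, a, ⟨hconf.anchor, hconf.anchor_unique⟩, ?_⟩
  rintro C' C₁ R₁ hdec 𝓡 𝓒 h𝓡 h𝓒
  -- Each decomposition brings its own configuration; uniqueness of the anchor of `C` identifies its
  -- point `b` with `a`.
  obtain ⟨b, r, c, hrc, hr, hc⟩ := hdec.exists_configuration
  obtain rfl := hconf.anchor_unique b hrc.anchor
  rw [hr] at h𝓡
  rw [hc] at h𝓒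
  subst h𝓡 h𝓒
  obtain ⟨ω, hω⟩ := hrc.exists_isLink
  obtain ⟨Φ, hΦ, hker, hp, hs⟩ := hrc.exists_hom hω
  -- Φ and the action on the 36 caps have the same kernel, so the action factors through the
  -- surjection Φ injectively.
  obtain ⟨ρ, hρ, hρΦ⟩ := AG43.exists_injective_lift hΦ (hker.trans hrc.ker_pairAction.symm)
  have hcard {f : Fin 6 → Finset AG43.Pt} (hf : Function.Injective f) :
      (Set.range f).ncard = 6 := by
    rw [← Nat.card_coe_set_eq, Nat.card_range_of_injective hf, Nat.card_fin]
  refine ⟨⟨hcard hrc.row_injective, hcard hrc.col_injective, hrc.disjoint_range, ?_⟩,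
    ⟨?_, hrc.ncard_completable⟩, hker ▸ Φ.normal_ker, hrc.card_signSubgroup, hrc.card_quotient,
    hrc.mem_signSubgroup_iff_fixes, fun g => hrc.xor_preserves_interchanges g.2,
    hrc.ncard_preserves, hrc.ncard_interchanges, fun r' c' hr' hc' => ?_,
    r, c, ⟨hrc.row_injective, rfl⟩, ⟨hrc.col_injective, rfl⟩, ω, hω.isOuter, hω.involutive,
    hω.map_swap_zero_one, hω.cases, hω.permutes, hω.swaps, Φ, hΦ, hker, hp, hs, ρ, hρ,
    fun g M => ?_⟩
  · rintro D (⟨i, rfl⟩ | ⟨j, rfl⟩)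
    · exact hrc.row_demicap i
    · exact hrc.col_demicap j
  · ext M
    rw [Set.mem_ofPred_eq, hrc.pair_iff]
    simp only [Set.mem_ofPred_eq, Set.exists_range_iff]
  · obtain ⟨ω', h1, h2, h3, h4⟩ := hω.renumber hrc hr' hc'
    exact ⟨ω', AG43.isOuter_of_cycleType ((h4 _).trans hω.cycleType_swap_zero_one), h1, h2, h3,
      fun σ hσ => (h4 σ).trans (hω.cycleType_of_two hσ),
      fun σ hσ => (h4 σ).trans (hω.cycleType_of_triple hσ),
      fun σ hσ => (h4 σ).trans (hω.cycleType_of_six hσ)⟩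
  · rw [hρΦ]
    rfl
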